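/- Let $p,q\in\mathbb{C}^*$ with $|p|<|q|<1$. Write $(u;q)_\infty=\prod_{\nu\ge 0}(1-q^\nu u)$, $(u;p,q)_\infty=\prod_{\mu,\nu\ge 0}(1-p^\mu q^\nu u)$, and $$\theta(u;p)=(u;p)_\infty\,(p/u;p)_\infty,\qquad \Gamma(u;p,q)=\frac{(pq/u;p,q)_\infty}{(u;p,q)_\infty},$$ with $\theta(u_1,\dots,u_m;p)=\prod_j\theta(u_j;p)$ and $\Gamma(u_1,\dots,u_m;p,q)=\prod_j\Gamma(u_j;p,q)$. For $a=(a_1,\dots,a_5)\in(\mathbb{C}^*)^5$ and $z=(z_1,z_2)\in(\mathbb{C}^*)^2$ put $$\Phi_+(a;z)=\frac{\prod_{k=1}^5\Gamma(a_kz_2,\,a_kz_1z_2,\,a_kz_1z_2^2;p,q)}{\Gamma(z_2,\,z_1z_2,\,z_1z_2^2,\,z_1,\,z_1z_2^3,\,z_1^2z_2^3;p,q)},\qquad \Phi(a;z)=\Phi_+(a;z)\,\Phi_+(a;z^{-1}),$$ where $z^{-1}=(z_1^{-1},z_2^{-1})$, and, when $|a_i|<1$ for $1\le i\le 5$, put $$I(a)=I(a_1,\dots,a_5)=\frac{1}{(2\pi\sqrt{-1})^2}\iint_{|z_1|=|z_2|=1}\Phi(a;z)\,\frac{dz_1}{z_1}\frac{dz_2}{z_2}.$$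 Suppose that $(a_1a_2a_3a_4a_5)^2=pq$, $|a_i|<1$ for $1\le i\le 4$, and $|a_5|<|q|$. Then for each $k=1,\dots,4$, $$\begin{aligned} I(a_1,\dots,qa_k,\dots,a_4,q^{-1}a_5)&=I(a_1,\dots,a_5)\,\frac{\theta(a_k^2,\;qa_k^2,\;q^{-1}a_5,\;a_1a_2a_3a_4;p)}{\theta(q^{-2}a_5^2,\;q^{-1}a_5^2,\;a_k,\;q^{-1}a_1a_2a_3a_4a_5/a_k;p)}\\ &\quad\times\prod_{\substack{1\le i\le 4\\ i\ne k}}\frac{\theta(a_ka_i;p)}{\theta(q^{-1}a_5a_i;p)}\prod_{\substack{1\le i<j\le 4\\ i,j\ne k}}\frac{\theta(a_ka_ia_j;p)}{\theta(q^{-1}a_5a_ia_j;p)}.\end{aligned}$$ -/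

import Mathlib

/-- The infinite product `(u; q)_∞ = ∏_{ν ≥ 0} (1 - q^ν u)`. -/
noncomputable def qPoch (u q : ℂ) : ℂ := ∏' ν : ℕ, (1 - q ^ ν * u)

/-- The double infinite product `(u; p, q)_∞ = ∏_{μ, ν ≥ 0} (1 - p^μ q^ν u)`. -/
noncomputable def pqPoch (u p q : ℂ) : ℂ := ∏' m : ℕ × ℕ, (1 - p ^ m.1 * q ^ m.2 * u)

/-- The theta function `θ(u; p) = (u; p)_∞ (p / u; p)_∞`. -/
noncomputable def ellTheta (u p : ℂ) : ℂ := qPoch u p * qPoch (p / u) p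

/-- The Ruijsenaars elliptic gamma function `Γ(u; p, q) = (p q / u; p, q)_∞ / (u; p, q)_∞`.
At its poles the value is `0`. -/
noncomputable def ellGamma (u p q : ℂ) : ℂ := pqPoch (p * q * u⁻¹) p q / pqPoch u p q

/-- The half `Φ₊(a; z)` of the integrand, attached to the positive roots of `G₂`, in the
coordinates `z 0 = z₁`, `z 1 = z₂` given by the simple roots. At the zeros of `1 / Γ` the value
is `0`, as it should be. -/
noncomputable def g2PhiPlus (p q : ℂ) (a : Fin 5 → ℂ) (z : Fin 2 → ℂ) : ℂ :=
  (∏ k : Fin 5, ellGamma (a k * z 1) p q * ellGamma (a k * (z 0 * z 1)) p q *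
      ellGamma (a k * (z 0 * z 1 ^ 2)) p q) /
    (ellGamma (z 1) p q * ellGamma (z 0 * z 1) p q * ellGamma (z 0 * z 1 ^ 2) p q *
      ellGamma (z 0) p q * ellGamma (z 0 * z 1 ^ 3) p q * ellGamma (z 0 ^ 2 * z 1 ^ 3) p q)

/-- The integrand `Φ(a; z) = Φ₊(a; z) Φ₊(a; z⁻¹)`, where `z⁻¹ = (z₁⁻¹, z₂⁻¹)`. -/
noncomputable def g2Phi (p q : ℂ) (a : Fin 5 → ℂ) (z : Fin 2 → ℂ) : ℂ :=
  g2PhiPlus p q a z * g2PhiPlus p q a z⁻¹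

/-- The integral `I(a) = (2πi)⁻² ∬ Φ(a; z) (dz₁/z₁) (dz₂/z₂)` over the torus
`|z₁| = |z₂| = 1`, both circles being positively oriented. -/
noncomputable def g2Integral (p q : ℂ) (a : Fin 5 → ℂ) : ℂ :=
  1 / (2 * (Real.pi : ℂ) * Complex.I) ^ 2 *
    torusIntegral (fun z : Fin 2 → ℂ => g2Phi p q a z / (z 0 * z 1)) 0 (fun _ => 1)

/-- The parameters `(a₁, …, q a_k, …, a₄, q⁻¹ a₅)`, for `k` among the first four indices. -/
noncomputable def qShift (q : ℂ) (k : Fin 4) (a : Fin 5 → ℂ) : Fin 5 → ℂ :=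
  Function.update (Function.update a k.castSucc (q * a k.castSucc))
    (Fin.last 4) (q⁻¹ * a (Fin.last 4))

/-! The identity is a contiguity relation for the integral `I`, read off from a vanishing integral.
Write `w = a_k`, `l = q⁻¹ a₅`, let `b₁, b₂, b₃` be the other three parameters, and use the short
roots `x₁ = z₂`, `x₂ = z₁ z₂`, `x₃ = (z₁ z₂²)⁻¹` as coordinates. The reflection formula for `Γ`
turns the denominator of `Φ` into the product of two Weyl denominators `weylTheta p x` and
`weylTheta q x`, so that `Φ` is a product of gamma functions times these (`g2Phi_eq`).
Since `Γ(q u) = θ(u; p) Γ(u)`, both sides of the identity are integrals against the same weight,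
that with parameters `(w, l, b)`: `I(a)` carries the additional factor `∏ θ(l x^α; p)` over the short
roots, and the shifted integral carries `∏ θ(w x^α; p)` (`orbitGamma_mul`).

Multiply the gamma factors and `weylTheta q x` by the theta function `numTheta`. The balancing
condition, which reads `(w l b₁ b₂ b₃)² q = p`, makes the result change by a sign when the shift
`x₁ → q x₁`, `x₂ → q⁻¹ x₂` is combined with the exchange of `x₁` and `x₂`
(`shiftIntegrand_shift`), and no pole is met when the contour is moved by the shift. Hence its
integral is its own opposite (`torusMean_eq_zero_of_shift`). As `weylTheta q` is antisymmetric in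
`x₁, x₂, x₃`, only the alternating sum `altTheta` of `numTheta` over the permutations matters
(`torusMean_mul_antisymmetrization`).

The alternating sum is `- weylTheta p x` times a combination of `∏ θ(l x^α; p)` and `∏ θ(w x^α; p)`
(`altTheta_eq`). Both sides have the same quasi-periods and symmetries, and such a function is zero
if it vanishes at `x₁ = w` and at `x₁ = l`, by a count of zeros in one variable
(`eq_zero_of_antisymmetric`). At `x₁ = w` four of the six terms are zero, and the other two are
added by the three term relation of Weierstrass, used once to factor `numTheta`
(`evenTheta_restrict`) and once for the sum (`weierstrass_five`). The coefficients `contiguityCoeff`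
come out as products, which the duplication formula `ellTheta_sq` brings to the required form
(`contiguityCoeff_mul`). -/

section

open Filter Topology MeasureTheory

/-! ### Infinite products and the theta function -/

/-- The products `∏ (1 - cᵢ u)` with `∑ ‖cᵢ‖ < ∞` are entire functions of `u`. -/
theorem differentiable_tprod_one_sub_mul {ι : Type*} {c : ι → ℂ} (hc : Summable fun i => ‖c i‖) :
    Differentiable ℂ fun u : ℂ => ∏' i, (1 - c i * u) := by
  intro u
  have hU : IsOpen (Metric.ball (0 : ℂ) (‖u‖ + 1)) := Metric.isOpen_ball
  have h := Summable.hasProdLocallyUniformlyOn_one_add (f := fun i (x : ℂ) => -(c i * x))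
    hU (hc.mul_right (‖u‖ + 1))
    (.of_forall fun i x hx => by
      rw [norm_neg, norm_mul]
      gcongr
      simpa using (Metric.mem_ball.1 hx).le) (fun i => by fun_prop)
  have h2 := h.differentiableOn (.of_forall fun _ => by
    simpa [Finset.prod_fn] using DifferentiableOn.finsetProd (fun _ _ => by fun_prop)) hU
  have h3 := h2.differentiableAt (hU.mem_nhds (by simp : u ∈ Metric.ball (0 : ℂ) (‖u‖ + 1)))
  simpa only [sub_eq_add_neg] using h3

theorem multipliable_one_sub_mul {ι : Type*} {c : ι → ℂ} (hc : Summable fun i => ‖c i‖) (u : ℂ) :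
    Multipliable fun i => 1 - c i * u := by
  simp only [sub_eq_add_neg]
  exact multipliable_one_add_of_summable (by simpa using hc.mul_right ‖u‖)

theorem tprod_one_sub_mul_ne_zero {ι : Type*} {c : ι → ℂ} (hc : Summable fun i => ‖c i‖) {u : ℂ}
    (h : ∀ i, c i * u ≠ 1) : ∏' i, (1 - c i * u) ≠ 0 := by
  simp only [sub_eq_add_neg]
  refine tprod_one_add_ne_zero_of_summable (fun i => ?_) (by simpa using hc.mul_right ‖u‖)
  rw [← sub_eq_add_neg]
  exact sub_ne_zero.2 (h i).symm

theorem summable_norm_pow {q : ℂ} (hq : ‖q‖ < 1) : Summable fun n : ℕ => ‖q ^ n‖ := by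
  simpa using summable_geometric_of_lt_one (norm_nonneg _) hq

theorem summable_norm_pow_mul_pow {p q : ℂ} (hp : ‖p‖ < 1) (hq : ‖q‖ < 1) :
    Summable fun m : ℕ × ℕ => ‖p ^ m.1 * q ^ m.2‖ := by
  simpa only [norm_mul] using
    Summable.mul_of_nonneg (summable_norm_pow hp) (summable_norm_pow hq)
      (fun _ => norm_nonneg _) (fun _ => norm_nonneg _)

theorem differentiable_qPoch {q : ℂ} (hq : ‖q‖ < 1) : Differentiable ℂ fun u => qPoch u q :=
  differentiable_tprod_one_sub_mul (summable_norm_pow hq)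

theorem qPoch_ne_zero {u q : ℂ} (hq : ‖q‖ < 1) (h : ∀ n : ℕ, q ^ n * u ≠ 1) : qPoch u q ≠ 0 :=
  tprod_one_sub_mul_ne_zero (summable_norm_pow hq) h

theorem qPoch_eq_mul {q : ℂ} (hq : ‖q‖ < 1) (u : ℂ) :
    qPoch u q = (1 - u) * qPoch (q * u) q := by
  unfold qPoch
  have h := multipliable_one_sub_mul (summable_norm_pow hq) (q * u)
  rw [tprod_eq_zero_mul']
  · simp [pow_succ, mul_assoc]
  · simpa [pow_succ, mul_assoc] using h

theorem norm_pow_mul_lt_one {q u : ℂ} (hq : ‖q‖ < 1) (hu : ‖u‖ < 1) (n : ℕ) : ‖q ^ n * u‖ < 1 := by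
  rw [norm_mul, norm_pow]
  exact (mul_le_of_le_one_left (norm_nonneg _) (pow_le_one₀ (norm_nonneg _) hq.le)).trans_lt hu

theorem ne_one_of_norm_lt {z : ℂ} (h : ‖z‖ < 1) : z ≠ 1 := by
  rintro rfl
  simp at h

theorem qPoch_ne_zero_of_norm_lt {u q : ℂ} (hq : ‖q‖ < 1) (hu : ‖u‖ < 1) : qPoch u q ≠ 0 :=
  qPoch_ne_zero hq fun n => ne_one_of_norm_lt (norm_pow_mul_lt_one hq hu n)

/-- Splitting the factors by parity gives `(u²; r²) = (u; r²) (-u; r²) (r u; r²) (-r u; r²)`. -/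
theorem qPoch_sq {r : ℂ} (hr : ‖r‖ < 1) (u : ℂ) :
    qPoch (u ^ 2) (r ^ 2) =
      qPoch u (r ^ 2) * qPoch (-u) (r ^ 2) * qPoch (r * u) (r ^ 2) * qPoch (-(r * u)) (r ^ 2) := by
  have hr2 : ‖r ^ 2‖ < 1 := by rw [norm_pow]; exact pow_lt_one₀ (norm_nonneg _) hr two_ne_zero
  have split : ∀ v : ℂ, qPoch v r = qPoch v (r ^ 2) * qPoch (r * v) (r ^ 2) := by
    intro v
    have e1 := multipliable_one_sub_mul (summable_norm_pow hr2) v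
    have e2 := multipliable_one_sub_mul (summable_norm_pow hr2) (r * v)
    unfold qPoch
    rw [← tprod_even_mul_odd]
    · congr 1
      · simp only [pow_mul]
      · simp only [pow_succ, pow_mul, pow_zero, one_mul, mul_assoc]
    · simpa only [pow_mul] using e1
    · simpa only [pow_succ, pow_mul, pow_zero, one_mul, mul_assoc] using e2
  have h : qPoch (u ^ 2) (r ^ 2) = qPoch u r * qPoch (-u) r := by
    unfold qPoch
    rw [← Multipliable.tprod_mul (multipliable_one_sub_mul (summable_norm_pow hr) u)
      (multipliable_one_sub_mul (summable_norm_pow hr) (-u))]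
    congr 1
    ext n
    ring
  rw [h, split u, split (-u)]
  ring_nf

theorem ellTheta_ne_zero {u p : ℂ} (hp : ‖p‖ < 1) (hu : ∀ m : ℤ, u ≠ p ^ m) :
    ellTheta u p ≠ 0 := by
  refine mul_ne_zero (qPoch_ne_zero hp fun n h => ?_) (qPoch_ne_zero hp fun n h => ?_)
  · refine hu (-n) ?_
    rw [zpow_neg, zpow_natCast]
    exact eq_inv_of_mul_eq_one_right h
  · have hu0 : u ≠ 0 := by
      rintro rfl
      simp at h
    refine hu (n + 1) ?_
    rw [← Nat.cast_succ, zpow_natCast, pow_succ]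
    field_simp at h
    exact h.symm

theorem ellTheta_ne_zero_of_norm {u p : ℂ} (h1 : ‖p‖ < ‖u‖) (h2 : ‖u‖ < 1) :
    ellTheta u p ≠ 0 := by
  have hp : ‖p‖ < 1 := h1.trans h2
  have hu : 0 < ‖u‖ := (norm_nonneg _).trans_lt h1
  refine mul_ne_zero (qPoch_ne_zero_of_norm_lt hp h2) (qPoch_ne_zero_of_norm_lt hp ?_)
  rwa [norm_div, div_lt_one hu]

theorem ellTheta_one (p : ℂ) : ellTheta 1 p = 0 := by
  have : qPoch 1 p = 0 := by
    unfold qPoch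
    exact tprod_of_exists_eq_zero ⟨0, by simp⟩
  rw [ellTheta, this, zero_mul]

theorem ellTheta_inv {p u : ℂ} (hp : ‖p‖ < 1) (hu : u ≠ 0) :
    ellTheta u⁻¹ p = -u⁻¹ * ellTheta u p := by
  unfold ellTheta
  rw [qPoch_eq_mul hp u⁻¹, qPoch_eq_mul hp u, div_inv_eq_mul, ← div_eq_mul_inv]
  field_simp
  ring

theorem ellTheta_mul {p u : ℂ} (hp0 : p ≠ 0) (hp : ‖p‖ < 1) (hu : u ≠ 0) :
    ellTheta (p * u) p = -u⁻¹ * ellTheta u p := by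
  rw [← ellTheta_inv hp hu]
  unfold ellTheta
  rw [mul_comm, div_inv_eq_mul]
  congr 2
  field_simp

theorem ellTheta_div {p u : ℂ} (hp0 : p ≠ 0) (hp : ‖p‖ < 1) (hu : u ≠ 0) :
    ellTheta (u / p) p = -(u / p) * ellTheta u p := by
  have h := ellTheta_mul hp0 hp (div_ne_zero hu hp0)
  rw [mul_div_cancel₀ _ hp0] at h
  rw [h]
  field_simp

theorem differentiableAt_ellTheta {p u : ℂ} (hp : ‖p‖ < 1) (hu : u ≠ 0) :
    DifferentiableAt ℂ (fun u => ellTheta u p) u := by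
  unfold ellTheta
  exact (differentiable_qPoch hp u).mul ((differentiable_qPoch hp (p / u)).comp u
    ((differentiableAt_const p).div differentiableAt_id hu))

/-- The duplication formula for the theta function, the base being a square. -/
theorem ellTheta_sq {r u : ℂ} (hr : r ≠ 0) (hr1 : ‖r‖ < 1) (hu : u ≠ 0) :
    ellTheta (u ^ 2) (r ^ 2) =
      ellTheta u (r ^ 2) * ellTheta (-u) (r ^ 2) * ellTheta (r * u) (r ^ 2) *
        ellTheta (-(r * u)) (r ^ 2) := by
  unfold ellTheta
  rw [qPoch_sq hr1, ← div_pow, qPoch_sq hr1 (r / u)]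
  have e1 : r ^ 2 / -u = -(r * (r / u)) := by rw [div_neg]; ring
  have e2 : r ^ 2 / (r * u) = r / u := by field_simp
  have e3 : r ^ 2 / -(r * u) = -(r / u) := by rw [div_neg, e2]
  have e4 : r ^ 2 / u = r * (r / u) := by ring
  rw [e1, e2, e3, e4]
  ring

/-- The zeros of the theta function are simple. -/
theorem deriv_ellTheta_ne_zero {p u : ℂ} (hp0 : p ≠ 0) (hp : ‖p‖ < 1)
    (h : ellTheta u p = 0) : deriv (fun u => ellTheta u p) u ≠ 0 := by
  have key : ∀ v : ℂ, v ≠ 0 → ellTheta v p = 0 →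
      p * deriv (fun u => ellTheta u p) (p * v) = -v⁻¹ * deriv (fun u => ellTheta u p) v := by
    intro v hv h0
    have hA : HasDerivAt (fun u => ellTheta (p * u) p)
        (p * deriv (fun u => ellTheta u p) (p * v)) v := by
      have := (differentiableAt_ellTheta hp (mul_ne_zero hp0 hv)).hasDerivAt.comp v
        ((hasDerivAt_id v).const_mul p)
      simpa [mul_comm, Function.comp_def] using this
    have hB : HasDerivAt (fun u => -u⁻¹ * ellTheta u p)
        (-v⁻¹ * deriv (fun u => ellTheta u p) v) v := by
      have := ((hasDerivAt_inv hv).fun_neg).fun_mul (differentiableAt_ellTheta hp hv).hasDerivAt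
      simpa [h0] using this
    refine hA.unique (hB.congr_of_eventuallyEq ?_)
    filter_upwards [isOpen_ne.mem_nhds hv] with z hz
    exact ellTheta_mul hp0 hp hz
  have one : deriv (fun u => ellTheta u p) 1 ≠ 0 := by
    have hd : DifferentiableAt ℂ (fun u => qPoch (p * u) p * qPoch (p / u) p) 1 := by
      refine DifferentiableAt.mul ?_ ?_
      · exact (differentiable_qPoch hp _).comp (1 : ℂ) (by fun_prop)
      · exact (differentiable_qPoch hp _).comp (1 : ℂ)
          ((differentiableAt_const p).div differentiableAt_id one_ne_zero)
    have h1 : HasDerivAt (fun u : ℂ => (1 - u) * (qPoch (p * u) p * qPoch (p / u) p))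
        (-(qPoch p p * qPoch p p)) 1 := by
      have := ((hasDerivAt_id' (1 : ℂ)).const_sub 1).fun_mul hd.hasDerivAt
      simpa using this
    have h2 : (fun u => ellTheta u p) = fun u : ℂ =>
        (1 - u) * (qPoch (p * u) p * qPoch (p / u) p) := by
      funext u
      rw [ellTheta, qPoch_eq_mul hp u, mul_assoc]
    rw [h2, h1.deriv]
    have := qPoch_ne_zero_of_norm_lt hp hp
    simpa using this
  have hz : ∀ m : ℤ, ellTheta (p ^ m) p = 0 ∧ deriv (fun u => ellTheta u p) (p ^ m) ≠ 0 := by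
    intro m
    induction m using Int.induction_on with
    | zero => simpa using ⟨ellTheta_one p, one⟩
    | succ n ih =>
      have hn : p ^ (n : ℤ) ≠ 0 := zpow_ne_zero _ hp0
      rw [add_comm, zpow_add₀ hp0, zpow_one]
      refine ⟨by rw [ellTheta_mul hp0 hp hn, ih.1, mul_zero], fun h0 => ?_⟩
      have := key _ hn ih.1
      rw [h0, mul_zero] at this
      exact mul_ne_zero (neg_ne_zero.2 (inv_ne_zero hn)) ih.2 this.symm
    | pred n ih =>
      have hn : p ^ (-(n : ℤ) - 1) ≠ 0 := zpow_ne_zero _ hp0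
      have e : p ^ (-(n : ℤ)) = p * p ^ (-(n : ℤ) - 1) := by
        rw [zpow_sub₀ hp0, zpow_one]
        field_simp
      have h0 : ellTheta (p ^ (-(n : ℤ) - 1)) p = 0 := by
        have := ih.1
        rw [e, ellTheta_mul hp0 hp hn] at this
        simpa [hn] using this
      refine ⟨h0, fun h1 => ?_⟩
      have := key _ hn h0
      rw [h1, mul_zero, ← e] at this
      exact mul_ne_zero hp0 ih.2 this
  by_contra hd
  refine ellTheta_ne_zero hp (fun m hm => ?_) h
  exact (hz m).2 (hm ▸ hd)

/-! ### Theta functions with too many zeros vanish -/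

/-- A continuous function on `ℂ \ {0}` that vanishes off a countable set vanishes. -/
theorem eq_zero_of_countable_compl {f : ℂ → ℂ} (hf : ∀ z ≠ 0, ContinuousAt f z) {S : Set ℂ}
    (hS : S.Countable) (h0 : ∀ z ≠ 0, z ∉ S → f z = 0) {z : ℂ} (hz : z ≠ 0) : f z = 0 := by
  by_contra hne
  have hd : Dense (insert 0 S)ᶜ := (hS.insert 0).dense_compl ℂ
  obtain ⟨w, hw, hwS⟩ := mem_closure_iff_nhds.1 (hd z) _ ((hf z hz).eventually_ne hne)
  simp only [Set.mem_compl_iff, Set.mem_insert_iff, not_or] at hwS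
  exact hw (h0 w hwS.1 hwS.2)

theorem countable_setOf_eq_zpow_mul (p c : ℂ) : {z : ℂ | ∃ m : ℤ, z = p ^ m * c}.Countable := by
  have : {z : ℂ | ∃ m : ℤ, z = p ^ m * c} = Set.range fun m : ℤ => p ^ m * c := by
    ext z
    simp [eq_comm]
  rw [this]
  exact Set.countable_range _

/-- A holomorphic function can be divided by one with simple zeros, if it vanishes at these. -/
theorem exists_differentiableAt_quotient {U : Set ℂ} (hU : IsOpen U) {h t : ℂ → ℂ}
    (hh : DifferentiableOn ℂ h U) (ht : DifferentiableOn ℂ t U)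
    (hz : ∀ z ∈ U, t z = 0 → h z = 0 ∧ deriv t z ≠ 0) :
    ∃ g : ℂ → ℂ, DifferentiableOn ℂ g U ∧ ∀ z ∈ U, h z = t z * g z := by
  classical
  refine ⟨fun z => if t z = 0 then deriv h z / deriv t z else h z / t z, fun z hzU => ?_,
    fun z hzU => ?_⟩
  · refine DifferentiableAt.differentiableWithinAt ?_
    have hzn := hU.mem_nhds hzU
    have hhz := hh.differentiableAt hzn
    have htz := ht.differentiableAt hzn
    by_cases h0 : t z = 0
    · obtain ⟨h1, h2⟩ := hz z hzU h0
      have dh := ((Complex.differentiableOn_dslope hzn).2 hh).differentiableAt hzn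
      have dt := ((Complex.differentiableOn_dslope hzn).2 ht).differentiableAt hzn
      have hne : dslope t z z ≠ 0 := by rwa [dslope_same]
      refine (dh.div dt hne).congr_of_eventuallyEq ?_
      filter_upwards [dt.continuousAt.eventually_ne hne] with w hw
      rcases eq_or_ne w z with rfl | hwz
      · simp [h0]
      · have et : t w = (w - z) * dslope t z w := by
          rw [dslope_of_ne _ hwz, slope_def_field, h0, sub_zero,
            mul_div_cancel₀ _ (sub_ne_zero.2 hwz)]
        have eh : h w = (w - z) * dslope h z w := by
          rw [dslope_of_ne _ hwz, slope_def_field, h1, sub_zero,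
            mul_div_cancel₀ _ (sub_ne_zero.2 hwz)]
        have htw : t w ≠ 0 := by
          rw [et]
          exact mul_ne_zero (sub_ne_zero.2 hwz) hw
        simp only [htw, if_false]
        rw [et, eh, mul_div_mul_left _ _ (sub_ne_zero.2 hwz)]
        rfl
    · refine (hhz.div htz h0).congr_of_eventuallyEq ?_
      filter_upwards [htz.continuousAt.eventually_ne h0] with w hw
      simp [hw]
  · by_cases h0 : t z = 0
    · simp [h0, (hz z hzU h0).1]
    · simp only [h0, if_false]
      rw [mul_div_cancel₀ _ h0]

/-- A holomorphic `h` on `ℂ \ {0}` with `h (p z) = C z h z` vanishes: it is bounded near `0`, hence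
extends to an entire function, whose order of vanishing at `0` would have to be infinite. -/
theorem eq_zero_of_map_mul_eq {p C : ℂ} (hp0 : p ≠ 0) (hp : ‖p‖ < 1) {h : ℂ → ℂ}
    (hd : DifferentiableOn ℂ h {0}ᶜ) (hq : ∀ z ≠ 0, h (p * z) = C * z * h z) :
    ∀ z ≠ 0, h z = 0 := by
  have hpn : 0 < ‖p‖ := norm_pos_iff.2 hp0
  obtain ⟨δ, hδ, hCδ⟩ : ∃ δ : ℝ, 0 < δ ∧ ‖C‖ * δ ≤ 1 := by
    refine ⟨(‖C‖ + 1)⁻¹, by positivity, ?_⟩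
    rw [← div_eq_mul_inv, div_le_one (by positivity)]
    linarith
  obtain ⟨M, hM⟩ : ∃ M, ∀ z : ℂ, ‖p‖ * δ ≤ ‖z‖ → ‖z‖ ≤ δ → ‖h z‖ ≤ M := by
    have hK : IsCompact (Metric.closedBall (0 : ℂ) δ \ Metric.ball 0 (‖p‖ * δ)) :=
      (isCompact_closedBall _ _).diff Metric.isOpen_ball
    obtain ⟨M, hM⟩ := hK.exists_bound_of_continuousOn (f := h)
      (hd.continuousOn.mono fun z hz => by
        rintro rfl
        simp at hz
        exact absurd hz.2 (not_le.2 (by positivity)))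
    exact ⟨M, fun z h1 h2 => hM z ⟨by simpa using h2, by simpa using h1⟩⟩
  have hb : ∀ k : ℕ, ∀ z : ℂ, ‖p‖ ^ (k + 1) * δ ≤ ‖z‖ → ‖z‖ ≤ δ → ‖h z‖ ≤ M := by
    intro k
    induction k with
    | zero => simpa using hM
    | succ k ih =>
      intro z h1 h2
      by_cases h3 : ‖p‖ * δ ≤ ‖z‖
      · exact hM z h3 h2
      · have hz : z ≠ 0 := by
          rintro rfl
          rw [norm_zero] at h1
          exact absurd h1 (not_le.2 (by positivity))
        have e : z = p * (z / p) := by field_simp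
        have n1 : ‖z / p‖ ≤ δ := by
          rw [norm_div, div_le_iff₀ hpn]
          linarith
        have n2 : ‖p‖ ^ (k + 1) * δ ≤ ‖z / p‖ := by
          rw [norm_div, le_div_iff₀ hpn]
          calc _ = ‖p‖ ^ (k + 1 + 1) * δ := by ring
            _ ≤ _ := h1
        rw [e, hq _ (div_ne_zero hz hp0), norm_mul, norm_mul]
        have h4 : ‖C‖ * ‖z / p‖ ≤ 1 :=
          (mul_le_mul_of_nonneg_left n1 (norm_nonneg _)).trans hCδ
        exact (mul_le_of_le_one_left (norm_nonneg _) h4).trans (ih _ n2 n1)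
  have hbd : ∀ z : ℂ, z ≠ 0 → ‖z‖ ≤ δ → ‖h z‖ ≤ M := by
    intro z hz hzd
    obtain ⟨k, hk⟩ := exists_pow_lt_of_lt_one (div_pos (norm_pos_iff.2 hz) hδ) hp
    refine hb k z ?_ hzd
    rw [lt_div_iff₀ hδ] at hk
    refine le_trans ?_ hk.le
    gcongr ?_ * δ
    exact pow_le_pow_of_le_one hpn.le hp.le (Nat.le_succ k)
  set G := Function.update h 0 (limUnder (𝓝[≠] 0) h) with hG
  have hGd : Differentiable ℂ G := by
    intro z
    rcases eq_or_ne z 0 with rfl | hz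
    · have hδn := Metric.ball_mem_nhds (0 : ℂ) hδ
      refine (Complex.differentiableOn_update_limUnder_of_bddAbove hδn
        (hd.mono fun z hz => hz.2) ⟨M, ?_⟩).differentiableAt hδn
      rintro _ ⟨z, hz, rfl⟩
      exact hbd z hz.2 (by simpa using (Metric.mem_ball.1 hz.1).le)
    · refine (hd.differentiableAt (isOpen_compl_singleton.mem_nhds hz)).congr_of_eventuallyEq ?_
      filter_upwards [isOpen_ne.mem_nhds hz] with w hw
      simp [hG, hw]
  have hGh : ∀ z ≠ 0, G z = h z := fun z hz => by simp [hG, hz]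
  have hGa : AnalyticAt ℂ G 0 := (hGd.analyticAt 0)
  have hGq : ∀ᶠ z in 𝓝[≠] (0 : ℂ), G (p * z) = C * z * G z := by
    filter_upwards [self_mem_nhdsWithin] with z hz
    rw [hGh _ hz, hGh _ (mul_ne_zero hp0 hz), hq z hz]
  have hG0 : ∀ᶠ z in 𝓝 (0 : ℂ), G z = 0 := by
    by_contra hcon
    obtain ⟨m, u, hu, hu0, hGu⟩ := hGa.exists_eventuallyEq_pow_smul_nonzero_iff.2 hcon
    simp only [sub_zero, smul_eq_mul] at hGu
    have tp : Tendsto (fun z : ℂ => p * z) (𝓝 0) (𝓝 0) := by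
      have : Continuous fun z : ℂ => p * z := by fun_prop
      simpa using this.tendsto 0
    have he : (fun z => p ^ m * u (p * z)) =ᶠ[𝓝[≠] 0] fun z => C * z * u z := by
      filter_upwards [hGq, hGu.filter_mono nhdsWithin_le_nhds,
        (tp.eventually hGu).filter_mono nhdsWithin_le_nhds, self_mem_nhdsWithin]
        with z h1 h2 h3 h4
      rw [h2, h3, mul_pow] at h1
      have : z ^ m ≠ 0 := pow_ne_zero _ h4
      refine mul_left_cancel₀ this ?_
      linear_combination h1
    have uc := hu.continuousAt
    have l1 : Tendsto (fun z => p ^ m * u (p * z)) (𝓝[≠] 0) (𝓝 (p ^ m * u 0)) :=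
      ((uc.tendsto.comp tp).const_mul _).mono_left nhdsWithin_le_nhds
    have l2 : Tendsto (fun z => C * z * u z) (𝓝[≠] 0) (𝓝 (C * 0 * u 0)) :=
      (((tendsto_id.const_mul C).mul uc.tendsto)).mono_left nhdsWithin_le_nhds
    have := tendsto_nhds_unique (l1.congr' he) l2
    simp [hp0, hu0] at this
  have hGz : G = 0 := by
    have h1 : AnalyticOnNhd ℂ G Set.univ := fun z _ => hGd.analyticAt z
    funext z
    exact h1.eqOn_zero_of_preconnected_of_eventuallyEq_zero isPreconnected_univ
      (Set.mem_univ 0) hG0 (Set.mem_univ z)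
  intro z hz
  rw [← hGh z hz, hGz, Pi.zero_apply]

/-- A holomorphic function `h` on `ℂ \ {0}` with `h (p z) = C z⁻ⁿ h z` that has `n + 1` zeros,
distinct modulo `p ^ ℤ`, vanishes. The zeros are divided out one by one. -/
theorem eq_zero_of_zeros {p : ℂ} (hp0 : p ≠ 0) (hp : ‖p‖ < 1) (s : List ℂ) :
    ∀ {h : ℂ → ℂ} {C : ℂ}, DifferentiableOn ℂ h {0}ᶜ →
    (∀ z ≠ 0, h (p * z) = C * z ^ (1 - s.length : ℤ) * h z) →
    (∀ c ∈ s, c ≠ 0 ∧ h c = 0) → s.Pairwise (fun c d => ∀ m : ℤ, d ≠ p ^ m * c) →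
    ∀ z ≠ 0, h z = 0 := by
  induction s with
  | nil =>
    intro h C hd hq _ _
    refine eq_zero_of_map_mul_eq hp0 hp hd (C := C) fun z hz => ?_
    simpa using hq z hz
  | cons c s ih =>
    intro h C hd hq hs hpw z hz
    rw [List.pairwise_cons] at hpw
    obtain ⟨hc0, hc⟩ := hs c (by simp)
    have hdt : ∀ z : ℂ, z ≠ 0 → DifferentiableAt ℂ (fun z => ellTheta (z / c) p) z := fun z hz =>
      DifferentiableAt.comp (f := fun z => z / c) z
        (differentiableAt_ellTheta hp (div_ne_zero hz hc0)) (by fun_prop)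
    -- `h` vanishes on the whole orbit of `c`
    have horb : ∀ m : ℤ, h (p ^ m * c) = 0 := by
      intro m
      have hne : ∀ m : ℤ, p ^ m * c ≠ 0 := fun m => mul_ne_zero (zpow_ne_zero _ hp0) hc0
      have step : ∀ m : ℤ, h (p ^ (m + 1) * c) =
          C * (p ^ m * c) ^ (1 - (c :: s).length : ℤ) * h (p ^ m * c) := by
        intro m
        rw [← hq _ (hne m), zpow_add₀ hp0, zpow_one]
        congr 1
        ring
      by_cases hC : C = 0
      · have := step (m - 1)
        rw [sub_add_cancel, hC] at this
        simpa using this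
      induction m using Int.induction_on with
      | zero => simpa using hc
      | succ n ih => rw [step, ih, mul_zero]
      | pred n ih =>
        have := step (-(n : ℤ) - 1)
        rw [sub_add_cancel, ih] at this
        exact (mul_eq_zero.1 this.symm).resolve_left (mul_ne_zero hC (zpow_ne_zero _ (hne _)))
    obtain ⟨g, hg, hgh⟩ := exists_differentiableAt_quotient isOpen_compl_singleton hd
      (t := fun z => ellTheta (z / c) p) (fun z hz => (hdt z hz).differentiableWithinAt)
      (fun z hz h0 => by
        refine ⟨?_, ?_⟩
        · by_contra hne
          refine ellTheta_ne_zero hp (fun m hm => hne ?_) h0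
          rw [← horb m, ← hm, div_mul_cancel₀ _ hc0]
        · have := (differentiableAt_ellTheta hp (div_ne_zero hz hc0)).hasDerivAt.comp z
            ((hasDerivAt_id z).div_const c)
          have h2 := this.deriv
          simp only [Function.comp_def, id] at h2
          rw [h2]
          exact mul_ne_zero (deriv_ellTheta_ne_zero hp0 hp h0)
            (div_ne_zero one_ne_zero hc0))
    have hcount := countable_setOf_eq_zpow_mul p c
    have hgq : ∀ z ≠ 0, g (p * z) = -(C / c) * z ^ (1 - s.length : ℤ) * g z := by
      intro z hz
      rw [← sub_eq_zero]
      refine eq_zero_of_countable_compl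
        (f := fun z => g (p * z) - -(C / c) * z ^ (1 - s.length : ℤ) * g z) ?_ hcount ?_ hz
      · intro z hz
        have c1 : ContinuousAt g z :=
          (hg.differentiableAt (isOpen_compl_singleton.mem_nhds hz)).continuousAt
        have c2 : ContinuousAt (fun z => g (p * z)) z :=
          ContinuousAt.comp (f := fun z => p * z) (hg.differentiableAt
            (isOpen_compl_singleton.mem_nhds (mul_ne_zero hp0 hz))).continuousAt (by fun_prop)
        exact c2.sub ((continuousAt_const.mul (continuousAt_zpow₀ z _ (Or.inl hz))).mul c1)
      · intro z hz hzc
        have hθ : ellTheta (z / c) p ≠ 0 := ellTheta_ne_zero hp fun m hm =>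
          hzc ⟨m, by rw [← hm, div_mul_cancel₀ _ hc0]⟩
        have h1 := hq z hz
        rw [hgh _ (mul_ne_zero hp0 hz), hgh z hz, mul_div_assoc,
          ellTheta_mul hp0 hp (div_ne_zero hz hc0)] at h1
        have e : (1 - ((c :: s).length : ℤ)) = (1 - (s.length : ℤ)) - 1 := by
          rw [List.length_cons]
          push_cast
          ring
        rw [e, zpow_sub_one₀ hz] at h1
        rw [sub_eq_zero]
        refine mul_left_cancel₀ hθ ?_
        field_simp at h1 ⊢
        linear_combination -h1
    rw [hgh z hz]
    refine mul_eq_zero_of_right _ (ih hg hgq (fun d hds => ?_) hpw.2 z hz)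
    obtain ⟨hd0, hd1⟩ := hs d (by simp [hds])
    refine ⟨hd0, ?_⟩
    rw [hgh d hd0] at hd1
    refine (mul_eq_zero.1 hd1).resolve_left (ellTheta_ne_zero hp fun m hm => ?_)
    exact hpw.1 d hds m (by rw [← hm, div_mul_cancel₀ _ hc0])

/-! ### The three-term relation of Weierstrass -/

@[fun_prop]
theorem DifferentiableAt.ellTheta {E : Type*} [NormedAddCommGroup E] [NormedSpace ℂ E] {p : ℂ}
    {f : E → ℂ} {z : E} (hf : DifferentiableAt ℂ f z)
    (hp : ‖p‖ < 1) (h0 : f z ≠ 0) : DifferentiableAt ℂ (fun z => ellTheta (f z) p) z :=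
  DifferentiableAt.comp (f := f) z (differentiableAt_ellTheta hp h0) hf

@[fun_prop]
theorem ContinuousAt.ellTheta {X : Type*} [TopologicalSpace X] {p : ℂ} {f : X → ℂ} {z : X}
    (hf : ContinuousAt f z) (hp : ‖p‖ < 1) (h0 : f z ≠ 0) :
    ContinuousAt (fun z => ellTheta (f z) p) z :=
  ContinuousAt.comp (f := f) (differentiableAt_ellTheta hp h0).continuousAt hf

theorem ellTheta_mul' {p u v : ℂ} (hp0 : p ≠ 0) (hp : ‖p‖ < 1) (hu : u ≠ 0) (h : v = p * u) :
    ellTheta v p = -u⁻¹ * ellTheta u p := by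
  rw [h, ellTheta_mul hp0 hp hu]

theorem ellTheta_inv' {p u v : ℂ} (hp : ‖p‖ < 1) (hu : u ≠ 0) (h : v = u⁻¹) :
    ellTheta v p = -u⁻¹ * ellTheta u p := by
  rw [h, ellTheta_inv hp hu]

/-- As a function of `t` the difference of the two sides has degree `2`, and it vanishes at `1`,
`ω⁻¹` and `y⁻¹`. -/
theorem weierstrass_generic {p x y ω t : ℂ} (hp0 : p ≠ 0) (hp : ‖p‖ < 1) (hx : x ≠ 0) (hy : y ≠ 0)
    (hω : ω ≠ 0) (ht : t ≠ 0) (gω : ∀ m : ℤ, ω ≠ p ^ m) (gy : ∀ m : ℤ, y ≠ p ^ m)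
    (gωy : ∀ m : ℤ, ω ≠ p ^ m * y) :
    ellTheta x p * ellTheta (ω / x) p * ellTheta (t * y) p * ellTheta (t * (ω / y)) p -
      ellTheta (t * x) p * ellTheta (t * (ω / x)) p * ellTheta y p * ellTheta (ω / y) p -
      y * ellTheta (x / y) p * ellTheta (ω / (x * y)) p * ellTheta t p * ellTheta (t * ω) p = 0 := by
  refine eq_zero_of_zeros hp0 hp [1, ω⁻¹, y⁻¹] (C := ω⁻¹) (h := fun t =>
    ellTheta x p * ellTheta (ω / x) p * ellTheta (t * y) p * ellTheta (t * (ω / y)) p -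
      ellTheta (t * x) p * ellTheta (t * (ω / x)) p * ellTheta y p * ellTheta (ω / y) p -
      y * ellTheta (x / y) p * ellTheta (ω / (x * y)) p * ellTheta t p * ellTheta (t * ω) p)
    ?_ ?_ ?_ ?_ t ht
  · intro t ht
    have ht0 : t ≠ 0 := ht
    refine DifferentiableAt.differentiableWithinAt ?_
    fun_prop (disch := first | assumption | positivity)
  · intro t ht
    rw [ellTheta_mul' (v := p * t * y) (u := t * y) hp0 hp (by positivity) (by ring),
      ellTheta_mul' (v := p * t * (ω / y)) (u := t * (ω / y)) hp0 hp (by positivity) (by ring),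
      ellTheta_mul' (v := p * t * x) (u := t * x) hp0 hp (by positivity) (by ring),
      ellTheta_mul' (v := p * t * (ω / x)) (u := t * (ω / x)) hp0 hp (by positivity) (by ring),
      ellTheta_mul hp0 hp ht,
      ellTheta_mul' (v := p * t * ω) (u := t * ω) hp0 hp (by positivity) (by ring)]
    have e : t ^ (1 - ([1, ω⁻¹, y⁻¹] : List ℂ).length : ℤ) = (t ^ 2)⁻¹ := by
      rw [← zpow_natCast, ← zpow_neg]
      simp
    rw [e]
    field_simp
  · intro c hc
    simp only [List.mem_cons, List.not_mem_nil, or_false] at hc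
    rcases hc with rfl | rfl | rfl
    · refine ⟨one_ne_zero, ?_⟩
      simp only [ellTheta_one, one_mul]
      ring
    · refine ⟨inv_ne_zero hω, ?_⟩
      rw [ellTheta_inv' (u := ω / y) hp (by positivity) (by field_simp : ω⁻¹ * y = _),
        ellTheta_inv' (u := y) hp (by positivity) (by field_simp : ω⁻¹ * (ω / y) = _),
        ellTheta_inv' (u := ω / x) hp (by positivity) (by field_simp : ω⁻¹ * x = _),
        ellTheta_inv' (u := x) hp (by positivity) (by field_simp : ω⁻¹ * (ω / x) = _),
        inv_mul_cancel₀ hω, ellTheta_one]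
      field_simp
      ring
    · refine ⟨inv_ne_zero hy, ?_⟩
      rw [inv_mul_cancel₀ hy, ellTheta_one, ellTheta_inv hp hy, show y⁻¹ * x = x / y by ring,
        show y⁻¹ * (ω / x) = ω / (x * y) by field_simp, show y⁻¹ * ω = ω / y by ring]
      field_simp
      ring
  · simp only [List.pairwise_cons, List.mem_cons, List.not_mem_nil, or_false, forall_eq_or_imp,
      forall_eq, mul_one, IsEmpty.forall_iff, implies_true, List.Pairwise.nil, and_true]
    refine ⟨⟨fun m h => gω (-m) ?_, fun m h => gy (-m) ?_⟩, fun m h => gωy m ?_⟩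
    · rw [zpow_neg, ← h, inv_inv]
    · rw [zpow_neg, ← h, inv_inv]
    · field_simp at h
      rw [h, mul_comm]

/-- The three-term relation of Weierstrass, in multiplicative notation. -/
theorem weierstrass {p x y ω t : ℂ} (hp0 : p ≠ 0) (hp : ‖p‖ < 1) (hx : x ≠ 0) (hy : y ≠ 0)
    (hω : ω ≠ 0) (ht : t ≠ 0) :
    ellTheta x p * ellTheta (ω / x) p * ellTheta (t * y) p * ellTheta (t * (ω / y)) p -
      ellTheta (t * x) p * ellTheta (t * (ω / x)) p * ellTheta y p * ellTheta (ω / y) p -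
      y * ellTheta (x / y) p * ellTheta (ω / (x * y)) p * ellTheta t p * ellTheta (t * ω) p = 0 := by
  refine eq_zero_of_countable_compl (f := fun y =>
    ellTheta x p * ellTheta (ω / x) p * ellTheta (t * y) p * ellTheta (t * (ω / y)) p -
      ellTheta (t * x) p * ellTheta (t * (ω / x)) p * ellTheta y p * ellTheta (ω / y) p -
      y * ellTheta (x / y) p * ellTheta (ω / (x * y)) p * ellTheta t p * ellTheta (t * ω) p)
      ?_ (countable_setOf_eq_zpow_mul p 1) ?_ hy
  · intro y hy
    fun_prop (disch := first | assumption | positivity)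
  intro y hy gy
  refine eq_zero_of_countable_compl (f := fun ω =>
    ellTheta x p * ellTheta (ω / x) p * ellTheta (t * y) p * ellTheta (t * (ω / y)) p -
      ellTheta (t * x) p * ellTheta (t * (ω / x)) p * ellTheta y p * ellTheta (ω / y) p -
      y * ellTheta (x / y) p * ellTheta (ω / (x * y)) p * ellTheta t p * ellTheta (t * ω) p)
      ?_ ((countable_setOf_eq_zpow_mul p 1).union (countable_setOf_eq_zpow_mul p y)) ?_ hω
  · intro ω hω
    fun_prop (disch := first | assumption | positivity)
  intro ω hω gω
  simp only [Set.mem_union, Set.mem_ofPred_eq, not_or, not_exists, mul_one] at gω gy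
  exact weierstrass_generic hp0 hp hx hy hω ht gω.1 gy gω.2

/-! ### Theta functions on the torus of type `G₂` -/

theorem ellTheta_self_div {p u : ℂ} (hp0 : p ≠ 0) : ellTheta (p / u) p = ellTheta u p := by
  unfold ellTheta
  rw [mul_comm, div_div_cancel₀ hp0]

/-- The symmetric theta function `θ(a x, a / x; p)`. -/
noncomputable def pairTheta (p a x : ℂ) : ℂ := ellTheta (a * x) p * ellTheta (a / x) p

/-- The product of `θ(a x^α; p)` over the six short roots `α`, where `x₁, x₂, x₃` with
`x₁ x₂ x₃ = 1` are three short roots, the other three being their inverses. -/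
noncomputable def orbitTheta (p a x₁ x₂ x₃ : ℂ) : ℂ :=
  pairTheta p a x₁ * pairTheta p a x₂ * pairTheta p a x₃

/-- The Weyl denominator of type `G₂`, a product of theta functions over the positive roots, times
a monomial that makes it antisymmetric under permutations of `x₁, x₂, x₃`. -/
noncomputable def weylTheta (p x₁ x₂ x₃ : ℂ) : ℂ :=
  x₂ * x₃ ^ 2 * (ellTheta (x₁ / x₂) p * ellTheta (x₁ / x₃) p * ellTheta (x₂ / x₃) p) *
    (ellTheta x₁ p * ellTheta x₂ p * ellTheta x₃ p)

/-- The theta function `∏ θ(u yᵢ; p)` of level one on the torus `y₁ y₂ y₃ = 1`. -/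
noncomputable def tripleTheta (p u y₁ y₂ y₃ : ℂ) : ℂ :=
  ellTheta (u * y₁) p * ellTheta (u * y₂) p * ellTheta (u * y₃) p

/-- The combination of the even level one theta functions `tripleTheta p (-1)` and
`tripleTheta p r`, where `r ^ 2 = p`, that vanishes at `y = (A / l, w / A, l / w)`. -/
noncomputable def evenTheta (p r A w l y₁ y₂ y₃ : ℂ) : ℂ :=
  tripleTheta p (-1) y₁ y₂ y₃ * tripleTheta p r (A / l) (w / A) (l / w) -
    tripleTheta p r y₁ y₂ y₃ * tripleTheta p (-1) (A / l) (w / A) (l / w)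

/-- The product of `θ(a u; p)` over the five parameters `a`. -/
noncomputable def prodTheta (p w l b₁ b₂ b₃ u : ℂ) : ℂ :=
  ellTheta (w * u) p * ellTheta (l * u) p * ellTheta (b₁ * u) p * ellTheta (b₂ * u) p *
    ellTheta (b₃ * u) p

/-- The numerator of the function whose `q`-difference in the direction `x₁ → q x₁`,
`x₂ → q⁻¹ x₂` produces the contiguity relation between the parameters `w` and `l`. -/
noncomputable def numTheta (p r w l b₁ b₂ b₃ x₁ x₂ x₃ : ℂ) : ℂ :=
  x₁ ^ 3 / x₂ ^ 2 * ellTheta x₃ p *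
    (prodTheta p w l b₁ b₂ b₃ x₁⁻¹ * prodTheta p w l b₁ b₂ b₃ x₂) *
    (pairTheta p w x₃ * pairTheta p l x₃) *
    evenTheta p r (w * l * b₁ * b₂ * b₃) w l (w * l * b₁ * b₂ * b₃ * x₁)
      (x₂ / (w * l * b₁ * b₂ * b₃)) x₃

section Shift

variable {p : ℂ}

theorem pairTheta_mul (hp0 : p ≠ 0) (hp : ‖p‖ < 1) {a x : ℂ} (ha : a ≠ 0) (hx : x ≠ 0) :
    pairTheta p a (p * x) = (p * x ^ 2)⁻¹ * pairTheta p a x := by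
  unfold pairTheta
  rw [show a * (p * x) = p * (a * x) by ring, ellTheta_mul hp0 hp (by positivity),
    show a / (p * x) = a / x / p by field_simp, ellTheta_div hp0 hp (by positivity)]
  field_simp

theorem pairTheta_inv {a x : ℂ} : pairTheta p a x⁻¹ = pairTheta p a x := by
  unfold pairTheta
  rw [div_inv_eq_mul, mul_comm, ← div_eq_mul_inv]

theorem tripleTheta_mul (hp0 : p ≠ 0) (hp : ‖p‖ < 1) {u y₁ y₂ y₃ : ℂ} (hu : u ≠ 0) (h₁ : y₁ ≠ 0)
    (h₂ : y₂ ≠ 0) :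
    tripleTheta p u (p * y₁) y₂ y₃ = y₂ / y₁ * tripleTheta p u y₁ (p * y₂) y₃ := by
  unfold tripleTheta
  rw [show u * (p * y₁) = p * (u * y₁) by ring, ellTheta_mul hp0 hp (by positivity),
    show u * (p * y₂) = p * (u * y₂) by ring, ellTheta_mul hp0 hp (by positivity)]
  field_simp

theorem tripleTheta_swap₁ {u y₁ y₂ y₃ : ℂ} :
    tripleTheta p u y₁ y₂ y₃ = tripleTheta p u y₂ y₁ y₃ := by
  unfold tripleTheta; ring

theorem tripleTheta_swap₂ {u y₁ y₂ y₃ : ℂ} :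
    tripleTheta p u y₁ y₂ y₃ = tripleTheta p u y₁ y₃ y₂ := by
  unfold tripleTheta; ring

theorem evenTheta_swap₁ {r A w l y₁ y₂ y₃ : ℂ} :
    evenTheta p r A w l y₁ y₂ y₃ = evenTheta p r A w l y₂ y₁ y₃ := by
  unfold evenTheta
  rw [tripleTheta_swap₁ (u := -1), tripleTheta_swap₁ (u := r) (y₁ := y₁)]

theorem evenTheta_swap₂ {r A w l y₁ y₂ y₃ : ℂ} :
    evenTheta p r A w l y₁ y₂ y₃ = evenTheta p r A w l y₁ y₃ y₂ := by
  unfold evenTheta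
  rw [tripleTheta_swap₂ (u := -1), tripleTheta_swap₂ (u := r) (y₂ := y₂)]

theorem evenTheta_mul (hp0 : p ≠ 0) (hp : ‖p‖ < 1) {r A w l y₁ y₂ y₃ : ℂ} (hr : r ≠ 0)
    (h₁ : y₁ ≠ 0) (h₂ : y₂ ≠ 0) :
    evenTheta p r A w l (p * y₁) y₂ y₃ = y₂ / y₁ * evenTheta p r A w l y₁ (p * y₂) y₃ := by
  unfold evenTheta
  rw [tripleTheta_mul hp0 hp (by simp) h₁ h₂, tripleTheta_mul hp0 hp hr h₁ h₂]
  ring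

theorem tripleTheta_neg_one_inv (hp : ‖p‖ < 1) {y₁ y₂ y₃ : ℂ} (h : y₁ * y₂ * y₃ = 1) :
    tripleTheta p (-1) y₁⁻¹ y₂⁻¹ y₃⁻¹ = tripleTheta p (-1) y₁ y₂ y₃ := by
  have h₁ : y₁ ≠ 0 := by rintro rfl; simp at h
  have h₂ : y₂ ≠ 0 := by rintro rfl; simp at h
  have h₃ : y₃ ≠ 0 := by rintro rfl; simp at h
  unfold tripleTheta
  have key : ∀ y : ℂ, y ≠ 0 → ellTheta (-1 * y⁻¹) p = y⁻¹ * ellTheta (-1 * y) p := by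
    intro y hy
    rw [ellTheta_inv' (v := -1 * y⁻¹) (u := -1 * y) hp (by simpa) (by field_simp)]
    field_simp
  rw [key _ h₁, key _ h₂, key _ h₃]
  field_simp
  linear_combination -(ellTheta (-y₁) p * ellTheta (-y₂) p * ellTheta (-y₃) p) * h

theorem tripleTheta_inv_of_sq (hp0 : p ≠ 0) {r y₁ y₂ y₃ : ℂ} (hr : r ^ 2 = p) :
    tripleTheta p r y₁⁻¹ y₂⁻¹ y₃⁻¹ = tripleTheta p r y₁ y₂ y₃ := by
  have hr0 : r ≠ 0 := by
    rintro rfl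
    simp at hr
    exact hp0 hr.symm
  unfold tripleTheta
  have key : ∀ y : ℂ, ellTheta (r * y⁻¹) p = ellTheta (r * y) p := by
    intro y
    rw [← ellTheta_self_div hp0, ← hr]
    congr 1
    field_simp
  rw [key, key, key]

theorem evenTheta_inv (hp0 : p ≠ 0) (hp : ‖p‖ < 1) {r A w l y₁ y₂ y₃ : ℂ} (hr : r ^ 2 = p)
    (h : y₁ * y₂ * y₃ = 1) :
    evenTheta p r A w l y₁⁻¹ y₂⁻¹ y₃⁻¹ = evenTheta p r A w l y₁ y₂ y₃ := by
  unfold evenTheta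
  rw [tripleTheta_neg_one_inv hp h, tripleTheta_inv_of_sq hp0 hr]

theorem evenTheta_comm (hp0 : p ≠ 0) (hp : ‖p‖ < 1) {r A w l y₁ y₂ y₃ : ℂ} (hr : r ^ 2 = p)
    (hA : A ≠ 0) (hw : w ≠ 0) (hl : l ≠ 0) :
    evenTheta p r A w l y₁ y₂ y₃ = evenTheta p r A l w y₁ y₂ y₃ := by
  unfold evenTheta
  have h : A / l * (w / A) * (l / w) = 1 := by field_simp
  rw [← tripleTheta_neg_one_inv hp h, ← tripleTheta_inv_of_sq hp0 hr (y₁ := A / l),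
    tripleTheta_swap₁ (y₁ := (A / l)⁻¹), tripleTheta_swap₁ (y₁ := (A / l)⁻¹)]
  simp only [inv_div]

theorem prodTheta_mul (hp0 : p ≠ 0) (hp : ‖p‖ < 1) {w l b₁ b₂ b₃ u : ℂ} (hw : w ≠ 0) (hl : l ≠ 0)
    (h₁ : b₁ ≠ 0) (h₂ : b₂ ≠ 0) (h₃ : b₃ ≠ 0) (hu : u ≠ 0) :
    prodTheta p w l b₁ b₂ b₃ (p * u) =
      -(w * l * b₁ * b₂ * b₃ * u ^ 5)⁻¹ * prodTheta p w l b₁ b₂ b₃ u := by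
  unfold prodTheta
  simp only [mul_left_comm _ p u]
  rw [ellTheta_mul hp0 hp (mul_ne_zero hw hu), ellTheta_mul hp0 hp (mul_ne_zero hl hu),
    ellTheta_mul hp0 hp (mul_ne_zero h₁ hu), ellTheta_mul hp0 hp (mul_ne_zero h₂ hu),
    ellTheta_mul hp0 hp (mul_ne_zero h₃ hu)]
  field_simp

theorem prodTheta_mul_inv (hp0 : p ≠ 0) (hp : ‖p‖ < 1) {w l b₁ b₂ b₃ u : ℂ} (hw : w ≠ 0)
    (hl : l ≠ 0) (h₁ : b₁ ≠ 0) (h₂ : b₂ ≠ 0) (h₃ : b₃ ≠ 0) (hu : u ≠ 0) :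
    prodTheta p w l b₁ b₂ b₃ (p * u)⁻¹ =
      -(w * l * b₁ * b₂ * b₃) / (p * u) ^ 5 * prodTheta p w l b₁ b₂ b₃ u⁻¹ := by
  have h := prodTheta_mul hp0 hp hw hl h₁ h₂ h₃ (inv_ne_zero (mul_ne_zero hp0 hu))
  rw [show p * (p * u)⁻¹ = u⁻¹ by field_simp] at h
  rw [h]
  field_simp

variable {r w l b₁ b₂ b₃ x₁ x₂ x₃ : ℂ}

theorem numTheta_shift₁₂ (hp0 : p ≠ 0) (hp : ‖p‖ < 1) (hr : r ≠ 0) (hw : w ≠ 0)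
    (hl : l ≠ 0) (h₁ : b₁ ≠ 0) (h₂ : b₂ ≠ 0) (h₃ : b₃ ≠ 0) (hx₁ : x₁ ≠ 0) (hx₂ : x₂ ≠ 0) :
    numTheta p r w l b₁ b₂ b₃ (p * x₁) x₂ x₃ =
      (x₂ / x₁) ^ 6 * numTheta p r w l b₁ b₂ b₃ x₁ (p * x₂) x₃ := by
  unfold numTheta
  rw [prodTheta_mul hp0 hp hw hl h₁ h₂ h₃ hx₂, prodTheta_mul_inv hp0 hp hw hl h₁ h₂ h₃ hx₁,
    mul_left_comm _ p x₁, evenTheta_mul hp0 hp hr (by positivity) (by positivity), mul_div_assoc p]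
  field_simp

theorem numTheta_shift₁₃ (hp0 : p ≠ 0) (hp : ‖p‖ < 1) (hr : r ≠ 0) (hw : w ≠ 0)
    (hl : l ≠ 0) (h₁ : b₁ ≠ 0) (h₂ : b₂ ≠ 0) (h₃ : b₃ ≠ 0) (hx₁ : x₁ ≠ 0) (hx₃ : x₃ ≠ 0) :
    numTheta p r w l b₁ b₂ b₃ (p * x₁) x₂ x₃ =
      (x₃ / x₁) ^ 6 * numTheta p r w l b₁ b₂ b₃ x₁ x₂ (p * x₃) := by
  unfold numTheta
  rw [prodTheta_mul_inv hp0 hp hw hl h₁ h₂ h₃ hx₁,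
    mul_left_comm _ p x₁, evenTheta_swap₂, evenTheta_mul hp0 hp hr (by positivity) hx₃,
    evenTheta_swap₂ (y₂ := p * x₃), pairTheta_mul hp0 hp hw hx₃, pairTheta_mul hp0 hp hl hx₃,
    ellTheta_mul hp0 hp hx₃]
  field_simp

theorem numTheta_shift₂₃ (hp0 : p ≠ 0) (hp : ‖p‖ < 1) (hr : r ≠ 0) (hw : w ≠ 0)
    (hl : l ≠ 0) (h₁ : b₁ ≠ 0) (h₂ : b₂ ≠ 0) (h₃ : b₃ ≠ 0) (hx₂ : x₂ ≠ 0) (hx₃ : x₃ ≠ 0) :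
    numTheta p r w l b₁ b₂ b₃ x₁ (p * x₂) x₃ =
      (x₃ / x₂) ^ 6 * numTheta p r w l b₁ b₂ b₃ x₁ x₂ (p * x₃) := by
  unfold numTheta
  rw [prodTheta_mul hp0 hp hw hl h₁ h₂ h₃ hx₂, mul_div_assoc p x₂,
    evenTheta_swap₁, evenTheta_swap₂, evenTheta_mul hp0 hp hr (by positivity) hx₃,
    evenTheta_swap₂ (y₂ := p * x₃), evenTheta_swap₁ (y₁ := x₂ / _), pairTheta_mul hp0 hp hw hx₃,
    pairTheta_mul hp0 hp hl hx₃, ellTheta_mul hp0 hp hx₃]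
  field_simp

theorem numTheta_inv (hp0 : p ≠ 0) (hp : ‖p‖ < 1) (hr : r ^ 2 = p) (hw : w ≠ 0)
    (hl : l ≠ 0) (h₁ : b₁ ≠ 0) (h₂ : b₂ ≠ 0) (h₃ : b₃ ≠ 0) (hx : x₁ * x₂ * x₃ = 1) :
    numTheta p r w l b₁ b₂ b₃ x₁⁻¹ x₂⁻¹ x₃⁻¹ = -numTheta p r w l b₁ b₂ b₃ x₂ x₁ x₃ := by
  have hx₁ : x₁ ≠ 0 := by rintro rfl; simp at hx
  have hx₂ : x₂ ≠ 0 := by rintro rfl; simp at hx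
  have hx₃ : x₃ ≠ 0 := by rintro rfl; simp at hx
  unfold numTheta
  set A := w * l * b₁ * b₂ * b₃ with hA
  have hA0 : A ≠ 0 := by positivity
  have e : evenTheta p r A w l (A * x₁⁻¹) (x₂⁻¹ / A) x₃⁻¹ =
      evenTheta p r A w l (A * x₂) (x₁ / A) x₃ := by
    rw [evenTheta_swap₁ (y₁ := A * x₂), ← evenTheta_inv hp0 hp hr]
    · congr 1 <;> field_simp
    · field_simp
      linear_combination -hx
  rw [e, inv_inv, pairTheta_inv, pairTheta_inv, ellTheta_inv hp hx₃]
  field_simp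
  rw [hx]
  ring

theorem numTheta_comm (hp0 : p ≠ 0) (hp : ‖p‖ < 1) (hr : r ^ 2 = p) (hw : w ≠ 0)
    (hl : l ≠ 0) (h₁ : b₁ ≠ 0) (h₂ : b₂ ≠ 0) (h₃ : b₃ ≠ 0) :
    numTheta p r w l b₁ b₂ b₃ x₁ x₂ x₃ = numTheta p r l w b₁ b₂ b₃ x₁ x₂ x₃ := by
  unfold numTheta prodTheta
  rw [evenTheta_comm hp0 hp hr (by positivity) hw hl, mul_comm w l]
  ring

theorem weylTheta_swap₁ (hp : ‖p‖ < 1) (hx₁ : x₁ ≠ 0) (hx₂ : x₂ ≠ 0) :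
    weylTheta p x₂ x₁ x₃ = -weylTheta p x₁ x₂ x₃ := by
  unfold weylTheta
  rw [ellTheta_inv' (u := x₁ / x₂) hp (by positivity) (inv_div _ _).symm]
  field_simp

theorem weylTheta_swap₂ (hp : ‖p‖ < 1) (hx₂ : x₂ ≠ 0) (hx₃ : x₃ ≠ 0) :
    weylTheta p x₁ x₃ x₂ = -weylTheta p x₁ x₂ x₃ := by
  unfold weylTheta
  rw [ellTheta_inv' (u := x₂ / x₃) hp (by positivity) (inv_div _ _).symm]
  field_simp

theorem weylTheta_inv (hp : ‖p‖ < 1) (hx : x₁ * x₂ * x₃ = 1) :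
    weylTheta p x₁⁻¹ x₂⁻¹ x₃⁻¹ = weylTheta p x₁ x₂ x₃ := by
  have hx₁ : x₁ ≠ 0 := by rintro rfl; simp at hx
  have hx₂ : x₂ ≠ 0 := by rintro rfl; simp at hx
  have hx₃ : x₃ ≠ 0 := by rintro rfl; simp at hx
  unfold weylTheta
  rw [ellTheta_inv hp hx₁, ellTheta_inv hp hx₂, ellTheta_inv hp hx₃,
    ellTheta_inv' (v := x₁⁻¹ / x₂⁻¹) (u := x₁ / x₂) hp (by positivity) (by field_simp),
    ellTheta_inv' (v := x₁⁻¹ / x₃⁻¹) (u := x₁ / x₃) hp (by positivity) (by field_simp),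
    ellTheta_inv' (v := x₂⁻¹ / x₃⁻¹) (u := x₂ / x₃) hp (by positivity) (by field_simp)]
  field_simp
  have h2 : x₁ ^ 3 * x₂ ^ 3 * x₃ ^ 3 = 1 := by rw [← mul_pow, ← mul_pow, hx, one_pow]
  linear_combination -(ellTheta x₁ p * ellTheta x₂ p * ellTheta x₃ p * ellTheta (x₁ / x₂) p *
    ellTheta (x₁ / x₃) p * ellTheta (x₂ / x₃) p) * h2

theorem weylTheta_shift (hp0 : p ≠ 0) (hp : ‖p‖ < 1) (hx₁ : x₁ ≠ 0) (hx₂ : x₂ ≠ 0)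
    (hx₃ : x₃ ≠ 0) :
    weylTheta p (p * x₁) x₂ x₃ = (x₂ / x₁) ^ 4 * weylTheta p x₁ (p * x₂) x₃ := by
  unfold weylTheta
  rw [ellTheta_mul hp0 hp hx₁, ellTheta_mul hp0 hp hx₂, mul_div_assoc p, mul_div_assoc p,
    mul_div_assoc p, ellTheta_mul hp0 hp (by positivity), ellTheta_mul hp0 hp (by positivity),
    ellTheta_mul hp0 hp (by positivity), show x₁ / (p * x₂) = x₁ / x₂ / p by field_simp,
    ellTheta_div hp0 hp (by positivity)]
  field_simp

theorem orbitTheta_shift (hp0 : p ≠ 0) (hp : ‖p‖ < 1) {a : ℂ} (ha : a ≠ 0) (hx₁ : x₁ ≠ 0)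
    (hx₂ : x₂ ≠ 0) :
    orbitTheta p a (p * x₁) x₂ x₃ = (x₂ / x₁) ^ 2 * orbitTheta p a x₁ (p * x₂) x₃ := by
  unfold orbitTheta
  rw [pairTheta_mul hp0 hp ha hx₁, pairTheta_mul hp0 hp ha hx₂]
  field_simp

end Shift

/-- The product `θ(-v, r v, -r v; r²) = θ(v²; r²) / θ(v; r²)`. -/
noncomputable def halfPeriodTheta (p r v : ℂ) : ℂ :=
  ellTheta (-v) p * ellTheta (r * v) p * ellTheta (-(r * v)) p

section Restriction

variable {p r w l b₁ b₂ b₃ x₁ x₂ x₃ : ℂ}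

/-- Where one of the three variables is `w / A`, the function `evenTheta` is a product, by the
three-term relation. -/
theorem evenTheta_restrict (hp0 : p ≠ 0) (hp : ‖p‖ < 1) (hr : r ^ 2 = p) {A y₁ y₃ : ℂ}
    (hA : A ≠ 0) (hw : w ≠ 0) (hl : l ≠ 0) (hy : y₁ * y₃ = A / w) :
    evenTheta p r A w l y₁ (w / A) y₃ = -(A / l) * ellTheta (-r) p * halfPeriodTheta p r (w / A) *
      (ellTheta (y₁ * l / A) p * ellTheta (l * y₃ / A) p) := by
  have hy1 : y₁ ≠ 0 := by
    rintro rfl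
    rw [zero_mul] at hy
    exact div_ne_zero hA hw hy.symm
  have hy3 : y₃ = A / w / y₁ := by
    rw [← hy]
    field_simp
  have hr0 : r ≠ 0 := by
    rintro rfl
    simp at hr
    exact hp0 hr.symm
  have h := weierstrass (x := -y₁) (y := -(A / l)) (ω := A / w) (t := -r) hp0 hp (by simpa)
    (by simp [hA, hl]) (by positivity) (by simpa)
  rw [show A / w / -y₁ = -1 * y₃ by rw [hy3, div_neg, neg_one_mul],
    show -r * -(A / l) = r * (A / l) by ring,
    show -r * (A / w / -(A / l)) = r * (l / w) by field_simp,
    show -r * -y₁ = r * y₁ by ring, show -r * (-1 * y₃) = r * y₃ by ring,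
    show A / w / -(A / l) = -1 * (l / w) by field_simp,
    show -y₁ / -(A / l) = y₁ * l / A by field_simp,
    show A / w / (-y₁ * -(A / l)) = l * y₃ / A by rw [hy3]; field_simp,
    ← ellTheta_self_div hp0 (u := -r * (A / w)),
    show p / (-r * (A / w)) = -(r * (w / A)) by rw [← hr]; field_simp,
    show -(A / l) = -1 * (A / l) by ring, show -y₁ = -1 * y₁ by ring] at h
  unfold evenTheta tripleTheta halfPeriodTheta
  rw [show -(w / A) = -1 * (w / A) by ring]
  linear_combination (ellTheta (-1 * (w / A)) p * ellTheta (r * (w / A)) p) * h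

theorem numTheta_restrict (hp0 : p ≠ 0) (hp : ‖p‖ < 1) (hr : r ^ 2 = p) (hw : w ≠ 0)
    (hl : l ≠ 0) (h₁ : b₁ ≠ 0) (h₂ : b₂ ≠ 0) (h₃ : b₃ ≠ 0) (hx : w * x₁ * x₃ = 1) :
    numTheta p r w l b₁ b₂ b₃ x₁ w x₃ =
      w * b₁ * b₂ * b₃ * ellTheta (-r) p * halfPeriodTheta p r (w / (w * l * b₁ * b₂ * b₃)) *
        prodTheta p w l b₁ b₂ b₃ w / w ^ 2 * (pairTheta p l x₁ * pairTheta p l x₃) *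
        (ellTheta x₁ p * ellTheta x₃ p * (ellTheta (w / x₁) p * ellTheta (w / x₃) p)) *
        (x₁ ^ 2 * (ellTheta (b₁ / x₁) p * ellTheta (b₂ / x₁) p * ellTheta (b₃ / x₁) p *
          ellTheta (x₃ / (w * b₁ * b₂ * b₃)) p)) := by
  have hx₁ : x₁ ≠ 0 := by rintro rfl; simp at hx
  have hx₃ : x₃ ≠ 0 := by rintro rfl; simp at hx
  have e₃ : w * x₃ = x₁⁻¹ := eq_inv_of_mul_eq_one_left (by linear_combination hx)
  have e₁ : w * x₁ = x₃⁻¹ := eq_inv_of_mul_eq_one_left (by linear_combination hx)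
  have hA : w * l * b₁ * b₂ * b₃ ≠ 0 := by positivity
  unfold numTheta
  rw [evenTheta_restrict hp0 hp hr hA hw hl (by field_simp; linear_combination hx)]
  have e4 : w * l * b₁ * b₂ * b₃ * x₁ * l / (w * l * b₁ * b₂ * b₃) = l * x₁ := by field_simp
  have e5 : l * x₃ / (w * l * b₁ * b₂ * b₃) = x₃ / (w * b₁ * b₂ * b₃) := by field_simp
  rw [e4, e5]
  unfold pairTheta
  rw [e₃, ellTheta_inv hp hx₁]
  rw [show prodTheta p w l b₁ b₂ b₃ x₁⁻¹ = ellTheta (w / x₁) p * ellTheta (l / x₁) p *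
    (ellTheta (b₁ / x₁) p * ellTheta (b₂ / x₁) p * ellTheta (b₃ / x₁) p) from by
      simp only [prodTheta, div_eq_mul_inv, mul_assoc]]
  have e6 : w * l * b₁ * b₂ * b₃ / l = w * b₁ * b₂ * b₃ := by field_simp
  rw [e6]
  generalize ellTheta (x₃ / (w * b₁ * b₂ * b₃)) p = t₁
  generalize halfPeriodTheta p r (w / (w * l * b₁ * b₂ * b₃)) = t₂
  generalize w * b₁ * b₂ * b₃ = B
  generalize prodTheta p w l b₁ b₂ b₃ w = t₃
  -- the theta values are opaque from here on, so that only monomials have to be compared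
  generalize ellTheta (w / x₁) p = s₁
  generalize ellTheta (w / x₃) p = s₂
  generalize ellTheta (l / x₁) p = s₃
  generalize ellTheta (l / x₃) p = s₄
  generalize ellTheta (l * x₁) p = s₅
  generalize ellTheta (l * x₃) p = s₆
  generalize ellTheta (b₁ / x₁) p * ellTheta (b₂ / x₁) p * ellTheta (b₃ / x₁) p = s₇
  generalize ellTheta x₁ p = s₈
  generalize ellTheta x₃ p = s₉
  have e7 : x₁ ^ 3 * x₁⁻¹ = x₁ ^ 2 := by field_simp
  rw [← e7]
  ring

/-- The relation that adds up the two terms of the alternating sum of `numTheta` that survive when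
one of the variables equals `w`. -/
theorem weierstrass_five (hp0 : p ≠ 0) (hp : ‖p‖ < 1) (hw : w ≠ 0)
    (h₁ : b₁ ≠ 0) (h₂ : b₂ ≠ 0) (h₃ : b₃ ≠ 0) (hx : w * x₂ * x₃ = 1) :
    x₃ ^ 2 * (ellTheta (b₁ / x₃) p * ellTheta (b₂ / x₃) p * ellTheta (b₃ / x₃) p *
        ellTheta (x₂ / (w * b₁ * b₂ * b₃)) p) -
      x₂ ^ 2 * (ellTheta (b₁ / x₂) p * ellTheta (b₂ / x₂) p * ellTheta (b₃ / x₂) p *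
        ellTheta (x₃ / (w * b₁ * b₂ * b₃)) p) =
      -(w * b₁ * b₂ * b₃)⁻¹ * (ellTheta (b₁ * b₂ * w) p * ellTheta (b₁ * b₃ * w) p *
        ellTheta (b₂ * b₃ * w) p) * (x₂ * x₃ ^ 2 * ellTheta (x₂ / x₃) p) := by
  have hx₂ : x₂ ≠ 0 := by rintro rfl; simp at hx
  have hx₃ : x₃ ≠ 0 := by rintro rfl; simp at hx
  have hw' : w = (x₂ * x₃)⁻¹ := eq_inv_of_mul_eq_one_left (by linear_combination hx)
  subst hw'
  have h := weierstrass (x := b₁ / x₃) (y := x₂ / b₃) (ω := b₁ * b₂ / x₃ ^ 2) (t := x₃ / x₂) hp0 hp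
    (by positivity) (by positivity) (by positivity) (by positivity)
  set B := (x₂ * x₃)⁻¹ * b₁ * b₂ * b₃ with hB
  have hB0 : B ≠ 0 := by positivity
  rw [show b₁ * b₂ / x₃ ^ 2 / (b₁ / x₃) = b₂ / x₃ by field_simp,
    ellTheta_inv' (v := x₃ / x₂ * (x₂ / b₃)) (u := b₃ / x₃) hp (by positivity) (by field_simp),
    ellTheta_inv' (v := x₃ / x₂ * (b₁ * b₂ / x₃ ^ 2 / (x₂ / b₃))) (u := x₂ / B) hp (by positivity)
      (by rw [hB]; field_simp),
    show x₃ / x₂ * (b₁ / x₃) = b₁ / x₂ by field_simp,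
    show x₃ / x₂ * (b₂ / x₃) = b₂ / x₂ by field_simp,
    ellTheta_inv' (v := x₂ / b₃) (u := b₃ / x₂) hp (by positivity) (by field_simp),
    ellTheta_inv' (v := b₁ * b₂ / x₃ ^ 2 / (x₂ / b₃)) (u := x₃ / B) hp (by positivity)
      (by rw [hB]; field_simp),
    show b₁ / x₃ / (x₂ / b₃) = b₁ * b₃ * (x₂ * x₃)⁻¹ by field_simp,
    show b₁ * b₂ / x₃ ^ 2 / (b₁ / x₃ * (x₂ / b₃)) = b₂ * b₃ * (x₂ * x₃)⁻¹ by field_simp,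
    ellTheta_inv' (v := x₃ / x₂) (u := x₂ / x₃) hp (by positivity) (by field_simp),
    show x₃ / x₂ * (b₁ * b₂ / x₃ ^ 2) = b₁ * b₂ * (x₂ * x₃)⁻¹ by field_simp] at h
  have hBi : B⁻¹ = x₂ * x₃ / (b₁ * b₂ * b₃) := by
    rw [hB]
    field_simp
  rw [hBi]
  have e2 : (x₂ / B)⁻¹ = b₁ * b₂ * b₃ / (x₂ ^ 2 * x₃) := by rw [hB]; field_simp
  have e3 : (x₃ / B)⁻¹ = b₁ * b₂ * b₃ / (x₃ ^ 2 * x₂) := by rw [hB]; field_simp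
  rw [e2, e3] at h
  clear_value B
  field_simp at h ⊢
  linear_combination h

end Restriction

theorem zpow_eq_one_of_norm {p : ℂ} (hp0 : p ≠ 0) (hp : ‖p‖ < 1) {m : ℤ} (h1 : ‖p‖ < ‖p ^ m‖)
    (h2 : ‖p ^ m‖ < ‖p‖⁻¹) : p ^ m = 1 := by
  have hpn : 0 < ‖p‖ := norm_pos_iff.2 hp0
  rw [norm_zpow] at h1 h2
  have l1 : m < 1 := (zpow_lt_zpow_iff_right_of_lt_one₀ hpn hp).1 (by simpa using h1)
  have l2 : -1 < m := (zpow_lt_zpow_iff_right_of_lt_one₀ hpn hp).1 (by simpa using h2)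
  obtain rfl : m = 0 := by omega
  exact zpow_zero _

/-- Two points whose squares have modulus strictly between `‖p‖` and `‖p‖⁻¹` are distinct modulo
`p ^ ℤ` once they are distinct. -/
theorem ne_zpow_mul_of_norm {p c d : ℂ} (hp0 : p ≠ 0) (hp : ‖p‖ < 1) (hcd : c ≠ d)
    (hc : ‖p‖ < ‖c‖ ^ 2 ∧ ‖c‖ ^ 2 < ‖p‖⁻¹) (hd : ‖p‖ < ‖d‖ ^ 2 ∧ ‖d‖ ^ 2 < ‖p‖⁻¹) (m : ℤ) :
    d ≠ p ^ m * c := by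
  intro h
  have hpn : 0 < ‖p‖ := norm_pos_iff.2 hp0
  have hcn : 0 < ‖c‖ ^ 2 := hpn.trans hc.1
  have hn : ‖d‖ ^ 2 = ‖p ^ m‖ ^ 2 * ‖c‖ ^ 2 := by rw [h, norm_mul, mul_pow]
  refine hcd ?_
  rw [h, zpow_eq_one_of_norm hp0 hp (m := m), one_mul]
  · refine lt_of_pow_lt_pow_left₀ 2 (norm_nonneg _) ?_
    refine lt_of_mul_lt_mul_right ?_ hcn.le
    rw [← hn]
    refine lt_trans ?_ hd.1
    calc ‖p‖ ^ 2 * ‖c‖ ^ 2 < ‖p‖ ^ 2 * ‖p‖⁻¹ := by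
          have := hc.2
          gcongr
      _ = ‖p‖ := by field_simp
  · refine lt_of_pow_lt_pow_left₀ 2 (by positivity) ?_
    refine lt_of_mul_lt_mul_right ?_ hcn.le
    rw [← hn]
    refine hd.2.trans ?_
    calc ‖p‖⁻¹ = ‖p‖⁻¹ ^ 2 * ‖p‖ := by field_simp
      _ < ‖p‖⁻¹ ^ 2 * ‖c‖ ^ 2 := by
          have := hc.1
          gcongr

/-- The set of `s` one of whose powers lies in the group generated by `p`, `w` and `l`. -/
def resonantSet (p w l : ℂ) : Set ℂ :=
  {s | s ≠ 0 ∧ ∃ n : ℤ, n ≠ 0 ∧ ∃ i j k : ℤ, s ^ n = p ^ i * w ^ j * l ^ k}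

theorem countable_resonantSet (p w l : ℂ) : (resonantSet p w l).Countable := by
  have : resonantSet p w l ⊆ ⋃ n : ℕ, ⋃ i : ℤ, ⋃ j : ℤ, ⋃ k : ℤ,
      {s : ℂ | s ^ (n + 1) = p ^ i * w ^ j * l ^ k} := by
    rintro s ⟨-, n, hn, i, j, k, h⟩
    simp only [Set.mem_iUnion, Set.mem_ofPred_eq]
    rcases lt_or_gt_of_ne hn with hn | hn
    · obtain ⟨m, rfl⟩ : ∃ m : ℕ, n = -((m : ℤ) + 1) := ⟨(-n - 1).toNat, by omega⟩
      refine ⟨m, -i, -j, -k, ?_⟩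
      have h2 : s ^ (m + 1) = (s ^ (-((m : ℤ) + 1)))⁻¹ := by
        rw [zpow_neg, inv_inv]
        norm_cast
      rw [h2, h]
      simp only [zpow_neg, mul_inv]
    · obtain ⟨m, rfl⟩ : ∃ m : ℕ, n = (m : ℤ) + 1 := ⟨(n - 1).toNat, by omega⟩
      exact ⟨m, i, j, k, by rw [← h]; norm_cast⟩
  refine Set.Countable.mono this ?_
  refine Set.countable_iUnion fun n => Set.countable_iUnion fun i => Set.countable_iUnion fun j =>
    Set.countable_iUnion fun k => Set.Finite.countable ?_
  refine (Polynomial.nthRoots (n + 1) (p ^ i * w ^ j * l ^ k)).toFinset.finite_toSet.subset ?_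
  intro s hs
  simpa [Polynomial.mem_nthRoots] using hs

theorem ne_zpow_mul_of_notMem_resonantSet {p w l s : ℂ} (hw : w ≠ 0) (hl : l ≠ 0)
    (hs0 : s ≠ 0) (hs : s ∉ resonantSet p w l) {e e' : ℤ} (hee : e ≠ e') {c d : ℂ}
    (hc : ∃ j k : ℤ, c = s ^ e * (w ^ j * l ^ k)) (hd : ∃ j k : ℤ, d = s ^ e' * (w ^ j * l ^ k))
    (m : ℤ) : d ≠ p ^ m * c := by
  rintro rfl
  obtain ⟨j, k, rfl⟩ := hc
  obtain ⟨j', k', h⟩ := hd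
  refine hs ⟨hs0, e' - e, sub_ne_zero.2 hee.symm, m, j - j', k - k', ?_⟩
  rw [zpow_sub₀ hs0, zpow_sub₀ hw, zpow_sub₀ hl]
  have n1 := zpow_ne_zero e hs0
  have n2 := zpow_ne_zero j' hw
  have n3 := zpow_ne_zero k' hl
  field_simp
  linear_combination -h

/-- A theta function of type `G₂`, antisymmetric under permutations of `x₁, x₂, x₃` and invariant
under inversion, of the quasi-periodicity of `weylTheta` times `orbitTheta`, vanishes if it
vanishes for `x₁ = w` and for `x₁ = l`. For fixed `x₃ = s⁻²` it has degree `12` in `x₁`, and it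
vanishes at `x₁, x₂ ∈ {w, w⁻¹, l, l⁻¹, 1}` and at points with `x₁ = x₃`, `x₂ = x₃`, `x₁ = x₂`:
for generic `s` these are `13` zeros. -/
theorem eq_zero_of_antisymmetric {p w l : ℂ} (hp0 : p ≠ 0) (hp : ‖p‖ < 1)
    (hw : ‖p‖ < ‖w‖ ^ 2) (hw1 : ‖w‖ < 1) (hl : ‖p‖ < ‖l‖ ^ 2) (hl1 : ‖l‖ < 1) (hwl : w ≠ l)
    {D : ℂ → ℂ → ℂ → ℂ} (hs₁ : ∀ x₁ x₂ x₃, x₁ * x₂ * x₃ = 1 → D x₂ x₁ x₃ = -D x₁ x₂ x₃)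
    (hs₂ : ∀ x₁ x₂ x₃, x₁ * x₂ * x₃ = 1 → D x₁ x₃ x₂ = -D x₁ x₂ x₃)
    (hinv : ∀ x₁ x₂ x₃, x₁ * x₂ * x₃ = 1 → D x₁⁻¹ x₂⁻¹ x₃⁻¹ = D x₁ x₂ x₃)
    (hDw : ∀ x₂ x₃, w * x₂ * x₃ = 1 → D w x₂ x₃ = 0)
    (hDl : ∀ x₂ x₃, l * x₂ * x₃ = 1 → D l x₂ x₃ = 0)
    (hshift : ∀ x₁ x₂ x₃, x₁ ≠ 0 → x₂ ≠ 0 → x₃ ≠ 0 →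
      D (p * x₁) x₂ x₃ = (x₂ / x₁) ^ 6 * D x₁ (p * x₂) x₃)
    (hdiff : ∀ c d z, c ≠ 0 → d ≠ 0 → z ≠ 0 → DifferentiableAt ℂ (fun z => D z (c / z) d) z)
    (hcont : ∀ z s, z ≠ 0 → s ≠ 0 → ContinuousAt (fun s => D z (s ^ 2 / z) (s ^ 2)⁻¹) s)
    {x₁ x₂ x₃ : ℂ} (hx : x₁ * x₂ * x₃ = 1) : D x₁ x₂ x₃ = 0 := by
  have hpn : 0 < ‖p‖ := norm_pos_iff.2 hp0
  have hw0 : w ≠ 0 := by rintro rfl; simp at hw; linarith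
  have hl0 : l ≠ 0 := by rintro rfl; simp at hl; linarith
  have hD1 : ∀ x₂ x₃, 1 * x₂ * x₃ = 1 → D 1 x₂ x₃ = 0 := by
    intro x₂ x₃ h
    have h1 := hinv _ _ _ h
    have e2 : x₂⁻¹ = x₃ := inv_eq_of_mul_eq_one_right (by simpa using h)
    rw [e2, ← e2, inv_inv, inv_one, e2, hs₂ _ _ _ h] at h1
    exact self_eq_neg.1 h1.symm
  have hDi : ∀ c, (∀ x₂ x₃, c * x₂ * x₃ = 1 → D c x₂ x₃ = 0) →
      ∀ x₂ x₃, c⁻¹ * x₂ * x₃ = 1 → D c⁻¹ x₂ x₃ = 0 := by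
    intro c hc x₂ x₃ h
    rw [← hinv _ _ _ h, inv_inv]
    refine hc _ _ ?_
    rw [← inv_inj, mul_inv, mul_inv, inv_inv, inv_inv, h, inv_one]
  have hbase : ∀ c ∈ [w, w⁻¹, l, l⁻¹, 1], (∀ x₂ x₃, c * x₂ * x₃ = 1 → D c x₂ x₃ = 0) := by
    simp only [List.mem_cons, List.not_mem_nil, or_false, forall_eq_or_imp, forall_eq]
    exact ⟨hDw, hDi w hDw, hDl, hDi l hDl, hD1⟩
  have hgen : ∀ s, s ≠ 0 → s ∉ resonantSet p w l → ∀ z, z ≠ 0 →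
      D z (s ^ 2 / z) (s ^ 2)⁻¹ = 0 := by
    intro s hs0 hs z hz
    have hbn : ∀ c ∈ [w, w⁻¹, l, l⁻¹, 1], c ≠ 0 ∧ ‖p‖ < ‖c‖ ^ 2 ∧ ‖c‖ ^ 2 < ‖p‖⁻¹ := by
      have hinvn : ∀ c : ℂ, ‖p‖ < ‖c‖ ^ 2 → ‖c‖ < 1 →
          (‖c‖ ^ 2 < ‖p‖⁻¹ ∧ ‖p‖ < ‖c⁻¹‖ ^ 2 ∧ ‖c⁻¹‖ ^ 2 < ‖p‖⁻¹) := by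
        intro c h1 h2
        have hc2 : ‖c‖ ^ 2 < 1 := pow_lt_one₀ (norm_nonneg _) h2 two_ne_zero
        have hc0 : 0 < ‖c‖ ^ 2 := hpn.trans h1
        have hp1 : 1 < ‖p‖⁻¹ := (one_lt_inv₀ hpn).2 hp
        rw [norm_inv, inv_pow]
        exact ⟨hc2.trans hp1, hp.trans ((one_lt_inv₀ hc0).2 hc2), (inv_lt_inv₀ hc0 hpn).2 h1⟩
      have h1 := hinvn w hw hw1
      have h2 := hinvn l hl hl1
      simp only [List.mem_cons, List.not_mem_nil, or_false, forall_eq_or_imp, forall_eq]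
      refine ⟨⟨hw0, hw, h1.1⟩, ⟨inv_ne_zero hw0, h1.2⟩, ⟨hl0, hl, h2.1⟩, ⟨inv_ne_zero hl0, h2.2⟩,
        one_ne_zero, by simpa using hp, by simpa using (one_lt_inv₀ hpn).2 hp⟩
    have hbnd : [w, w⁻¹, l, l⁻¹, 1].Pairwise (· ≠ ·) := by
      have ne : ∀ c d : ℂ, ‖c‖ < 1 → 1 ≤ ‖d‖ → c ≠ d := by
        rintro c d h1 h2 rfl
        linarith
      have hi : ∀ c : ℂ, c ≠ 0 → ‖c‖ < 1 → 1 < ‖c⁻¹‖ := by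
        intro c h0 h1
        rw [norm_inv]
        exact (one_lt_inv₀ (norm_pos_iff.2 h0)).2 h1
      have hwi := hi w hw0 hw1
      have hli := hi l hl0 hl1
      simp only [List.pairwise_cons, List.mem_cons, List.not_mem_nil, or_false, forall_eq_or_imp,
        forall_eq, IsEmpty.forall_iff, implies_true, List.Pairwise.nil, and_true]
      refine ⟨⟨ne _ _ hw1 hwi.le, hwl, ne _ _ hw1 hli.le, ne _ _ hw1 (by simp)⟩,
        ⟨(ne _ _ hl1 hwi.le).symm, fun h => hwl (inv_inj.1 h), ?_⟩,
        ⟨ne _ _ hl1 hli.le, ne _ _ hl1 (by simp)⟩, ?_⟩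
      · intro h; rw [h] at hwi; simp at hwi
      · intro h; rw [h] at hli; simp at hli
    have hs2 : s ^ 2 ≠ 0 := pow_ne_zero _ hs0
    refine eq_zero_of_zeros hp0 hp ([w, w⁻¹, l, l⁻¹, 1] ++ ([w, w⁻¹, l, l⁻¹, 1].map (s ^ 2 * ·) ++
      [(s ^ 2)⁻¹, s ^ 4, s])) (C := (s ^ 2) ^ 6 / p ^ 6)
      (h := fun z => D z (s ^ 2 / z) (s ^ 2)⁻¹) ?_ ?_ ?_ ?_ z hz
    · exact fun z hz => (hdiff _ _ z hs2 (inv_ne_zero hs2) hz).differentiableWithinAt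
    · intro z hz
      rw [hshift _ _ _ hz (div_ne_zero hs2 (mul_ne_zero hp0 hz)) (inv_ne_zero hs2)]
      have e : p * (s ^ 2 / (p * z)) = s ^ 2 / z := by field_simp
      have e2 : (1 - (([w, w⁻¹, l, l⁻¹, 1] ++ ([w, w⁻¹, l, l⁻¹, 1].map (s ^ 2 * ·) ++
        [(s ^ 2)⁻¹, s ^ 4, s])).length : ℤ)) = -(12 : ℕ) := by simp
      rw [e, e2, zpow_neg, zpow_natCast]
      field_simp
    · intro c hc
      rw [List.mem_append, List.mem_append] at hc
      rcases hc with hc | hc | hc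
      · have hc0 := (hbn c hc).1
        exact ⟨hc0, hbase c hc _ _ (by field_simp)⟩
      · obtain ⟨d, hd, rfl⟩ := List.mem_map.1 hc
        have hd0 := (hbn d hd).1
        refine ⟨mul_ne_zero hs2 hd0, ?_⟩
        have e : s ^ 2 / (s ^ 2 * d) = d⁻¹ := by field_simp
        have e1 : D d⁻¹ (s ^ 2 * d) (s ^ 2)⁻¹ = 0 :=
          hDi d (hbase d hd) _ _ (by field_simp)
        rw [e, hs₁ _ _ _ (by field_simp), e1, neg_zero]
      · simp only [List.mem_cons, List.not_mem_nil, or_false] at hc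
        rcases hc with rfl | rfl | rfl
        · refine ⟨inv_ne_zero hs2, ?_⟩
          have h := hs₁ (s ^ 2 / (s ^ 2)⁻¹) (s ^ 2)⁻¹ (s ^ 2)⁻¹ (by field_simp)
          have h' := hs₂ (s ^ 2 / (s ^ 2)⁻¹) (s ^ 2)⁻¹ (s ^ 2)⁻¹ (by field_simp)
          rw [h, self_eq_neg.1 h', neg_zero]
        · refine ⟨pow_ne_zero _ hs0, ?_⟩
          have h := hs₂ (s ^ 4) (s ^ 2)⁻¹ (s ^ 2)⁻¹ (by field_simp)
          rw [show s ^ 2 / s ^ 4 = (s ^ 2)⁻¹ by field_simp]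
          exact self_eq_neg.1 h
        · refine ⟨hs0, ?_⟩
          have h := hs₁ c c (c ^ 2)⁻¹ (by field_simp)
          rw [show c ^ 2 / c = c by field_simp]
          exact self_eq_neg.1 h
    · have hb0 : [w, w⁻¹, l, l⁻¹, 1].Pairwise fun c d => ∀ m : ℤ, d ≠ p ^ m * c :=
        hbnd.imp_of_mem fun hc hd hcd m =>
          ne_zpow_mul_of_norm hp0 hp hcd (hbn _ hc).2 (hbn _ hd).2 m
      have hQ0 : ∀ c ∈ [w, w⁻¹, l, l⁻¹, 1], ∃ j k : ℤ, c = s ^ (0 : ℤ) * (w ^ j * l ^ k) := by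
        simp only [List.mem_cons, List.not_mem_nil, or_false, forall_eq_or_imp, forall_eq]
        exact ⟨⟨1, 0, by simp⟩, ⟨-1, 0, by simp⟩, ⟨0, 1, by simp⟩, ⟨0, -1, by simp⟩, ⟨0, 0, by simp⟩⟩
      have hQ2 : ∀ c ∈ [w, w⁻¹, l, l⁻¹, 1].map (s ^ 2 * ·),
          ∃ j k : ℤ, c = s ^ (2 : ℤ) * (w ^ j * l ^ k) := by
        intro c hc
        obtain ⟨d, hd, rfl⟩ := List.mem_map.1 hc
        obtain ⟨j, k, h⟩ := hQ0 d hd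
        refine ⟨j, k, ?_⟩
        rw [zpow_zero, one_mul] at h
        rw [← h]
        norm_cast
      have hQm : ∃ j k : ℤ, (s ^ 2)⁻¹ = s ^ (-2 : ℤ) * (w ^ j * l ^ k) :=
        ⟨0, 0, by rw [zpow_neg]; norm_cast; simp⟩
      have hQ4 : ∃ j k : ℤ, s ^ 4 = s ^ (4 : ℤ) * (w ^ j * l ^ k) := ⟨0, 0, by norm_cast; simp⟩
      have hQ1 : ∃ j k : ℤ, s = s ^ (1 : ℤ) * (w ^ j * l ^ k) := ⟨0, 0, by simp⟩
      have R : ∀ {e e' : ℤ} (_ : e ≠ e') {c d : ℂ} (_ : ∃ j k : ℤ, c = s ^ e * (w ^ j * l ^ k))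
          (_ : ∃ j k : ℤ, d = s ^ e' * (w ^ j * l ^ k)) (m : ℤ), d ≠ p ^ m * c :=
        fun hee _ _ hc hd m => ne_zpow_mul_of_notMem_resonantSet hw0 hl0 hs0 hs hee hc hd m
      rw [List.pairwise_append, List.pairwise_append]
      refine ⟨hb0, ⟨?_, ?_, ?_⟩, ?_⟩
      · rw [List.pairwise_map]
        refine hb0.imp fun {c d} h m hm => h m ?_
        refine mul_left_cancel₀ hs2 ?_
        rw [hm]
        ring
      · simp only [List.pairwise_cons, List.mem_cons, List.not_mem_nil, or_false,
          forall_eq_or_imp, forall_eq, IsEmpty.forall_iff, implies_true, List.Pairwise.nil,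
          and_true]
        exact ⟨⟨R (by norm_num) hQm hQ4, R (by norm_num) hQm hQ1⟩, R (by norm_num) hQ4 hQ1⟩
      · intro c hc d hd
        simp only [List.mem_cons, List.not_mem_nil, or_false] at hd
        rcases hd with rfl | rfl | rfl
        · exact R (by norm_num) (hQ2 c hc) hQm
        · exact R (by norm_num) (hQ2 c hc) hQ4
        · exact R (by norm_num) (hQ2 c hc) hQ1
      · intro c hc d hd
        rw [List.mem_append] at hd
        simp only [List.mem_cons (l := [_, _]), List.mem_cons (l := [_]), List.mem_cons (l := []),
          List.not_mem_nil, or_false] at hd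
        rcases hd with hd | rfl | rfl | rfl
        · exact R (by norm_num) (hQ0 c hc) (hQ2 d hd)
        · exact R (by norm_num) (hQ0 c hc) hQm
        · exact R (by norm_num) (hQ0 c hc) hQ4
        · exact R (by norm_num) (hQ0 c hc) hQ1
  have hx₁ : x₁ ≠ 0 := by rintro rfl; simp at hx
  have hx₂ : x₂ ≠ 0 := by rintro rfl; simp at hx
  obtain ⟨s, hs⟩ : ∃ s : ℂ, s ^ 2 = x₁ * x₂ := IsAlgClosed.exists_pow_nat_eq _ two_pos
  have hs0 : s ≠ 0 := by
    rintro rfl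
    simp [hx₁, hx₂] at hs
  have h := eq_zero_of_countable_compl (f := fun s => D x₁ (s ^ 2 / x₁) (s ^ 2)⁻¹)
    (fun s h => hcont x₁ s hx₁ h) (countable_resonantSet p w l)
    (fun s h0 h1 => hgen s h0 h1 x₁ hx₁) hs0
  have e1 : s ^ 2 / x₁ = x₂ := by rw [hs]; field_simp
  have e2 : (s ^ 2)⁻¹ = x₃ := by
    rw [hs]
    exact inv_eq_of_mul_eq_one_right hx
  simpa only [e1, e2] using h

section Smooth

variable {E : Type*} [NormedAddCommGroup E] [NormedSpace ℂ E] {p : ℂ} {z : E} {f₁ f₂ f₃ : E → ℂ}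

@[fun_prop]
theorem DifferentiableAt.pairTheta {a : ℂ} (hp : ‖p‖ < 1) (ha : a ≠ 0)
    (hf : DifferentiableAt ℂ f₁ z) (h0 : f₁ z ≠ 0) :
    DifferentiableAt ℂ (fun z => pairTheta p a (f₁ z)) z := by
  unfold _root_.pairTheta
  fun_prop (disch := first | assumption | positivity)

@[fun_prop]
theorem DifferentiableAt.orbitTheta {a : ℂ} (hp : ‖p‖ < 1) (ha : a ≠ 0)
    (hf₁ : DifferentiableAt ℂ f₁ z) (hf₂ : DifferentiableAt ℂ f₂ z) (hf₃ : DifferentiableAt ℂ f₃ z)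
    (h₁ : f₁ z ≠ 0) (h₂ : f₂ z ≠ 0) (h₃ : f₃ z ≠ 0) :
    DifferentiableAt ℂ (fun z => orbitTheta p a (f₁ z) (f₂ z) (f₃ z)) z := by
  unfold _root_.orbitTheta
  fun_prop (disch := first | assumption | positivity)

@[fun_prop]
theorem DifferentiableAt.weylTheta (hp : ‖p‖ < 1)
    (hf₁ : DifferentiableAt ℂ f₁ z) (hf₂ : DifferentiableAt ℂ f₂ z) (hf₃ : DifferentiableAt ℂ f₃ z)
    (h₁ : f₁ z ≠ 0) (h₂ : f₂ z ≠ 0) (h₃ : f₃ z ≠ 0) :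
    DifferentiableAt ℂ (fun z => weylTheta p (f₁ z) (f₂ z) (f₃ z)) z := by
  unfold _root_.weylTheta
  fun_prop (disch := first | assumption | positivity)

@[fun_prop]
theorem DifferentiableAt.tripleTheta {u : ℂ} (hp : ‖p‖ < 1) (hu : u ≠ 0)
    (hf₁ : DifferentiableAt ℂ f₁ z) (hf₂ : DifferentiableAt ℂ f₂ z) (hf₃ : DifferentiableAt ℂ f₃ z)
    (h₁ : f₁ z ≠ 0) (h₂ : f₂ z ≠ 0) (h₃ : f₃ z ≠ 0) :
    DifferentiableAt ℂ (fun z => tripleTheta p u (f₁ z) (f₂ z) (f₃ z)) z := by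
  unfold _root_.tripleTheta
  fun_prop (disch := first | assumption | positivity)

@[fun_prop]
theorem DifferentiableAt.evenTheta {r A w l : ℂ} (hp : ‖p‖ < 1) (hr : r ≠ 0)
    (hf₁ : DifferentiableAt ℂ f₁ z) (hf₂ : DifferentiableAt ℂ f₂ z) (hf₃ : DifferentiableAt ℂ f₃ z)
    (h₁ : f₁ z ≠ 0) (h₂ : f₂ z ≠ 0) (h₃ : f₃ z ≠ 0) :
    DifferentiableAt ℂ (fun z => evenTheta p r A w l (f₁ z) (f₂ z) (f₃ z)) z := by
  have h : (-1 : ℂ) ≠ 0 := by simp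
  unfold _root_.evenTheta
  fun_prop (disch := first | assumption | positivity)

@[fun_prop]
theorem DifferentiableAt.prodTheta {w l b₁ b₂ b₃ : ℂ} (hp : ‖p‖ < 1) (hw : w ≠ 0) (hl : l ≠ 0)
    (hb₁ : b₁ ≠ 0) (hb₂ : b₂ ≠ 0) (hb₃ : b₃ ≠ 0) (hf₁ : DifferentiableAt ℂ f₁ z)
    (h₁ : f₁ z ≠ 0) : DifferentiableAt ℂ (fun z => prodTheta p w l b₁ b₂ b₃ (f₁ z)) z := by
  unfold _root_.prodTheta
  fun_prop (disch := first | assumption | positivity)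

@[fun_prop]
theorem DifferentiableAt.numTheta {r w l b₁ b₂ b₃ : ℂ} (hp : ‖p‖ < 1) (hr : r ≠ 0) (hw : w ≠ 0)
    (hl : l ≠ 0) (hb₁ : b₁ ≠ 0) (hb₂ : b₂ ≠ 0) (hb₃ : b₃ ≠ 0)
    (hf₁ : DifferentiableAt ℂ f₁ z) (hf₂ : DifferentiableAt ℂ f₂ z) (hf₃ : DifferentiableAt ℂ f₃ z)
    (h₁ : f₁ z ≠ 0) (h₂ : f₂ z ≠ 0) (h₃ : f₃ z ≠ 0) :
    DifferentiableAt ℂ (fun z => numTheta p r w l b₁ b₂ b₃ (f₁ z) (f₂ z) (f₃ z)) z := by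
  unfold _root_.numTheta
  fun_prop (disch := first | assumption | positivity)

end Smooth

/-- The alternating sum of `numTheta` over the permutations of `x₁, x₂, x₃`. -/
noncomputable def altTheta (p r w l b₁ b₂ b₃ x₁ x₂ x₃ : ℂ) : ℂ :=
  numTheta p r w l b₁ b₂ b₃ x₁ x₂ x₃ - numTheta p r w l b₁ b₂ b₃ x₂ x₁ x₃ -
    numTheta p r w l b₁ b₂ b₃ x₁ x₃ x₂ - numTheta p r w l b₁ b₂ b₃ x₃ x₂ x₁ +
    numTheta p r w l b₁ b₂ b₃ x₂ x₃ x₁ + numTheta p r w l b₁ b₂ b₃ x₃ x₁ x₂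

/-- The coefficient of `orbitTheta p l` in the expansion of `altTheta`. -/
noncomputable def contiguityCoeff (p r w l b₁ b₂ b₃ : ℂ) : ℂ :=
  ellTheta (-r) p * halfPeriodTheta p r (w / (w * l * b₁ * b₂ * b₃)) *
    (ellTheta (b₁ * b₂ * w) p * ellTheta (b₁ * b₃ * w) p * ellTheta (b₂ * b₃ * w) p) *
    prodTheta p w l b₁ b₂ b₃ w / (w ^ 2 * ellTheta w p * pairTheta p l w)

section Expansion

variable {p r w l b₁ b₂ b₃ x₁ x₂ x₃ : ℂ}

theorem pairTheta_self (hw : w ≠ 0) : pairTheta p w w = 0 := by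
  rw [pairTheta, div_self hw, ellTheta_one, mul_zero]

theorem numTheta_first_eq_zero (hw : w ≠ 0) : numTheta p r w l b₁ b₂ b₃ w x₂ x₃ = 0 := by
  unfold numTheta prodTheta
  rw [mul_inv_cancel₀ hw, ellTheta_one]
  ring

theorem numTheta_third_eq_zero (hw : w ≠ 0) : numTheta p r w l b₁ b₂ b₃ x₁ x₂ w = 0 := by
  unfold numTheta
  rw [pairTheta_self hw]
  ring

theorem altTheta_comm (hp0 : p ≠ 0) (hp : ‖p‖ < 1) (hr : r ^ 2 = p) (hw : w ≠ 0)
    (hl : l ≠ 0) (h₁ : b₁ ≠ 0) (h₂ : b₂ ≠ 0) (h₃ : b₃ ≠ 0) :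
    altTheta p r w l b₁ b₂ b₃ x₁ x₂ x₃ = altTheta p r l w b₁ b₂ b₃ x₁ x₂ x₃ := by
  unfold altTheta
  simp only [numTheta_comm hp0 hp hr hw hl h₁ h₂ h₃]

theorem altTheta_of_first_eq (hp0 : p ≠ 0) (hp : ‖p‖ < 1) (hr : r ^ 2 = p) (hw : w ≠ 0)
    (hl : l ≠ 0) (h₁ : b₁ ≠ 0) (h₂ : b₂ ≠ 0) (h₃ : b₃ ≠ 0) (hθw : ellTheta w p ≠ 0)
    (hθ : pairTheta p l w ≠ 0) (hx : w * x₂ * x₃ = 1) :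
    altTheta p r w l b₁ b₂ b₃ w x₂ x₃ =
      -weylTheta p w x₂ x₃ * (contiguityCoeff p r w l b₁ b₂ b₃ * orbitTheta p l w x₂ x₃) := by
  have hx' : w * x₃ * x₂ = 1 := by linear_combination hx
  have hB : w * b₁ * b₂ * b₃ ≠ 0 := by positivity
  have h5 := weierstrass_five hp0 hp hw h₁ h₂ h₃ hx
  unfold altTheta
  rw [numTheta_first_eq_zero hw, numTheta_first_eq_zero hw, numTheta_third_eq_zero hw,
    numTheta_third_eq_zero hw, numTheta_restrict hp0 hp hr hw hl h₁ h₂ h₃ hx,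
    numTheta_restrict hp0 hp hr hw hl h₁ h₂ h₃ hx']
  unfold contiguityCoeff orbitTheta weylTheta
  set B := w * b₁ * b₂ * b₃
  generalize halfPeriodTheta p r (w / (w * l * b₁ * b₂ * b₃)) = t₁ at *
  generalize prodTheta p w l b₁ b₂ b₃ w = t₂ at *
  generalize ellTheta (-r) p = t₃ at *
  generalize pairTheta p l w = t₄ at *
  generalize ellTheta w p = t₅ at *
  generalize ellTheta (b₁ * b₂ * w) p * ellTheta (b₁ * b₃ * w) p * ellTheta (b₂ * b₃ * w) p = t₆
    at *
  generalize x₃ ^ 2 * (ellTheta (b₁ / x₃) p * ellTheta (b₂ / x₃) p * ellTheta (b₃ / x₃) p *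
    ellTheta (x₂ / B) p) = s₁ at *
  generalize x₂ ^ 2 * (ellTheta (b₁ / x₂) p * ellTheta (b₂ / x₂) p * ellTheta (b₃ / x₂) p *
    ellTheta (x₃ / B) p) = s₂ at *
  generalize ellTheta (x₂ / x₃) p = s₃ at *
  generalize ellTheta (w / x₂) p = s₄ at *
  generalize ellTheta (w / x₃) p = s₅ at *
  clear_value B
  rw [sub_eq_iff_eq_add.1 h5]
  field_simp
  ring

/-- The alternating sum of `numTheta` as a combination of two functions `orbitTheta`. -/
theorem altTheta_eq (hp0 : p ≠ 0) (hp : ‖p‖ < 1) (hr : r ^ 2 = p)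
    (hw : ‖p‖ < ‖w‖ ^ 2) (hw1 : ‖w‖ < 1) (hl : ‖p‖ < ‖l‖ ^ 2) (hl1 : ‖l‖ < 1) (hwl : w ≠ l)
    (h₁ : b₁ ≠ 0) (h₂ : b₂ ≠ 0) (h₃ : b₃ ≠ 0) (hθw : ellTheta w p ≠ 0) (hθl : ellTheta l p ≠ 0)
    (hlw : pairTheta p l w ≠ 0) (hwl' : pairTheta p w l ≠ 0) (hx : x₁ * x₂ * x₃ = 1) :
    altTheta p r w l b₁ b₂ b₃ x₁ x₂ x₃ = -weylTheta p x₁ x₂ x₃ *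
      (contiguityCoeff p r w l b₁ b₂ b₃ * orbitTheta p l x₁ x₂ x₃ +
        contiguityCoeff p r l w b₁ b₂ b₃ * orbitTheta p w x₁ x₂ x₃) := by
  have hw0 : w ≠ 0 := by
    rintro rfl
    simp only [norm_zero, ne_eq, OfNat.ofNat_ne_zero, not_false_eq_true, zero_pow] at hw
    exact absurd hw (norm_nonneg p).not_gt
  have hl0 : l ≠ 0 := by
    rintro rfl
    simp only [norm_zero, ne_eq, OfNat.ofNat_ne_zero, not_false_eq_true, zero_pow] at hl
    exact absurd hl (norm_nonneg p).not_gt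
  have hr0 : r ≠ 0 := by
    rintro rfl
    simp at hr
    exact hp0 hr.symm
  rw [neg_mul, ← add_eq_zero_iff_eq_neg]
  have h0 : ∀ {a b c : ℂ}, a * b * c = 1 → a ≠ 0 ∧ b ≠ 0 ∧ c ≠ 0 := by
    intro a b c h
    refine ⟨?_, ?_, ?_⟩ <;> rintro rfl <;> simp at h
  refine eq_zero_of_antisymmetric hp0 hp hw hw1 hl hl1 hwl (D := fun x₁ x₂ x₃ =>
    altTheta p r w l b₁ b₂ b₃ x₁ x₂ x₃ + weylTheta p x₁ x₂ x₃ *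
      (contiguityCoeff p r w l b₁ b₂ b₃ * orbitTheta p l x₁ x₂ x₃ +
        contiguityCoeff p r l w b₁ b₂ b₃ * orbitTheta p w x₁ x₂ x₃))
    ?_ ?_ ?_ ?_ ?_ ?_ ?_ ?_ hx
  · intro x₁ x₂ x₃ hx
    obtain ⟨n1, n2, n3⟩ := h0 hx
    rw [weylTheta_swap₁ hp n1 n2]
    unfold altTheta orbitTheta
    ring
  · intro x₁ x₂ x₃ hx
    obtain ⟨n1, n2, n3⟩ := h0 hx
    rw [weylTheta_swap₂ hp n2 n3]
    unfold altTheta orbitTheta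
    ring
  · intro x₁ x₂ x₃ hx
    rw [weylTheta_inv hp hx]
    unfold altTheta orbitTheta
    simp only [pairTheta_inv]
    have ni : ∀ {a b c : ℂ}, a * b * c = 1 → numTheta p r w l b₁ b₂ b₃ a⁻¹ b⁻¹ c⁻¹ =
        -numTheta p r w l b₁ b₂ b₃ b a c := fun h => numTheta_inv hp0 hp hr hw0 hl0 h₁ h₂ h₃ h
    rw [ni (a := x₁) (b := x₂) (c := x₃) hx,
      ni (a := x₂) (b := x₁) (c := x₃) (by linear_combination hx),
      ni (a := x₁) (b := x₃) (c := x₂) (by linear_combination hx),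
      ni (a := x₃) (b := x₂) (c := x₁) (by linear_combination hx),
      ni (a := x₂) (b := x₃) (c := x₁) (by linear_combination hx),
      ni (a := x₃) (b := x₁) (c := x₂) (by linear_combination hx)]
    ring
  · intro x₂ x₃ hx
    have e : orbitTheta p w w x₂ x₃ = 0 := by
      rw [orbitTheta, pairTheta_self hw0]
      ring
    rw [altTheta_of_first_eq hp0 hp hr hw0 hl0 h₁ h₂ h₃ hθw hlw hx, e]
    ring
  · intro x₂ x₃ hx
    have e : orbitTheta p l l x₂ x₃ = 0 := by
      rw [orbitTheta, pairTheta_self hl0]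
      ring
    rw [altTheta_comm hp0 hp hr hw0 hl0 h₁ h₂ h₃,
      altTheta_of_first_eq hp0 hp hr hl0 hw0 h₁ h₂ h₃ hθl hwl' hx, e]
    ring
  · intro x₁ x₂ x₃ n1 n2 n3
    rw [weylTheta_shift hp0 hp n1 n2 n3, orbitTheta_shift hp0 hp hl0 n1 n2,
      orbitTheta_shift hp0 hp hw0 n1 n2]
    unfold altTheta
    rw [numTheta_shift₁₂ (x₁ := x₁) (x₂ := x₂) hp0 hp hr0 hw0 hl0 h₁ h₂ h₃ n1 n2,
      numTheta_shift₁₃ (x₁ := x₁) (x₃ := x₂) hp0 hp hr0 hw0 hl0 h₁ h₂ h₃ n1 n2,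
      numTheta_shift₂₃ (x₂ := x₁) (x₃ := x₂) hp0 hp hr0 hw0 hl0 h₁ h₂ h₃ n1 n2]
    have s21 : numTheta p r w l b₁ b₂ b₃ x₂ (p * x₁) x₃ =
        (x₂ / x₁) ^ 6 * numTheta p r w l b₁ b₂ b₃ (p * x₂) x₁ x₃ := by
      rw [numTheta_shift₁₂ hp0 hp hr0 hw0 hl0 h₁ h₂ h₃ n2 n1]
      field_simp
    have s31 : numTheta p r w l b₁ b₂ b₃ x₂ x₃ (p * x₁) =
        (x₂ / x₁) ^ 6 * numTheta p r w l b₁ b₂ b₃ (p * x₂) x₃ x₁ := by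
      rw [numTheta_shift₁₃ hp0 hp hr0 hw0 hl0 h₁ h₂ h₃ n2 n1]
      field_simp
    have s32 : numTheta p r w l b₁ b₂ b₃ x₃ x₂ (p * x₁) =
        (x₂ / x₁) ^ 6 * numTheta p r w l b₁ b₂ b₃ x₃ (p * x₂) x₁ := by
      rw [numTheta_shift₂₃ hp0 hp hr0 hw0 hl0 h₁ h₂ h₃ n2 n1]
      field_simp
    rw [s21, s31, s32]
    ring
  · intro c d z hc hd hz
    unfold altTheta
    fun_prop (disch := first | assumption | positivity)
  · intro z s hz hs
    unfold altTheta
    refine DifferentiableAt.continuousAt (𝕜 := ℂ) ?_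
    fun_prop (disch := first | assumption | positivity)

end Expansion

/-! ### The elliptic gamma function -/

section Gamma

variable {p q u : ℂ}

theorem pqPoch_comm (u p q : ℂ) : pqPoch u p q = pqPoch u q p := by
  unfold pqPoch
  rw [← (Equiv.prodComm ℕ ℕ).tprod_eq]
  simp [mul_comm]

theorem differentiable_pqPoch (hp : ‖p‖ < 1) (hq : ‖q‖ < 1) :
    Differentiable ℂ fun u => pqPoch u p q :=
  differentiable_tprod_one_sub_mul (summable_norm_pow_mul_pow hp hq)

theorem pqPoch_ne_zero_of_norm_lt (hp : ‖p‖ < 1) (hq : ‖q‖ < 1) (hu : ‖u‖ < 1) :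
    pqPoch u p q ≠ 0 :=
  tprod_one_sub_mul_ne_zero (summable_norm_pow_mul_pow hp hq) fun m => by
    rw [mul_assoc]
    exact ne_one_of_norm_lt (norm_pow_mul_lt_one hp (norm_pow_mul_lt_one hq hu _) _)

theorem pqPoch_eq_mul (hp : ‖p‖ < 1) (hq : ‖q‖ < 1) (u : ℂ) :
    pqPoch u p q = qPoch u p * pqPoch (q * u) p q := by
  have h : ∀ v : ℂ, HasProd (fun n : ℕ => qPoch (q ^ n * v) p) (pqPoch v p q) := by
    intro v
    have h1 := (multipliable_one_sub_mul (summable_norm_pow_mul_pow hq hp) v).hasProd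
    rw [pqPoch_comm]
    refine h1.prod_fiberwise fun n => ?_
    have h2 := (multipliable_one_sub_mul (summable_norm_pow hp) (q ^ n * v)).hasProd
    refine h2.congr_fun ?_
    intro m
    ring
  have h1 := (h (q * u)).multipliable
  rw [← (h u).tprod_eq, ← (h (q * u)).tprod_eq, tprod_eq_zero_mul']
  · simp [pow_succ, mul_assoc]
  · simpa [pow_succ, mul_assoc] using h1

/-- The first order difference equation of the elliptic gamma function. -/
theorem ellGamma_mul (hq0 : q ≠ 0) (hp : ‖p‖ < 1) (hq : ‖q‖ < 1) (hu0 : u ≠ 0) (hu : ‖u‖ < 1) :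
    ellGamma (q * u) p q = ellTheta u p * ellGamma u p q := by
  unfold ellGamma ellTheta
  have e1 : p * q * (q * u)⁻¹ = p / u := by field_simp
  have e2 : q * (p / u) = p * q * u⁻¹ := by ring
  rw [e1, pqPoch_eq_mul hp hq (p / u), pqPoch_eq_mul hp hq u, e2]
  have h1 := qPoch_ne_zero_of_norm_lt hp hu
  field_simp

/-- The reflection formula for `Γ(u) Γ(u⁻¹)`. It remains true at the poles of the product, which
are zeros of the right-hand side, thanks to the convention `0⁻¹ = 0`. -/
theorem ellGamma_mul_inv (hp : ‖p‖ < 1) (hq : ‖q‖ < 1) (hu : ‖u‖ = 1) :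
    (ellGamma u p q * ellGamma u⁻¹ p q)⁻¹ = ellTheta u p * ellTheta u⁻¹ q := by
  have hu0 : u ≠ 0 := by rintro rfl; simp at hu
  have hn : ‖p * q‖ < 1 := by
    rw [norm_mul]
    exact (mul_le_of_le_one_right (norm_nonneg _) hq.le).trans_lt hp
  have n1 : pqPoch (p * q * u⁻¹) p q ≠ 0 :=
    pqPoch_ne_zero_of_norm_lt hp hq (by rwa [norm_mul, norm_inv, hu, inv_one, mul_one])
  have n2 : pqPoch (p * q * u) p q ≠ 0 :=
    pqPoch_ne_zero_of_norm_lt hp hq (by rwa [norm_mul, hu, mul_one])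
  have e1 : pqPoch u p q = qPoch u p * (qPoch (q * u) q * pqPoch (p * q * u) p q) := by
    rw [pqPoch_eq_mul hp hq u, pqPoch_comm (q * u), pqPoch_eq_mul hq hp (q * u),
      pqPoch_comm _ q, mul_assoc p]
  have e2 : pqPoch u⁻¹ p q = qPoch u⁻¹ q * (qPoch (p * u⁻¹) p * pqPoch (p * q * u⁻¹) p q) := by
    rw [pqPoch_comm, pqPoch_eq_mul hq hp u⁻¹, pqPoch_comm _ q, pqPoch_eq_mul hp hq (p * u⁻¹),
      show q * (p * u⁻¹) = p * q * u⁻¹ by ring]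
  unfold ellGamma ellTheta
  rw [div_mul_div_comm, inv_div, inv_inv, e1, e2, div_inv_eq_mul, ← div_eq_mul_inv p]
  generalize pqPoch (p * q * u⁻¹) p q = t₁ at *
  generalize pqPoch (p * q * u) p q = t₂ at *
  rw [mul_comm q u, mul_comm u q, div_eq_iff (mul_ne_zero n1 n2)]
  ring

theorem differentiableAt_ellGamma (hp : ‖p‖ < 1) (hq : ‖q‖ < 1) (hu0 : u ≠ 0) (hu : ‖u‖ < 1) :
    DifferentiableAt ℂ (fun u => ellGamma u p q) u := by
  unfold ellGamma
  refine DifferentiableAt.div ?_ (differentiable_pqPoch hp hq u)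
    (pqPoch_ne_zero_of_norm_lt hp hq hu)
  exact DifferentiableAt.comp (f := fun u => p * q * u⁻¹) u (differentiable_pqPoch hp hq _)
    (by fun_prop (disch := assumption))

@[fun_prop]
theorem DifferentiableAt.ellGamma {E : Type*} [NormedAddCommGroup E] [NormedSpace ℂ E] {f : E → ℂ}
    {z : E} (hf : DifferentiableAt ℂ f z) (hp : ‖p‖ < 1) (hq : ‖q‖ < 1) (h0 : f z ≠ 0)
    (h1 : ‖f z‖ < 1) : DifferentiableAt ℂ (fun z => ellGamma (f z) p q) z :=
  DifferentiableAt.comp (f := f) z (differentiableAt_ellGamma hp hq h0 h1) hf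

end Gamma

/-- The product `Γ(a x, a / x; p, q)`. -/
noncomputable def pairGamma (p q a x : ℂ) : ℂ := ellGamma (a * x) p q * ellGamma (a / x) p q

/-- The product of `Γ(a x^α; p, q)` over the six short roots `α`. -/
noncomputable def orbitGamma (p q a x₁ x₂ x₃ : ℂ) : ℂ :=
  pairGamma p q a x₁ * pairGamma p q a x₂ * pairGamma p q a x₃

theorem inv_ellGamma_mul {p q u v : ℂ} (hp : ‖p‖ < 1) (hq : ‖q‖ < 1) (hu : ‖u‖ = 1)
    (hv : v = u⁻¹) :
    (ellGamma u p q)⁻¹ * (ellGamma v p q)⁻¹ = ellTheta u p * ellTheta v q := by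
  rw [hv, ← mul_inv, ellGamma_mul_inv hp hq hu]

theorem weylTheta_mul_weylTheta {p q x y : ℂ} (hp : ‖p‖ < 1) (hq : ‖q‖ < 1) (n0 : x ≠ 0)
    (n1 : y ≠ 0) :
    weylTheta p y (x * y) (x * y ^ 2)⁻¹ * weylTheta q y (x * y) (x * y ^ 2)⁻¹ =
    (ellTheta y p * ellTheta y⁻¹ q) * (ellTheta (x * y) p * ellTheta (x⁻¹ * y⁻¹) q) *
    (ellTheta (x * y ^ 2) p * ellTheta (x⁻¹ * y⁻¹ ^ 2) q) * (ellTheta x p * ellTheta x⁻¹ q) *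
    (ellTheta (x * y ^ 3) p * ellTheta (x⁻¹ * y⁻¹ ^ 3) q) *
    (ellTheta (x ^ 2 * y ^ 3) p * ellTheta (x⁻¹ ^ 2 * y⁻¹ ^ 3) q) := by
  unfold weylTheta
  rw [show y / (x * y) = x⁻¹ by field_simp, show y / (x * y ^ 2)⁻¹ = x * y ^ 3 by field_simp,
    show x * y / (x * y ^ 2)⁻¹ = x ^ 2 * y ^ 3 by field_simp,
    ellTheta_inv hp n0, ellTheta_inv (u := x * y ^ 2) hp (by positivity), ellTheta_inv hq n1,
    ellTheta_inv' (v := x⁻¹ * y⁻¹) (u := x * y) hq (by positivity) (by field_simp),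
    ellTheta_inv' (v := x⁻¹ * y⁻¹ ^ 3) (u := x * y ^ 3) hq (by positivity) (by field_simp),
    ellTheta_inv' (v := x⁻¹ ^ 2 * y⁻¹ ^ 3) (u := x ^ 2 * y ^ 3) hq (by positivity)
      (by field_simp),
    show x⁻¹ * y⁻¹ ^ 2 = (x * y ^ 2)⁻¹ by field_simp]
  generalize ellTheta y p = t₁
  generalize ellTheta (x * y) p = t₂
  generalize ellTheta (x * y ^ 2) p = t₃
  generalize ellTheta x p = t₄
  generalize ellTheta (x * y ^ 3) p = t₅
  generalize ellTheta (x ^ 2 * y ^ 3) p = t₆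
  generalize ellTheta y q = s₁
  generalize ellTheta (x * y) q = s₂
  generalize ellTheta (x * y ^ 2)⁻¹ q = s₃
  generalize ellTheta x⁻¹ q = s₄
  generalize ellTheta (x * y ^ 3) q = s₅
  generalize ellTheta (x ^ 2 * y ^ 3) q = s₆
  have e : (x * y * (x * y ^ 2)⁻¹ ^ 2) ^ 2 * (x⁻¹ * (x * y ^ 2)⁻¹) =
      y⁻¹ * (x * y)⁻¹ * ((x * y ^ 3)⁻¹ * (x ^ 2 * y ^ 3)⁻¹) := by
    field_simp
  linear_combination (t₁ * t₂ * t₃ * t₄ * t₅ * t₆ * (s₁ * s₂ * s₃ * s₄ * s₅ * s₆)) * e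

/-- The integrand in terms of theta functions and of the short roots `x₁ = z₂`, `x₂ = z₁ z₂`,
`x₃ = (z₁ z₂²)⁻¹`. -/
theorem g2Phi_eq {p q : ℂ} (hp : ‖p‖ < 1) (hq : ‖q‖ < 1) (a : Fin 5 → ℂ) {z : Fin 2 → ℂ}
    (h0 : ‖z 0‖ = 1) (h1 : ‖z 1‖ = 1) :
    g2Phi p q a z =
      (∏ k, orbitGamma p q (a k) (z 1) (z 0 * z 1) (z 0 * z 1 ^ 2)⁻¹) *
        (weylTheta p (z 1) (z 0 * z 1) (z 0 * z 1 ^ 2)⁻¹ *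
          weylTheta q (z 1) (z 0 * z 1) (z 0 * z 1 ^ 2)⁻¹) := by
  have n0 : z 0 ≠ 0 := by intro h; rw [h] at h0; simp at h0
  have n1 : z 1 ≠ 0 := by intro h; rw [h] at h1; simp at h1
  unfold g2Phi g2PhiPlus
  simp only [Pi.inv_apply]
  generalize z 0 = x at *
  generalize z 1 = y at *
  have m1 : ∏ k, orbitGamma p q (a k) y (x * y) (x * y ^ 2)⁻¹ =
      (∏ k, ellGamma (a k * y) p q * ellGamma (a k * (x * y)) p q *
        ellGamma (a k * (x * y ^ 2)) p q) *
      ∏ k, ellGamma (a k * y⁻¹) p q * ellGamma (a k * (x⁻¹ * y⁻¹)) p q *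
        ellGamma (a k * (x⁻¹ * y⁻¹ ^ 2)) p q := by
    rw [← Finset.prod_mul_distrib]
    refine Finset.prod_congr rfl fun k _ => ?_
    unfold orbitGamma pairGamma
    rw [show a k / y = a k * y⁻¹ by ring, show a k / (x * y) = a k * (x⁻¹ * y⁻¹) by field_simp,
      show a k * (x * y ^ 2)⁻¹ = a k * (x⁻¹ * y⁻¹ ^ 2) by field_simp,
      show a k / (x * y ^ 2)⁻¹ = a k * (x * y ^ 2) by field_simp]
    ring
  have l1 := inv_ellGamma_mul (v := y⁻¹) hp hq h1 (by field_simp)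
  have l2 := inv_ellGamma_mul (u := x * y) (v := x⁻¹ * y⁻¹) hp hq (by simp [h0, h1]) (by field_simp)
  have l3 := inv_ellGamma_mul (u := x * y ^ 2) (v := x⁻¹ * y⁻¹ ^ 2) hp hq (by simp [h0, h1])
    (by field_simp)
  have l4 := inv_ellGamma_mul (v := x⁻¹) hp hq h0 (by field_simp)
  have l5 := inv_ellGamma_mul (u := x * y ^ 3) (v := x⁻¹ * y⁻¹ ^ 3) hp hq (by simp [h0, h1])
    (by field_simp)
  have l6 := inv_ellGamma_mul (u := x ^ 2 * y ^ 3) (v := x⁻¹ ^ 2 * y⁻¹ ^ 3) hp hq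
    (by simp [h0, h1]) (by field_simp)
  have m2 := weylTheta_mul_weylTheta hp hq n0 n1
  rw [m1, m2, ← l1, ← l2, ← l3, ← l4, ← l5, ← l6]
  simp only [div_eq_mul_inv, mul_inv]
  ring

/-! ### Integrals over the torus -/

instance fact_two_pi_pos : Fact (0 < 2 * Real.pi) := ⟨Real.two_pi_pos⟩

/-- The circle `ℝ / 2πℤ`. -/
abbrev Angle := AddCircle (2 * Real.pi)

/-- The point of the unit circle in `ℂ` with the given angle. -/
noncomputable def unitPt (t : Angle) : ℂ := (AddCircle.toCircle t : ℂ)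

theorem unitPt_add (s t : Angle) : unitPt (s + t) = unitPt s * unitPt t := by
  simp [unitPt, AddCircle.toCircle_add]

theorem unitPt_neg (t : Angle) : unitPt (-t) = (unitPt t)⁻¹ := by
  simp [unitPt, AddCircle.toCircle_neg]

theorem norm_unitPt (t : Angle) : ‖unitPt t‖ = 1 := Circle.norm_coe _

theorem unitPt_ne_zero (t : Angle) : unitPt t ≠ 0 := by simp [unitPt]

theorem continuous_unitPt : Continuous unitPt :=
  continuous_subtype_val.comp AddCircle.continuous_toCircle

theorem unitPt_coe (t : ℝ) : unitPt (t : Angle) = Complex.exp (t * Complex.I) := by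
  rw [unitPt, AddCircle.toCircle_apply_mk, Circle.coe_exp, div_self Real.two_pi_pos.ne', one_mul]

theorem exists_eq_norm_mul_unitPt (q : ℂ) : ∃ γ : Angle, q = ‖q‖ * unitPt γ := by
  refine ⟨(Complex.arg q : ℝ), ?_⟩
  rw [unitPt_coe, Complex.norm_mul_exp_arg_mul_I]

theorem circleIntegral_inv_smul_eq (h : ℂ → ℂ) (R : ℝ) (hR : R ≠ 0) :
    (∮ z in C(0, R), (z - 0)⁻¹ • h z) = Complex.I * ∫ t : Angle, h (R * unitPt t) := by
  rw [circleIntegral, ← AddCircle.intervalIntegral_preimage (2 * Real.pi) 0, zero_add,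
    ← intervalIntegral.integral_const_mul]
  refine intervalIntegral.integral_congr fun t _ => ?_
  simp only [unitPt_coe, deriv_circleMap, circleMap, zero_add, sub_zero, smul_eq_mul]
  have : (R : ℂ) ≠ 0 := by exact_mod_cast hR
  field_simp

/-- The mean value of a holomorphic function over the unit circle agrees with that over the
circle of radius `‖q‖`. -/
theorem integral_unitPt_eq_integral_mul {q : ℂ} (hq0 : q ≠ 0) (hq : ‖q‖ < 1) {h : ℂ → ℂ}
    (hd : ∀ z, ‖q‖ ≤ ‖z‖ → ‖z‖ ≤ 1 → DifferentiableAt ℂ h z) :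
    ∫ t : Angle, h (unitPt t) = ∫ t : Angle, h (q * unitPt t) := by
  have hqn : 0 < ‖q‖ := norm_pos_iff.2 hq0
  have h1 := Complex.circleIntegral_sub_center_inv_smul_eq_of_differentiable_on_annulus_off_countable
    (c := 0) (f := h) hqn hq.le Set.countable_empty
    (fun z hz => (hd z (by simpa using hz.2) (by simpa using hz.1)).continuousAt.continuousWithinAt)
    (fun z hz => hd z
      (by
        have := hz.1.2
        rw [mem_closedBall_zero_iff, not_le] at this
        exact this.le)
      (mem_ball_zero_iff.1 hz.1.1).le)
  rw [circleIntegral_inv_smul_eq h 1 one_ne_zero, circleIntegral_inv_smul_eq h _ hqn.ne'] at h1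
  have h2 := mul_left_cancel₀ Complex.I_ne_zero h1
  simp only [Complex.ofReal_one, one_mul] at h2
  rw [h2]
  obtain ⟨γ, hγ⟩ := exists_eq_norm_mul_unitPt q
  rw [← integral_add_left_eq_self _ γ]
  refine integral_congr_ae (.of_forall fun t => ?_)
  simp only
  conv_rhs => rw [hγ]
  rw [unitPt_add, mul_assoc]

theorem integral_comp_addEquiv (e : Angle × Angle ≃+ Angle × Angle) (he : Continuous e)
    (he' : Continuous e.symm) (G : Angle × Angle → ℂ) : ∫ x, G (e x) = ∫ x, G x := by
  have h : MeasurePreserving e volume volume := by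
    rw [Measure.volume_eq_prod]
    exact AddMonoidHom.measurePreserving (f := e.toAddMonoidHom) he e.surjective rfl
  exact h.integral_comp (Homeomorph.measurableEmbedding ⟨e.toEquiv, he, he'⟩) G

/-- The integral over the torus with respect to `(dz₁ / z₁) (dz₂ / z₂)`. The sign is that of
`i²`. -/
theorem torusIntegral_eq_integral_angle {G : ℂ → ℂ → ℂ}
    (hG : Continuous fun x : Angle × Angle => G (unitPt x.1) (unitPt x.2)) :
    torusIntegral (fun z : Fin 2 → ℂ => G (z 0) (z 1) / (z 0 * z 1)) 0 (fun _ => 1) =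
      -∫ x : Angle × Angle, G (unitPt x.1) (unitPt x.2) := by
  have hmp : MeasurePreserving (fun x : ℝ × ℝ => ((x.1 : Angle), (x.2 : Angle)))
      ((volume.restrict (Set.Ioc 0 (0 + 2 * Real.pi))).prod
        (volume.restrict (Set.Ioc 0 (0 + 2 * Real.pi)))) volume := by
    rw [Measure.volume_eq_prod]
    exact (AddCircle.measurePreserving_mk (2 * Real.pi) 0).prod
      (AddCircle.measurePreserving_mk (2 * Real.pi) 0)
  rw [← hmp.map_eq, integral_map hmp.measurable.aemeasurable
    hG.aestronglyMeasurable, Measure.prod_restrict, ← Measure.volume_eq_prod, zero_add]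
  have hv := (volume_preserving_finTwoArrow ℝ).symm _
  rw [torusIntegral, ← hv.setIntegral_preimage_emb (MeasurableEquiv.measurableEmbedding _)]
  have hs : (MeasurableEquiv.finTwoArrow (α := ℝ)).symm ⁻¹'
      (Set.Icc (0 : Fin 2 → ℝ) fun _ => 2 * Real.pi) =
      Set.Icc 0 (2 * Real.pi) ×ˢ Set.Icc 0 (2 * Real.pi) := by
    ext x
    simp [Set.mem_Icc, Pi.le_def, Fin.forall_fin_two, Prod.le_def]
  rw [hs, ← integral_neg, ← Measure.restrict_congr_set (μ := volume)
    (s := Set.Ioc 0 (2 * Real.pi) ×ˢ Set.Ioc 0 (2 * Real.pi))]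
  · refine integral_congr_ae (.of_forall fun x => ?_)
    simp [torusMap, Fin.prod_univ_two, unitPt_coe]
    have h1 := Complex.exp_ne_zero (x.1 * Complex.I)
    have h2 := Complex.exp_ne_zero (x.2 * Complex.I)
    field_simp
    rw [Complex.I_sq, neg_one_mul]
  · exact Measure.set_prod_ae_eq Ioc_ae_eq_Icc Ioc_ae_eq_Icc

/-- The integral over the torus `x₁ x₂ x₃ = 1`, `‖xᵢ‖ = 1`, of total mass `(2π)²`. -/
noncomputable def torusMean (G : ℂ → ℂ → ℂ → ℂ) : ℂ :=
  ∫ x : Angle × Angle, G (unitPt x.1) (unitPt x.2) (unitPt (-(x.1 + x.2)))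

/-- Continuity of a function on the torus `x₁ x₂ x₃ = 1`, `‖xᵢ‖ = 1`. -/
def TorusContinuous (G : ℂ → ℂ → ℂ → ℂ) : Prop :=
  Continuous fun x : Angle × Angle => G (unitPt x.1) (unitPt x.2) (unitPt (-(x.1 + x.2)))

section TorusMean

variable {G G' : ℂ → ℂ → ℂ → ℂ}

theorem unitPt_mul_mul_unitPt_neg (s t : Angle) :
    unitPt s * unitPt t * unitPt (-(s + t)) = 1 := by
  rw [unitPt_neg, unitPt_add]
  exact mul_inv_cancel₀ (mul_ne_zero (unitPt_ne_zero s) (unitPt_ne_zero t))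

theorem torusMean_congr (h : ∀ x₁ x₂ x₃, ‖x₁‖ = 1 → ‖x₂‖ = 1 → ‖x₃‖ = 1 → x₁ * x₂ * x₃ = 1 →
    G x₁ x₂ x₃ = G' x₁ x₂ x₃) : torusMean G = torusMean G' :=
  integral_congr_ae (.of_forall fun _ => h _ _ _ (norm_unitPt _) (norm_unitPt _) (norm_unitPt _)
    (unitPt_mul_mul_unitPt_neg _ _))

theorem torusMean_swap₁ : torusMean (fun x₁ x₂ x₃ => G x₂ x₁ x₃) = torusMean G := by
  unfold torusMean
  rw [← integral_comp_addEquiv AddEquiv.prodComm (continuous_swap) (continuous_swap)]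
  simp [add_comm]

/-- The involution `(s, t) ↦ (s, -s - t)` of the torus, which exchanges two of the three
characters of sum zero. -/
noncomputable def angleInvolution : Angle × Angle ≃+ Angle × Angle where
  toFun x := (x.1, -(x.1 + x.2))
  invFun x := (x.1, -(x.1 + x.2))
  left_inv x := by ext <;> simp
  right_inv x := by ext <;> simp
  map_add' x y := by ext <;> simp; abel

theorem integral_comp_angleInvolution (g : Angle × Angle → ℂ) :
    ∫ x : Angle × Angle, g (x.1, -(x.1 + x.2)) = ∫ x, g x :=
  integral_comp_addEquiv angleInvolution
    (by change Continuous fun x : Angle × Angle => (x.1, -(x.1 + x.2)); fun_prop)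
    (by change Continuous fun x : Angle × Angle => (x.1, -(x.1 + x.2)); fun_prop) g

theorem torusMean_swap₂ : torusMean (fun x₁ x₂ x₃ => G x₁ x₃ x₂) = torusMean G := by
  unfold torusMean
  rw [← integral_comp_angleInvolution]
  simp

theorem TorusContinuous.of_differentiableAt (h : ∀ x₁ x₂ x₃, ‖x₁‖ = 1 → ‖x₂‖ = 1 → ‖x₃‖ = 1 →
    DifferentiableAt ℂ (fun v : ℂ × ℂ × ℂ => G v.1 v.2.1 v.2.2) (x₁, x₂, x₃)) :
    TorusContinuous G := by
  refine continuous_iff_continuousAt.2 fun x => ?_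
  have h1 := (h _ _ _ (norm_unitPt x.1) (norm_unitPt x.2)
    (norm_unitPt (-(x.1 + x.2)))).continuousAt
  have hu := continuous_unitPt
  have h2 : Continuous fun x : Angle × Angle =>
      (unitPt x.1, unitPt x.2, unitPt (-(x.1 + x.2))) := by fun_prop
  exact ContinuousAt.comp (f := fun x : Angle × Angle =>
      (unitPt x.1, unitPt x.2, unitPt (-(x.1 + x.2)))) h1 h2.continuousAt

theorem TorusContinuous.integrable (h : TorusContinuous G) :
    Integrable fun x : Angle × Angle =>
      G (unitPt x.1) (unitPt x.2) (unitPt (-(x.1 + x.2))) :=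
  h.integrable_of_hasCompactSupport (HasCompactSupport.of_compactSpace _)

theorem torusMean_add (h : TorusContinuous G) (h' : TorusContinuous G') :
    torusMean (fun x₁ x₂ x₃ => G x₁ x₂ x₃ + G' x₁ x₂ x₃) = torusMean G + torusMean G' :=
  integral_add h.integrable h'.integrable

theorem torusMean_const_mul (c : ℂ) :
    torusMean (fun x₁ x₂ x₃ => c * G x₁ x₂ x₃) = c * torusMean G :=
  integral_const_mul _ _

theorem torusMean_neg : torusMean (fun x₁ x₂ x₃ => -G x₁ x₂ x₃) = -torusMean G :=
  integral_neg _

/-- The unimodular change of variables `x₁ = z₂`, `x₂ = z₁ z₂`, `x₃ = (z₁ z₂²)⁻¹`. -/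
noncomputable def angleShear : Angle × Angle ≃+ Angle × Angle where
  toFun x := (x.2, x.1 + x.2)
  invFun x := (x.2 - x.1, x.1)
  left_inv x := by ext <;> simp
  right_inv x := by ext <;> simp
  map_add' x y := by
    ext
    · simp
    · simp only [Prod.fst_add, Prod.snd_add]; abel

theorem g2Integral_eq_torusMean {p q : ℂ} {a : Fin 5 → ℂ} (hG : TorusContinuous G)
    (h : ∀ z : Fin 2 → ℂ, ‖z 0‖ = 1 → ‖z 1‖ = 1 →
      g2Phi p q a z = G (z 1) (z 0 * z 1) (z 0 * z 1 ^ 2)⁻¹) :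
    g2Integral p q a = 1 / (2 * Real.pi) ^ 2 * torusMean G := by
  have e : ∀ x : Angle × Angle, G (unitPt x.2) (unitPt x.1 * unitPt x.2)
      (unitPt x.1 * unitPt x.2 ^ 2)⁻¹ = G (unitPt (angleShear x).1) (unitPt (angleShear x).2)
        (unitPt (-((angleShear x).1 + (angleShear x).2))) := by
    intro x
    change _ = G (unitPt x.2) (unitPt (x.1 + x.2)) (unitPt (-(x.2 + (x.1 + x.2))))
    rw [unitPt_neg, unitPt_add, unitPt_add, unitPt_add]
    congr 2
    ring
  have hs : Continuous angleShear := by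
    change Continuous fun x : Angle × Angle => (x.2, x.1 + x.2)
    fun_prop
  have hs' : Continuous angleShear.symm := by
    change Continuous fun x : Angle × Angle => (x.2 - x.1, x.1)
    fun_prop
  have hc : Continuous fun x : Angle × Angle =>
      g2Phi p q a ![unitPt x.1, unitPt x.2] := by
    have := hG.comp hs
    refine this.congr fun x => ?_
    rw [h _ (norm_unitPt _) (norm_unitPt _)]
    exact (e x).symm
  have h1 := torusIntegral_eq_integral_angle (G := fun x y => g2Phi p q a ![x, y]) hc
  have h2 : ∀ z : Fin 2 → ℂ, g2Phi p q a ![z 0, z 1] = g2Phi p q a z := by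
    intro z
    congr 1
    ext i
    fin_cases i <;> rfl
  simp only [h2] at h1
  have h3 : ∫ x : Angle × Angle, g2Phi p q a ![unitPt x.1, unitPt x.2] = torusMean G := by
    unfold torusMean
    rw [← integral_comp_addEquiv angleShear hs hs'
      (fun x => G (unitPt x.1) (unitPt x.2) (unitPt (-(x.1 + x.2))))]
    refine integral_congr_ae (.of_forall fun x => ?_)
    simp only
    rw [h _ (norm_unitPt _) (norm_unitPt _)]
    exact e x
  rw [g2Integral, h1, h3, mul_pow _ Complex.I, Complex.I_sq]
  ring

/-- If `G` is holomorphic in `x₁` on the annulus `‖q‖ ≤ ‖x₁‖ ≤ 1` with `x₃` and `x₁ x₂` fixed, and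
if its `q`-shift is opposite to its image under the exchange of `x₁` and `x₂`, then its integral
over the torus vanishes: shifting the contour shows that the integral is its own opposite. -/
theorem torusMean_eq_zero_of_shift {q : ℂ} (hq0 : q ≠ 0) (hq : ‖q‖ < 1) (hG : TorusContinuous G)
    (hd : ∀ c d z, ‖c‖ = 1 → ‖d‖ = 1 → ‖q‖ ≤ ‖z‖ → ‖z‖ ≤ 1 →
      DifferentiableAt ℂ (fun z => G z (c / z) d) z)
    (hshift : ∀ x₁ x₂ x₃, x₁ ≠ 0 → x₂ ≠ 0 → x₃ ≠ 0 → G (q * x₁) x₂ x₃ = -G (q * x₂) x₁ x₃) :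
    torusMean G = 0 := by
  have key : ∀ u : Angle,
      ∫ s : Angle, G (unitPt s) (unitPt (-(s + u))) (unitPt u) = 0 := by
    intro u
    have e : ∀ s : Angle, unitPt (-(s + u)) = unitPt (-u) / unitPt s := by
      intro s
      rw [neg_add, add_comm, unitPt_add, unitPt_neg s, div_eq_mul_inv]
    have h1 := integral_unitPt_eq_integral_mul hq0 hq
      (h := fun z => G z (unitPt (-u) / z) (unitPt u))
      (fun z h1 h2 => hd _ _ z (norm_unitPt _) (norm_unitPt _) h1 h2)
    have h2 : ∀ s : Angle, G (q * unitPt s) (unitPt (-u) / (q * unitPt s)) (unitPt u) =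
        -G (unitPt (-u - s)) (unitPt (-(-u - s + u))) (unitPt u) := by
      intro s
      have ns := unitPt_ne_zero s
      have nu := unitPt_ne_zero (-u)
      rw [hshift _ _ _ ns (div_ne_zero nu (mul_ne_zero hq0 ns)) (unitPt_ne_zero u)]
      congr 2
      · rw [sub_eq_add_neg, unitPt_add, unitPt_neg s]
        field_simp
      · congr 1
        abel
    simp only [← e, h2] at h1
    rw [integral_neg, integral_sub_left_eq_self
      (fun s => G (unitPt s) (unitPt (-(s + u))) (unitPt u))] at h1
    exact self_eq_neg.1 h1
  have hint := hG.integrable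
  unfold torusMean
  have hc : Continuous fun x : Angle × Angle => (x.1, -(x.1 + x.2)) := by fun_prop
  have hi2 : Integrable fun x : Angle × Angle =>
      G (unitPt x.1) (unitPt (-(x.1 + x.2))) (unitPt x.2) := by
    have h3 : Continuous fun x : Angle × Angle =>
      G (unitPt x.1) (unitPt (-(x.1 + x.2))) (unitPt x.2) := by
      refine (hG.comp hc).congr fun x => ?_
      simp
    exact h3.integrable_of_hasCompactSupport (HasCompactSupport.of_compactSpace _)
  rw [← integral_comp_angleInvolution
    (fun x => G (unitPt x.1) (unitPt x.2) (unitPt (-(x.1 + x.2))))]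
  have e : ∀ x : Angle × Angle, -(x.1 + -(x.1 + x.2)) = x.2 := by
    intro x
    abel
  simp only [e]
  rw [Measure.volume_eq_prod] at hi2 ⊢
  rw [integral_prod_symm _ hi2]
  simp only [key, integral_zero]

end TorusMean

/-! ### The vanishing integral and the three term relation -/

/-- The modification of `orbitGamma p q a x₁ x₂ x₃` in which two of the six arguments are multiplied
by `q`. Its shift by `x₁ → q x₁` is symmetric in `x₁` and `x₂`, and has no pole between the two
contours. -/
noncomputable def shiftGamma (p q a x₁ x₂ x₃ : ℂ) : ℂ :=
  ellGamma (a * x₁) p q * ellGamma (q * (a / x₁)) p q *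
    (ellGamma (q * (a * x₂)) p q * ellGamma (a / x₂) p q) * pairGamma p q a x₃

/-- The product of the elliptic gamma functions of the integrand over the five parameters. -/
noncomputable def gammaProd (p q w l b₁ b₂ b₃ x₁ x₂ x₃ : ℂ) : ℂ :=
  orbitGamma p q w x₁ x₂ x₃ * orbitGamma p q l x₁ x₂ x₃ * orbitGamma p q b₁ x₁ x₂ x₃ *
    orbitGamma p q b₂ x₁ x₂ x₃ * orbitGamma p q b₃ x₁ x₂ x₃

/-- The product of `numTheta` and of the gamma factors of the integrand, in a form that is
holomorphic between the torus and its shift by `x₁ → q x₁`, `x₂ → q⁻¹ x₂`. -/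
noncomputable def shiftIntegrand (p q r w l b₁ b₂ b₃ x₁ x₂ x₃ : ℂ) : ℂ :=
  (shiftGamma p q w x₁ x₂ x₃ * shiftGamma p q l x₁ x₂ x₃ * shiftGamma p q b₁ x₁ x₂ x₃ *
    shiftGamma p q b₂ x₁ x₂ x₃ * shiftGamma p q b₃ x₁ x₂ x₃) * weylTheta q x₁ x₂ x₃ *
  (x₁ ^ 3 / x₂ ^ 2 * ellTheta x₃ p * (pairTheta p w x₃ * pairTheta p l x₃) *
    evenTheta p r (w * l * b₁ * b₂ * b₃) w l (w * l * b₁ * b₂ * b₃ * x₁)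
      (x₂ / (w * l * b₁ * b₂ * b₃)) x₃)

section Smooth

variable {E : Type*} [NormedAddCommGroup E] [NormedSpace ℂ E] {p q a : ℂ} {z : E}
  {f₁ f₂ f₃ : E → ℂ}

theorem DifferentiableAt.pairGamma (hp : ‖p‖ < 1) (hq : ‖q‖ < 1) (ha : a ≠ 0) (ha1 : ‖a‖ < 1)
    (hf₁ : DifferentiableAt ℂ f₁ z) (h₁ : ‖f₁ z‖ = 1) :
    DifferentiableAt ℂ (fun z => pairGamma p q a (f₁ z)) z := by
  have n1 : f₁ z ≠ 0 := by intro h; simp [h] at h₁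
  have m1 : ‖a * f₁ z‖ < 1 := by rwa [norm_mul, h₁, mul_one]
  have m2 : ‖a / f₁ z‖ < 1 := by rwa [norm_div, h₁, div_one]
  unfold _root_.pairGamma
  fun_prop (disch := first | assumption | positivity)

theorem DifferentiableAt.shiftGamma (hq0 : q ≠ 0) (hp : ‖p‖ < 1) (hq : ‖q‖ < 1) (ha : a ≠ 0)
    (ha1 : ‖a‖ < 1)
    (hf₁ : DifferentiableAt ℂ f₁ z) (hf₂ : DifferentiableAt ℂ f₂ z) (hf₃ : DifferentiableAt ℂ f₃ z)
    (h₁ : ‖f₁ z‖ ≤ 1) (h₁' : ‖q‖ ≤ ‖f₁ z‖) (h₂ : 1 ≤ ‖f₂ z‖) (h₂' : ‖q‖ * ‖f₂ z‖ ≤ 1)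
    (h₃ : ‖f₃ z‖ = 1) :
    DifferentiableAt ℂ (fun z => shiftGamma p q a (f₁ z) (f₂ z) (f₃ z)) z := by
  have n1 : f₁ z ≠ 0 := norm_pos_iff.1 ((norm_pos_iff.2 hq0).trans_le h₁')
  have n2 : f₂ z ≠ 0 := norm_pos_iff.1 (zero_lt_one.trans_le h₂)
  have m1 : ‖a * f₁ z‖ < 1 := by
    rw [norm_mul]
    exact (mul_le_of_le_one_right (norm_nonneg _) h₁).trans_lt ha1
  have m2 : ‖q * (a / f₁ z)‖ < 1 := by
    rw [mul_div_left_comm, norm_mul, norm_div]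
    exact (mul_le_of_le_one_right (norm_nonneg _) (div_le_one_of_le₀ h₁' (norm_nonneg _))).trans_lt
      ha1
  have m3 : ‖q * (a * f₂ z)‖ < 1 := by
    rw [mul_left_comm, norm_mul, norm_mul]
    exact (mul_le_of_le_one_right (norm_nonneg _) h₂').trans_lt ha1
  have m4 : ‖a / f₂ z‖ < 1 := by
    rw [norm_div]
    exact (div_le_self (norm_nonneg _) h₂).trans_lt ha1
  have h := DifferentiableAt.pairGamma hp hq ha ha1 hf₃ h₃
  unfold _root_.shiftGamma
  fun_prop (disch := first | assumption | positivity)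

variable {r w l b₁ b₂ b₃ : ℂ}

theorem DifferentiableAt.shiftIntegrand (hq0 : q ≠ 0) (hp : ‖p‖ < 1) (hq : ‖q‖ < 1) (hr : r ≠ 0)
    (hw : w ≠ 0) (hl : l ≠ 0) (hb₁ : b₁ ≠ 0) (hb₂ : b₂ ≠ 0) (hb₃ : b₃ ≠ 0)
    (hw1 : ‖w‖ < 1) (hl1 : ‖l‖ < 1) (hb₁1 : ‖b₁‖ < 1) (hb₂1 : ‖b₂‖ < 1) (hb₃1 : ‖b₃‖ < 1)
    (hf₁ : DifferentiableAt ℂ f₁ z) (hf₂ : DifferentiableAt ℂ f₂ z) (hf₃ : DifferentiableAt ℂ f₃ z)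
    (h₁ : ‖f₁ z‖ ≤ 1) (h₁' : ‖q‖ ≤ ‖f₁ z‖) (h₂ : 1 ≤ ‖f₂ z‖) (h₂' : ‖q‖ * ‖f₂ z‖ ≤ 1)
    (h₃ : ‖f₃ z‖ = 1) :
    DifferentiableAt ℂ
      (fun z => shiftIntegrand p q r w l b₁ b₂ b₃ (f₁ z) (f₂ z) (f₃ z)) z := by
  have n1 : f₁ z ≠ 0 := norm_pos_iff.1 ((norm_pos_iff.2 hq0).trans_le h₁')
  have n2 : f₂ z ≠ 0 := norm_pos_iff.1 (zero_lt_one.trans_le h₂)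
  have n3 : f₃ z ≠ 0 := norm_pos_iff.1 (zero_lt_one.trans_eq h₃.symm)
  have g1 := DifferentiableAt.shiftGamma hq0 hp hq hw hw1 hf₁ hf₂ hf₃ h₁ h₁' h₂ h₂' h₃
  have g2 := DifferentiableAt.shiftGamma hq0 hp hq hl hl1 hf₁ hf₂ hf₃ h₁ h₁' h₂ h₂' h₃
  have g3 := DifferentiableAt.shiftGamma hq0 hp hq hb₁ hb₁1 hf₁ hf₂ hf₃ h₁ h₁' h₂ h₂' h₃
  have g4 := DifferentiableAt.shiftGamma hq0 hp hq hb₂ hb₂1 hf₁ hf₂ hf₃ h₁ h₁' h₂ h₂' h₃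
  have g5 := DifferentiableAt.shiftGamma hq0 hp hq hb₃ hb₃1 hf₁ hf₂ hf₃ h₁ h₁' h₂ h₂' h₃
  unfold _root_.shiftIntegrand
  fun_prop (disch := first | assumption | positivity)

theorem DifferentiableAt.gammaProd (hp : ‖p‖ < 1) (hq : ‖q‖ < 1)
    (hw : w ≠ 0) (hl : l ≠ 0) (hb₁ : b₁ ≠ 0) (hb₂ : b₂ ≠ 0) (hb₃ : b₃ ≠ 0)
    (hw1 : ‖w‖ < 1) (hl1 : ‖l‖ < 1) (hb₁1 : ‖b₁‖ < 1) (hb₂1 : ‖b₂‖ < 1) (hb₃1 : ‖b₃‖ < 1)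
    (hf₁ : DifferentiableAt ℂ f₁ z) (hf₂ : DifferentiableAt ℂ f₂ z) (hf₃ : DifferentiableAt ℂ f₃ z)
    (h₁ : ‖f₁ z‖ = 1) (h₂ : ‖f₂ z‖ = 1) (h₃ : ‖f₃ z‖ = 1) :
    DifferentiableAt ℂ (fun z => gammaProd p q w l b₁ b₂ b₃ (f₁ z) (f₂ z) (f₃ z)) z := by
  have key : ∀ {a : ℂ}, a ≠ 0 → ‖a‖ < 1 →
      DifferentiableAt ℂ (fun z => orbitGamma p q a (f₁ z) (f₂ z) (f₃ z)) z := fun ha ha1 =>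
    ((DifferentiableAt.pairGamma hp hq ha ha1 hf₁ h₁).mul
      (DifferentiableAt.pairGamma hp hq ha ha1 hf₂ h₂)).mul
      (DifferentiableAt.pairGamma hp hq ha ha1 hf₃ h₃)
  exact ((((key hw hw1).mul (key hl hl1)).mul (key hb₁ hb₁1)).mul (key hb₂ hb₂1)).mul (key hb₃ hb₃1)

end Smooth

section Relation

variable {p q r w l b₁ b₂ b₃ x₁ x₂ x₃ : ℂ}

theorem shiftGamma_eq (hq0 : q ≠ 0) (hp : ‖p‖ < 1) (hq : ‖q‖ < 1) {a : ℂ} (ha : a ≠ 0)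
    (ha1 : ‖a‖ < 1) (h₁ : ‖x₁‖ = 1) (h₂ : ‖x₂‖ = 1) :
    shiftGamma p q a x₁ x₂ x₃ =
      ellTheta (a * x₁⁻¹) p * ellTheta (a * x₂) p * orbitGamma p q a x₁ x₂ x₃ := by
  have n1 : x₁ ≠ 0 := by intro h; simp [h] at h₁
  have n2 : x₂ ≠ 0 := by intro h; simp [h] at h₂
  unfold shiftGamma orbitGamma pairGamma
  rw [ellGamma_mul hq0 hp hq (div_ne_zero ha n1) (by rwa [norm_div, h₁, div_one]),
    ellGamma_mul hq0 hp hq (mul_ne_zero ha n2) (by rwa [norm_mul, h₂, mul_one]), ← div_eq_mul_inv]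
  ring

theorem orbitGamma_mul (hq0 : q ≠ 0) (hp : ‖p‖ < 1) (hq : ‖q‖ < 1) {a : ℂ} (ha : a ≠ 0)
    (ha1 : ‖a‖ < 1) (h₁ : ‖x₁‖ = 1) (h₂ : ‖x₂‖ = 1) (h₃ : ‖x₃‖ = 1) :
    orbitGamma p q (q * a) x₁ x₂ x₃ = orbitTheta p a x₁ x₂ x₃ * orbitGamma p q a x₁ x₂ x₃ := by
  have key : ∀ {x : ℂ}, ‖x‖ = 1 →
      pairGamma p q (q * a) x = pairTheta p a x * pairGamma p q a x := by
    intro x hx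
    have n : x ≠ 0 := by intro h; simp [h] at hx
    unfold pairGamma pairTheta
    rw [mul_assoc, mul_div_assoc,
      ellGamma_mul hq0 hp hq (mul_ne_zero ha n) (by rwa [norm_mul, hx, mul_one]),
      ellGamma_mul hq0 hp hq (div_ne_zero ha n) (by rwa [norm_div, hx, div_one])]
    ring
  unfold orbitGamma orbitTheta
  rw [key h₁, key h₂, key h₃]
  ring

theorem shiftIntegrand_eq (hq0 : q ≠ 0) (hp : ‖p‖ < 1) (hq : ‖q‖ < 1)
    (hw : w ≠ 0) (hl : l ≠ 0) (hb₁ : b₁ ≠ 0) (hb₂ : b₂ ≠ 0) (hb₃ : b₃ ≠ 0)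
    (hw1 : ‖w‖ < 1) (hl1 : ‖l‖ < 1) (hb₁1 : ‖b₁‖ < 1) (hb₂1 : ‖b₂‖ < 1) (hb₃1 : ‖b₃‖ < 1)
    (h₁ : ‖x₁‖ = 1) (h₂ : ‖x₂‖ = 1) :
    shiftIntegrand p q r w l b₁ b₂ b₃ x₁ x₂ x₃ =
      gammaProd p q w l b₁ b₂ b₃ x₁ x₂ x₃ * weylTheta q x₁ x₂ x₃ *
        numTheta p r w l b₁ b₂ b₃ x₁ x₂ x₃ := by
  unfold shiftIntegrand gammaProd numTheta prodTheta
  rw [shiftGamma_eq hq0 hp hq hw hw1 h₁ h₂, shiftGamma_eq hq0 hp hq hl hl1 h₁ h₂,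
    shiftGamma_eq hq0 hp hq hb₁ hb₁1 h₁ h₂, shiftGamma_eq hq0 hp hq hb₂ hb₂1 h₁ h₂,
    shiftGamma_eq hq0 hp hq hb₃ hb₃1 h₁ h₂]
  ring

theorem shiftGamma_shift (hq0 : q ≠ 0) {a : ℂ} :
    shiftGamma p q a (q * x₁) x₂ x₃ = shiftGamma p q a (q * x₂) x₁ x₃ := by
  unfold shiftGamma
  rw [show q * (a / (q * x₁)) = a / x₁ by field_simp,
    show q * (a / (q * x₂)) = a / x₂ by field_simp, mul_left_comm a q x₁, mul_left_comm a q x₂]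
  ring

/-- The balancing condition makes the shift of `shiftIntegrand` antisymmetric in `x₁, x₂`. -/
theorem shiftIntegrand_shift (hp0 : p ≠ 0) (hp : ‖p‖ < 1) (hq0 : q ≠ 0) (hq : ‖q‖ < 1)
    (hr : r ≠ 0) (hbal : (w * l * b₁ * b₂ * b₃) ^ 2 * q = p)
    (hx₁ : x₁ ≠ 0) (hx₂ : x₂ ≠ 0) (hx₃ : x₃ ≠ 0) :
    shiftIntegrand p q r w l b₁ b₂ b₃ (q * x₁) x₂ x₃ =
      -shiftIntegrand p q r w l b₁ b₂ b₃ (q * x₂) x₁ x₃ := by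
  unfold shiftIntegrand
  set A := w * l * b₁ * b₂ * b₃ with hA
  have hA0 : A ≠ 0 := by
    intro h
    simp only [h, ne_eq, OfNat.ofNat_ne_zero, not_false_eq_true, zero_pow, zero_mul] at hbal
    exact hp0 hbal.symm
  have e1 : ∀ x, A * (q * x) = p * (x / A) := by
    intro x
    rw [← hbal]
    field_simp
  rw [shiftGamma_shift (a := w) hq0, shiftGamma_shift (a := l) hq0, shiftGamma_shift (a := b₁) hq0,
    shiftGamma_shift (a := b₂) hq0, shiftGamma_shift (a := b₃) hq0, e1, e1,
    evenTheta_mul hp0 hp hr (by positivity) (by positivity), evenTheta_swap₁ (y₁ := x₁ / A),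
    weylTheta_shift hq0 hq hx₁ hx₂ hx₃, weylTheta_swap₁ (x₁ := q * x₂) (x₂ := x₁) hq
      (by positivity) hx₁]
  field_simp

end Relation

section Antisymmetrization

variable {G : ℂ → ℂ → ℂ → ℂ}

theorem TorusContinuous.swap₁ (h : TorusContinuous G) :
    TorusContinuous fun x₁ x₂ x₃ => G x₂ x₁ x₃ :=
  (Continuous.comp h continuous_swap).congr fun x => by
    simp only [Function.comp_apply, Prod.fst_swap, Prod.snd_swap, add_comm]

theorem TorusContinuous.swap₂ (h : TorusContinuous G) :
    TorusContinuous fun x₁ x₂ x₃ => G x₁ x₃ x₂ := by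
  have hc : Continuous fun x : Angle × Angle => (x.1, -(x.1 + x.2)) := by fun_prop
  exact (Continuous.comp h hc).congr fun x => by simp

/-- If `W` is antisymmetric and `W N` integrates to zero, then so does the product of `W` and of
the antisymmetrization of `N`. -/
theorem torusMean_mul_antisymmetrization {W N : ℂ → ℂ → ℂ → ℂ}
    (hW₁ : ∀ x₁ x₂ x₃, x₁ ≠ 0 → x₂ ≠ 0 → x₃ ≠ 0 → W x₂ x₁ x₃ = -W x₁ x₂ x₃)
    (hW₂ : ∀ x₁ x₂ x₃, x₁ ≠ 0 → x₂ ≠ 0 → x₃ ≠ 0 → W x₁ x₃ x₂ = -W x₁ x₂ x₃)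
    (hc : TorusContinuous fun x₁ x₂ x₃ => W x₁ x₂ x₃ * N x₁ x₂ x₃)
    (h0 : torusMean (fun x₁ x₂ x₃ => W x₁ x₂ x₃ * N x₁ x₂ x₃) = 0) :
    torusMean (fun x₁ x₂ x₃ => W x₁ x₂ x₃ * (N x₁ x₂ x₃ - N x₂ x₁ x₃ - N x₁ x₃ x₂ - N x₃ x₂ x₁ +
      N x₂ x₃ x₁ + N x₃ x₁ x₂)) = 0 := by
  set F := fun x₁ x₂ x₃ => W x₁ x₂ x₃ * N x₁ x₂ x₃ with hF
  have c2 := hc.swap₁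
  have c3 := hc.swap₂
  have c4 := c2.swap₂
  have c5 := c3.swap₁
  have c6 := c4.swap₁
  have t2 := torusMean_swap₁ (G := F)
  have t3 := torusMean_swap₂ (G := F)
  have t4 := torusMean_swap₂ (G := fun x₁ x₂ x₃ => F x₂ x₁ x₃)
  have t5 := torusMean_swap₁ (G := fun x₁ x₂ x₃ => F x₁ x₃ x₂)
  have t6 := torusMean_swap₁ (G := fun x₁ x₂ x₃ => F x₃ x₁ x₂)
  have s : torusMean (fun x₁ x₂ x₃ => W x₁ x₂ x₃ * (N x₁ x₂ x₃ - N x₂ x₁ x₃ - N x₁ x₃ x₂ -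
      N x₃ x₂ x₁ + N x₂ x₃ x₁ + N x₃ x₁ x₂)) =
      torusMean (fun x₁ x₂ x₃ => F x₁ x₂ x₃ + F x₂ x₁ x₃ + (F x₁ x₃ x₂ + F x₃ x₁ x₂) +
        (F x₂ x₃ x₁ + F x₃ x₂ x₁)) := by
    refine torusMean_congr fun x₁ x₂ x₃ h₁ h₂ h₃ _ => ?_
    have n : ∀ {x : ℂ}, ‖x‖ = 1 → x ≠ 0 := fun h h' => by simp [h'] at h
    have n1 := n h₁
    have n2 := n h₂
    have n3 := n h₃
    simp only [hF]
    rw [hW₁ x₁ x₃ x₂ n1 n3 n2, hW₁ x₂ x₃ x₁ n2 n3 n1, hW₂ x₂ x₁ x₃ n2 n1 n3, hW₁ x₁ x₂ x₃ n1 n2 n3,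
      hW₂ x₁ x₂ x₃ n1 n2 n3]
    ring
  have d (G G' : ℂ → ℂ → ℂ → ℂ) (h : TorusContinuous G) (h' : TorusContinuous G') :
      TorusContinuous fun x₁ x₂ x₃ => G x₁ x₂ x₃ + G' x₁ x₂ x₃ := Continuous.add h h'
  have s1 := d _ _ hc c2
  have s2 := d _ _ c3 c4
  rw [s, torusMean_add (d _ _ s1 s2) (d _ _ c5 c6), torusMean_add s1 s2, torusMean_add hc c2,
    torusMean_add c3 c4, torusMean_add c5 c6, t6, t5, t4, t3, t2, h0]
  simp

end Antisymmetrization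

/-- The integral, with the first two parameters singled out, as an integral over the torus
`x₁ x₂ x₃ = 1`. -/
noncomputable def torusGamma (p q w l b₁ b₂ b₃ : ℂ) : ℂ :=
  torusMean fun x₁ x₂ x₃ => gammaProd p q w l b₁ b₂ b₃ x₁ x₂ x₃ *
    (weylTheta p x₁ x₂ x₃ * weylTheta q x₁ x₂ x₃)

section Relation

variable {p q r w l b₁ b₂ b₃ : ℂ}

theorem torusContinuous_gammaProd (hp : ‖p‖ < 1) (hq : ‖q‖ < 1)
    (hw : w ≠ 0) (hl : l ≠ 0) (hb₁ : b₁ ≠ 0) (hb₂ : b₂ ≠ 0) (hb₃ : b₃ ≠ 0)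
    (hw1 : ‖w‖ < 1) (hl1 : ‖l‖ < 1) (hb₁1 : ‖b₁‖ < 1) (hb₂1 : ‖b₂‖ < 1) (hb₃1 : ‖b₃‖ < 1) :
    TorusContinuous fun x₁ x₂ x₃ => gammaProd p q w l b₁ b₂ b₃ x₁ x₂ x₃ *
      (weylTheta p x₁ x₂ x₃ * weylTheta q x₁ x₂ x₃) := by
  refine TorusContinuous.of_differentiableAt fun x₁ x₂ x₃ h₁ h₂ h₃ => ?_
  have n : ∀ {x : ℂ}, ‖x‖ = 1 → x ≠ 0 := fun h h' => by simp [h'] at h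
  have n1 := n h₁
  have n2 := n h₂
  have n3 := n h₃
  have hg := DifferentiableAt.gammaProd (f₁ := fun v : ℂ × ℂ × ℂ => v.1) (f₂ := fun v => v.2.1)
    (f₃ := fun v => v.2.2) (z := (x₁, x₂, x₃)) hp hq hw hl hb₁ hb₂ hb₃ hw1 hl1 hb₁1 hb₂1 hb₃1
    (by fun_prop) (by fun_prop) (by fun_prop) h₁ h₂ h₃
  fun_prop (disch := first | assumption | positivity)

theorem torusMean_shiftIntegrand (hp0 : p ≠ 0) (hp : ‖p‖ < 1) (hq0 : q ≠ 0) (hq : ‖q‖ < 1)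
    (hr : r ≠ 0) (hbal : (w * l * b₁ * b₂ * b₃) ^ 2 * q = p)
    (hw : w ≠ 0) (hl : l ≠ 0) (hb₁ : b₁ ≠ 0) (hb₂ : b₂ ≠ 0) (hb₃ : b₃ ≠ 0)
    (hw1 : ‖w‖ < 1) (hl1 : ‖l‖ < 1) (hb₁1 : ‖b₁‖ < 1) (hb₂1 : ‖b₂‖ < 1) (hb₃1 : ‖b₃‖ < 1) :
    TorusContinuous (shiftIntegrand p q r w l b₁ b₂ b₃) ∧
      torusMean (shiftIntegrand p q r w l b₁ b₂ b₃) = 0 := by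
  have hc : TorusContinuous (shiftIntegrand p q r w l b₁ b₂ b₃) :=
    TorusContinuous.of_differentiableAt fun x₁ x₂ x₃ h₁ h₂ h₃ =>
      DifferentiableAt.shiftIntegrand hq0 hp hq hr hw hl hb₁ hb₂ hb₃ hw1 hl1 hb₁1 hb₂1 hb₃1
        (by fun_prop) (by fun_prop) (by fun_prop) h₁.le (by simpa [h₁] using hq.le) h₂.ge
        (by simpa [h₂] using hq.le) h₃
  refine ⟨hc, torusMean_eq_zero_of_shift hq0 hq hc (fun c d z hc1 hd1 hz hz' => ?_)
    fun x₁ x₂ x₃ => shiftIntegrand_shift hp0 hp hq0 hq hr hbal⟩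
  have hz0 : 0 < ‖z‖ := (norm_pos_iff.2 hq0).trans_le hz
  have n : z ≠ 0 := norm_pos_iff.1 hz0
  have e : ‖c / z‖ = ‖z‖⁻¹ := by rw [norm_div, hc1, one_div]
  refine DifferentiableAt.shiftIntegrand hq0 hp hq hr hw hl hb₁ hb₂ hb₃ hw1 hl1 hb₁1 hb₂1 hb₃1
    (by fun_prop) (by fun_prop (disch := assumption)) (by fun_prop) hz' hz ?_ ?_ hd1
  · rw [e]
    exact (one_le_inv₀ hz0).2 hz'
  · rw [e, ← div_eq_mul_inv]
    exact div_le_one_of_le₀ hz hz0.le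

theorem torusMean_altTheta (hp0 : p ≠ 0) (hp : ‖p‖ < 1) (hq0 : q ≠ 0) (hq : ‖q‖ < 1)
    (hr : r ≠ 0) (hbal : (w * l * b₁ * b₂ * b₃) ^ 2 * q = p)
    (hw : w ≠ 0) (hl : l ≠ 0) (hb₁ : b₁ ≠ 0) (hb₂ : b₂ ≠ 0) (hb₃ : b₃ ≠ 0)
    (hw1 : ‖w‖ < 1) (hl1 : ‖l‖ < 1) (hb₁1 : ‖b₁‖ < 1) (hb₂1 : ‖b₂‖ < 1) (hb₃1 : ‖b₃‖ < 1) :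
    torusMean (fun x₁ x₂ x₃ => gammaProd p q w l b₁ b₂ b₃ x₁ x₂ x₃ * weylTheta q x₁ x₂ x₃ *
      altTheta p r w l b₁ b₂ b₃ x₁ x₂ x₃) = 0 := by
  obtain ⟨hc, h0⟩ := torusMean_shiftIntegrand hp0 hp hq0 hq hr hbal hw hl hb₁ hb₂ hb₃ hw1 hl1 hb₁1
    hb₂1 hb₃1
  have e : ∀ x₁ x₂ x₃, ‖x₁‖ = 1 → ‖x₂‖ = 1 → ‖x₃‖ = 1 → x₁ * x₂ * x₃ = 1 →
      shiftIntegrand p q r w l b₁ b₂ b₃ x₁ x₂ x₃ =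
      gammaProd p q w l b₁ b₂ b₃ x₁ x₂ x₃ * weylTheta q x₁ x₂ x₃ *
        numTheta p r w l b₁ b₂ b₃ x₁ x₂ x₃ := fun x₁ x₂ x₃ h₁ h₂ _ _ =>
    shiftIntegrand_eq hq0 hp hq hw hl hb₁ hb₂ hb₃ hw1 hl1 hb₁1 hb₂1 hb₃1 h₁ h₂
  unfold altTheta
  refine torusMean_mul_antisymmetrization
    (W := fun x₁ x₂ x₃ => gammaProd p q w l b₁ b₂ b₃ x₁ x₂ x₃ * weylTheta q x₁ x₂ x₃) ?_ ?_ ?_ ?_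
  · intro x₁ x₂ x₃ n1 n2 n3
    simp only [weylTheta_swap₁ hq n1 n2]
    unfold gammaProd orbitGamma
    ring
  · intro x₁ x₂ x₃ n1 n2 n3
    simp only [weylTheta_swap₂ hq n2 n3]
    unfold gammaProd orbitGamma
    ring
  · exact Continuous.congr hc fun x => e _ _ _ (norm_unitPt _) (norm_unitPt _) (norm_unitPt _)
      (unitPt_mul_mul_unitPt_neg _ _)
  · rw [← h0]
    exact (torusMean_congr e).symm

/-- The contiguity relation between the integrals with parameters `(w, q l)` and `(q w, l)`. -/
theorem contiguity (hp0 : p ≠ 0) (hp : ‖p‖ < 1) (hq0 : q ≠ 0) (hq : ‖q‖ < 1)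
    (hr : r ^ 2 = p) (hbal : (w * l * b₁ * b₂ * b₃) ^ 2 * q = p)
    (hw : ‖p‖ < ‖w‖ ^ 2) (hw1 : ‖w‖ < 1) (hl : ‖p‖ < ‖l‖ ^ 2) (hl1 : ‖l‖ < 1) (hwl : w ≠ l)
    (hb₁ : b₁ ≠ 0) (hb₂ : b₂ ≠ 0) (hb₃ : b₃ ≠ 0)
    (hb₁1 : ‖b₁‖ < 1) (hb₂1 : ‖b₂‖ < 1) (hb₃1 : ‖b₃‖ < 1)
    (hθw : ellTheta w p ≠ 0) (hθl : ellTheta l p ≠ 0)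
    (hlw : pairTheta p l w ≠ 0) (hwl' : pairTheta p w l ≠ 0) :
    contiguityCoeff p r w l b₁ b₂ b₃ * torusGamma p q w (q * l) b₁ b₂ b₃ +
      contiguityCoeff p r l w b₁ b₂ b₃ * torusGamma p q (q * w) l b₁ b₂ b₃ = 0 := by
  have hw0 : w ≠ 0 := by
    rintro rfl
    simp only [norm_zero, ne_eq, OfNat.ofNat_ne_zero, not_false_eq_true, zero_pow] at hw
    exact absurd hw (norm_nonneg p).not_gt
  have hl0 : l ≠ 0 := by
    rintro rfl
    simp only [norm_zero, ne_eq, OfNat.ofNat_ne_zero, not_false_eq_true, zero_pow] at hl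
    exact absurd hl (norm_nonneg p).not_gt
  have hr0 : r ≠ 0 := by
    rintro rfl
    simp at hr
    exact hp0 hr.symm
  have lt {a : ℂ} (h : ‖a‖ < 1) : ‖q * a‖ < 1 := by
    rw [norm_mul]
    exact (mul_le_of_le_one_left (norm_nonneg _) hq.le).trans_lt h
  have h0 := torusMean_altTheta hp0 hp hq0 hq hr0 hbal hw0 hl0 hb₁ hb₂ hb₃ hw1 hl1 hb₁1 hb₂1 hb₃1
  have c1 := torusContinuous_gammaProd hp hq hw0 (mul_ne_zero hq0 hl0) hb₁ hb₂ hb₃ hw1 (lt hl1)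
    hb₁1 hb₂1 hb₃1
  have c2 := torusContinuous_gammaProd hp hq (mul_ne_zero hq0 hw0) hl0 hb₁ hb₂ hb₃ (lt hw1) hl1
    hb₁1 hb₂1 hb₃1
  have c3 (c : ℂ) (G : ℂ → ℂ → ℂ → ℂ) (h : TorusContinuous G) :
      TorusContinuous fun x₁ x₂ x₃ => c * G x₁ x₂ x₃ := Continuous.mul continuous_const h
  unfold torusGamma
  rw [← torusMean_const_mul, ← torusMean_const_mul, ← torusMean_add (c3 _ _ c1) (c3 _ _ c2),
    ← neg_eq_zero, ← torusMean_neg, ← h0]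
  refine torusMean_congr fun x₁ x₂ x₃ h₁ h₂ h₃ hx => ?_
  rw [altTheta_eq hp0 hp hr hw hw1 hl hl1 hwl hb₁ hb₂ hb₃ hθw hθl hlw hwl' hx]
  unfold gammaProd
  rw [orbitGamma_mul hq0 hp hq hl0 hl1 h₁ h₂ h₃, orbitGamma_mul hq0 hp hq hw0 hw1 h₁ h₂ h₃]
  ring

end Relation

/-! ### The contiguity relation in terms of the parameters -/

section Coefficients

variable {p q r w l b₁ b₂ b₃ : ℂ}

theorem norm_mul_lt_one {x y : ℂ} (hx : ‖x‖ < 1) (hy : ‖y‖ < 1) : ‖x * y‖ < 1 := by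
  rw [norm_mul]
  exact (mul_le_of_le_one_left (norm_nonneg _) hx.le).trans_lt hy

/-- The duplication formula evaluates the theta functions of `contiguityCoeff` that involve the
half periods. -/
theorem halfPeriodTheta_mul (hp0 : p ≠ 0) (hp : ‖p‖ < 1) (hr : r ^ 2 = p) {A : ℂ}
    (hA : A ^ 2 * q = p) (hw : w ≠ 0) :
    halfPeriodTheta p r (w / A) * ellTheta (A / w) p =
      q * A * w / p * ellTheta (q * w ^ 2) p := by
  have hA0 : A ≠ 0 := by
    rintro rfl
    simp only [ne_eq, OfNat.ofNat_ne_zero, not_false_eq_true, zero_pow, zero_mul] at hA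
    exact hp0 hA.symm
  have hq0 : q ≠ 0 := by
    rintro rfl
    rw [mul_zero] at hA
    exact hp0 hA.symm
  have hr0 : r ≠ 0 := by
    rintro rfl
    simp at hr
    exact hp0 hr.symm
  have hr1 : ‖r‖ < 1 := by
    rw [← hr, norm_pow] at hp
    exact (pow_lt_one_iff_of_nonneg (norm_nonneg r) two_ne_zero).1 hp
  have h1 := ellTheta_sq hr0 hr1 (u := w / A) (by positivity)
  rw [hr] at h1
  have h2 : ellTheta (w / A) p = -(w / A) * ellTheta (A / w) p := by
    rw [ellTheta_inv' (u := A / w) hp (by positivity) (inv_div _ _).symm, inv_div]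
  have h3 : (w / A) ^ 2 = q * w ^ 2 / p := by
    rw [← hA]
    field_simp
  rw [h3, ellTheta_div hp0 hp (by positivity), h2] at h1
  unfold halfPeriodTheta
  field_simp at h1 ⊢
  linear_combination h1

theorem contiguityCoeff_mul (hp0 : p ≠ 0) (hp : ‖p‖ < 1) (hr : r ^ 2 = p)
    (hbal : (w * l * b₁ * b₂ * b₃) ^ 2 * q = p) (hw : w ≠ 0) (hθw : ellTheta w p ≠ 0)
    (hlw : pairTheta p l w ≠ 0) :
    contiguityCoeff p r w l b₁ b₂ b₃ *
        (w * ellTheta (l / w) p * (ellTheta w p * ellTheta (w * l * b₁ * b₂ * b₃ / w) p)) =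
      ellTheta (-r) p * (q * (w * l * b₁ * b₂ * b₃) / p) *
        (ellTheta (w ^ 2) p * ellTheta (q * w ^ 2) p *
          (ellTheta (w * b₁) p * ellTheta (w * b₂) p * ellTheta (w * b₃) p) *
          (ellTheta (w * b₁ * b₂) p * ellTheta (w * b₁ * b₃) p * ellTheta (w * b₂ * b₃) p)) := by
  have h := halfPeriodTheta_mul hp0 hp hr hbal hw
  unfold contiguityCoeff prodTheta
  unfold pairTheta at hlw ⊢
  obtain ⟨n1, n2⟩ := mul_ne_zero_iff.1 hlw
  generalize w * l * b₁ * b₂ * b₃ = A at *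
  rw [← pow_two w, mul_comm b₁ w, mul_comm b₂ w, mul_comm b₃ w,
    show b₁ * b₂ * w = w * b₁ * b₂ by ring, show b₁ * b₃ * w = w * b₁ * b₃ by ring,
    show b₂ * b₃ * w = w * b₂ * b₃ by ring]
  generalize halfPeriodTheta p r (w / A) = t at *
  generalize ellTheta (A / w) p = s at *
  generalize ellTheta (q * w ^ 2) p = s' at *
  generalize ellTheta (w ^ 2) p = s'' at *
  rw [div_mul_eq_mul_div, div_eq_iff (by positivity)]
  linear_combination (w * ellTheta (l / w) p * ellTheta w p * (ellTheta (-r) p *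
    (ellTheta (w * b₁ * b₂) p * ellTheta (w * b₁ * b₃) p * ellTheta (w * b₂ * b₃) p) *
    (s'' * ellTheta (l * w) p * ellTheta (w * b₁) p * ellTheta (w * b₂) p *
    ellTheta (w * b₃) p))) * h

/-- The factor of the contiguity relation that belongs to the parameter `w`. -/
noncomputable def contiguityFactor (p q w b₁ b₂ b₃ : ℂ) : ℂ :=
  ellTheta (w ^ 2) p * ellTheta (q * w ^ 2) p *
    (ellTheta (w * b₁) p * ellTheta (w * b₂) p * ellTheta (w * b₃) p) *
    (ellTheta (w * b₁ * b₂) p * ellTheta (w * b₁ * b₃) p * ellTheta (w * b₂ * b₃) p)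

theorem torusGamma_comm : torusGamma p q w l b₁ b₂ b₃ = torusGamma p q l w b₁ b₂ b₃ := by
  unfold torusGamma gammaProd
  simp only [mul_comm (orbitGamma p q w _ _ _)]

/-- Partial products of the five parameters have modulus at least `‖A‖ > ‖p‖ ^ (1 / 2)`, where `A`
is their full product. -/
theorem norm_lt_sq_of_mul_eq {A x y : ℂ} (hp0 : p ≠ 0) (hA : A ^ 2 * q = p) (hq : ‖q‖ < 1)
    (hxy : x * y = A) (hy : ‖y‖ ≤ 1) : ‖p‖ < ‖x‖ ^ 2 := by
  have hA0 : 0 < ‖A‖ := norm_pos_iff.2 <| by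
    rintro rfl
    simp only [ne_eq, OfNat.ofNat_ne_zero, not_false_eq_true, zero_pow, zero_mul] at hA
    exact hp0 hA.symm
  calc ‖p‖ = ‖A‖ ^ 2 * ‖q‖ := by rw [← hA, norm_mul, norm_pow]
    _ < ‖A‖ ^ 2 := mul_lt_of_lt_one_right (by positivity) hq
    _ ≤ ‖x‖ ^ 2 := by
      rw [← hxy, norm_mul]
      gcongr
      exact mul_le_of_le_one_right (norm_nonneg _) hy

theorem ellTheta_ne_zero_of_mul_eq {A x y : ℂ} (hp0 : p ≠ 0) (hA : A ^ 2 * q = p) (hq : ‖q‖ < 1)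
    (hxy : x * y = A) (hy : ‖y‖ ≤ 1) (hx : ‖x‖ < 1) : ellTheta x p ≠ 0 :=
  ellTheta_ne_zero_of_norm ((norm_lt_sq_of_mul_eq hp0 hA hq hxy hy).trans_le
    (pow_le_of_le_one (norm_nonneg _) hx.le two_ne_zero)) hx

theorem contiguityFactor_ne_zero (hp0 : p ≠ 0) (hq : ‖q‖ < 1)
    (hbal : (w * l * b₁ * b₂ * b₃) ^ 2 * q = p)
    (hw1 : ‖w‖ < 1) (hl1 : ‖l‖ < 1) (hb₁ : ‖b₁‖ < 1) (hb₂ : ‖b₂‖ < 1) (hb₃ : ‖b₃‖ < 1) :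
    contiguityFactor p q w b₁ b₂ b₃ ≠ 0 := by
  have m {x y : ℂ} (hx : ‖x‖ < 1) (hy : ‖y‖ < 1) := norm_mul_lt_one hx hy
  have t (x y : ℂ) (hxy : x * y = w * l * b₁ * b₂ * b₃) (hy : ‖y‖ < 1) (hx : ‖x‖ < 1) :
      ellTheta x p ≠ 0 := ellTheta_ne_zero_of_mul_eq hp0 hbal hq hxy hy.le hx
  have hw2 : ‖w ^ 2‖ < 1 := by rw [pow_two]; exact m hw1 hw1
  have n1 : ellTheta (w ^ 2) p ≠ 0 := by
    refine ellTheta_ne_zero_of_norm ?_ hw2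
    rw [norm_pow]
    exact norm_lt_sq_of_mul_eq hp0 hbal hq (y := l * b₁ * b₂ * b₃) (by ring)
      (m (m (m hl1 hb₁) hb₂) hb₃).le
  have n2 : ellTheta (q * w ^ 2) p ≠ 0 := by
    refine ellTheta_ne_zero_of_norm ?_ (m hq hw2)
    have hB : ‖l * b₁ * b₂ * b₃‖ < 1 := m (m (m hl1 hb₁) hb₂) hb₃
    have hp' : p = q * w ^ 2 * (l * b₁ * b₂ * b₃) ^ 2 := by rw [← hbal]; ring
    have h0 : 0 < ‖q * w ^ 2‖ := norm_pos_iff.2 fun h => hp0 (by rw [hp', h, zero_mul])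
    calc ‖p‖ = ‖q * w ^ 2‖ * ‖l * b₁ * b₂ * b₃‖ ^ 2 := by
          rw [← norm_pow, ← norm_mul, ← hp']
      _ < ‖q * w ^ 2‖ := mul_lt_of_lt_one_right h0 (pow_lt_one₀ (norm_nonneg _) hB two_ne_zero)
  unfold contiguityFactor
  refine mul_ne_zero (mul_ne_zero (mul_ne_zero n1 n2) (mul_ne_zero (mul_ne_zero ?_ ?_) ?_))
    (mul_ne_zero (mul_ne_zero ?_ ?_) ?_)
  · exact t _ (l * b₂ * b₃) (by ring) (m (m hl1 hb₂) hb₃) (m hw1 hb₁)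
  · exact t _ (l * b₁ * b₃) (by ring) (m (m hl1 hb₁) hb₃) (m hw1 hb₂)
  · exact t _ (l * b₁ * b₂) (by ring) (m (m hl1 hb₁) hb₂) (m hw1 hb₃)
  · exact t _ (l * b₃) (by ring) (m hl1 hb₃) (m (m hw1 hb₁) hb₂)
  · exact t _ (l * b₂) (by ring) (m hl1 hb₂) (m (m hw1 hb₁) hb₃)
  · exact t _ (l * b₁) (by ring) (m hl1 hb₁) (m (m hw1 hb₂) hb₃)

/-- The contiguity relation with explicit coefficients. If `w = l` both sides are equal by symmetry,
and otherwise `contiguity` applies. -/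
theorem torusGamma_shift (hp0 : p ≠ 0) (hp : ‖p‖ < 1) (hq0 : q ≠ 0) (hq : ‖q‖ < 1)
    (hbal : (w * l * b₁ * b₂ * b₃) ^ 2 * q = p)
    (hw1 : ‖w‖ < 1) (hl1 : ‖l‖ < 1) (hb₁1 : ‖b₁‖ < 1) (hb₂1 : ‖b₂‖ < 1) (hb₃1 : ‖b₃‖ < 1) :
    torusGamma p q (q * w) l b₁ b₂ b₃ = torusGamma p q w (q * l) b₁ b₂ b₃ *
      (contiguityFactor p q w b₁ b₂ b₃ * (ellTheta l p * ellTheta (w * b₁ * b₂ * b₃) p) /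
        (contiguityFactor p q l b₁ b₂ b₃ * (ellTheta w p * ellTheta (l * b₁ * b₂ * b₃) p))) := by
  have m {x y : ℂ} (hx : ‖x‖ < 1) (hy : ‖y‖ < 1) := norm_mul_lt_one hx hy
  have t (x y : ℂ) (hxy : x * y = w * l * b₁ * b₂ * b₃) (hy : ‖y‖ < 1) (hx : ‖x‖ < 1) :
      ellTheta x p ≠ 0 := ellTheta_ne_zero_of_mul_eq hp0 hbal hq hxy hy.le hx
  have hbal' : (l * w * b₁ * b₂ * b₃) ^ 2 * q = p := by rw [← hbal]; ring
  have nl : contiguityFactor p q l b₁ b₂ b₃ ≠ 0 :=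
    contiguityFactor_ne_zero hp0 hq hbal' hl1 hw1 hb₁1 hb₂1 hb₃1
  have hθw : ellTheta w p ≠ 0 :=
    t _ (l * b₁ * b₂ * b₃) (by ring) (m (m (m hl1 hb₁1) hb₂1) hb₃1) hw1
  have hθl : ellTheta l p ≠ 0 :=
    t _ (w * b₁ * b₂ * b₃) (by ring) (m (m (m hw1 hb₁1) hb₂1) hb₃1) hl1
  have hθlb : ellTheta (l * b₁ * b₂ * b₃) p ≠ 0 :=
    t _ w (by ring) hw1 (m (m (m hl1 hb₁1) hb₂1) hb₃1)
  have hθwb : ellTheta (w * b₁ * b₂ * b₃) p ≠ 0 :=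
    t _ l (by ring) hl1 (m (m (m hw1 hb₁1) hb₂1) hb₃1)
  have hθwl : ellTheta (w * l) p ≠ 0 :=
    t _ (b₁ * b₂ * b₃) (by ring) (m (m hb₁1 hb₂1) hb₃1) (m hw1 hl1)
  by_cases hwl : w = l
  · subst hwl
    rw [torusGamma_comm, div_self (mul_ne_zero nl (mul_ne_zero hθw hθwb)), mul_one]
  have hA0 : w * l * b₁ * b₂ * b₃ ≠ 0 := by
    intro h
    simp only [h, ne_eq, OfNat.ofNat_ne_zero, not_false_eq_true, zero_pow, zero_mul] at hbal
    exact hp0 hbal.symm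
  have hb₃ := right_ne_zero_of_mul hA0
  have hb₂ := right_ne_zero_of_mul (left_ne_zero_of_mul hA0)
  have hb₁ := right_ne_zero_of_mul (left_ne_zero_of_mul (left_ne_zero_of_mul hA0))
  have hwl0 := left_ne_zero_of_mul (left_ne_zero_of_mul (left_ne_zero_of_mul hA0))
  have hw := left_ne_zero_of_mul hwl0
  have hl := right_ne_zero_of_mul hwl0
  have hwp : ‖p‖ < ‖w‖ ^ 2 := norm_lt_sq_of_mul_eq hp0 hbal hq (y := l * b₁ * b₂ * b₃) (by ring)
    (m (m (m hl1 hb₁1) hb₂1) hb₃1).le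
  have hlp : ‖p‖ < ‖l‖ ^ 2 := norm_lt_sq_of_mul_eq hp0 hbal hq (y := w * b₁ * b₂ * b₃) (by ring)
    (m (m (m hw1 hb₁1) hb₂1) hb₃1).le
  have hinv {x : ℂ} (hx : ‖x‖ < 1) : ‖x‖ ^ 2 < ‖p‖⁻¹ :=
    (pow_lt_one₀ (norm_nonneg _) hx two_ne_zero).trans
      ((one_lt_inv₀ (norm_pos_iff.2 hp0)).2 hp)
  have hdlw : ellTheta (l / w) p ≠ 0 := ellTheta_ne_zero hp fun k h =>
    ne_zpow_mul_of_norm hp0 hp hwl ⟨hwp, hinv hw1⟩ ⟨hlp, hinv hl1⟩ k ((div_eq_iff hw).1 h)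
  have hdwl : ellTheta (w / l) p = -(w / l) * ellTheta (l / w) p := by
    rw [ellTheta_inv' (u := l / w) hp (by positivity) (inv_div _ _).symm, inv_div]
  have hlw : pairTheta p l w ≠ 0 := mul_ne_zero (by rwa [mul_comm]) hdlw
  have hwl' : pairTheta p w l ≠ 0 := by
    refine mul_ne_zero hθwl ?_
    rw [hdwl]
    exact mul_ne_zero (neg_ne_zero.2 (by positivity)) hdlw
  obtain ⟨r, hr⟩ := IsAlgClosed.exists_pow_nat_eq p two_pos
  have hr1 : ‖r‖ < 1 := by
    rw [← hr, norm_pow] at hp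
    exact (pow_lt_one_iff_of_nonneg (norm_nonneg r) two_ne_zero).1 hp
  have hr0 : 0 < ‖r‖ := norm_pos_iff.2 <| by
    rintro rfl
    simp at hr
    exact hp0 hr.symm
  have hθr : ellTheta (-r) p ≠ 0 := by
    refine ellTheta_ne_zero_of_norm ?_ (by rwa [norm_neg])
    rw [norm_neg, ← hr, norm_pow, pow_two]
    exact mul_lt_of_lt_one_right hr0 hr1
  have h := contiguity hp0 hp hq0 hq hr hbal hwp hw1 hlp hl1 hwl hb₁ hb₂ hb₃ hb₁1 hb₂1 hb₃1 hθw hθl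
    hlw hwl'
  have ew : w * l * b₁ * b₂ * b₃ / w = l * b₁ * b₂ * b₃ := by field_simp
  have el : l * w * b₁ * b₂ * b₃ / l = w * b₁ * b₂ * b₃ := by field_simp
  have cw := contiguityCoeff_mul hp0 hp hr hbal hw hθw hlw
  have cl := contiguityCoeff_mul hp0 hp hr hbal' hl hθl hwl'
  rw [ew] at cw
  rw [el, hdwl, mul_comm l w] at cl
  change _ = _ * contiguityFactor p q w b₁ b₂ b₃ at cw
  change _ = _ * contiguityFactor p q l b₁ b₂ b₃ at cl
  have hK : ellTheta (-r) p * (q * (w * l * b₁ * b₂ * b₃) / p) ≠ 0 := by positivity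
  generalize ellTheta (-r) p * (q * (w * l * b₁ * b₂ * b₃) / p) = K at *
  generalize ellTheta (l * b₁ * b₂ * b₃) p = s₁ at *
  generalize ellTheta (w * b₁ * b₂ * b₃) p = s₂ at *
  generalize contiguityFactor p q w b₁ b₂ b₃ = N₁ at *
  generalize contiguityFactor p q l b₁ b₂ b₃ = N₂ at *
  generalize torusGamma p q (q * w) l b₁ b₂ b₃ = J₁ at *
  generalize torusGamma p q w (q * l) b₁ b₂ b₃ = J₂ at *
  generalize contiguityCoeff p r w l b₁ b₂ b₃ = c₁ at *
  generalize contiguityCoeff p r l w b₁ b₂ b₃ = c₂ at *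
  rw [← mul_div_assoc, eq_div_iff (by positivity)]
  refine mul_left_cancel₀ hK ?_
  have cl' : c₂ * (-w * ellTheta (l / w) p * (ellTheta l p * s₂)) = K * N₂ := by
    rw [← cl]
    field_simp
  linear_combination (J₂ * ellTheta l p * s₂) * cw - (J₁ * ellTheta w p * s₁) * cl' -
    (w * ellTheta (l / w) p * ellTheta w p * s₁ * ellTheta l p * s₂) * h

end Coefficients

theorem g2Integral_eq_torusGamma {p q w l b₁ b₂ b₃ : ℂ} {a : Fin 5 → ℂ} (hp : ‖p‖ < 1)
    (hq : ‖q‖ < 1) (h : ∀ f : ℂ → ℂ, ∏ i, f (a i) = f w * f l * f b₁ * f b₂ * f b₃)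
    (hw : w ≠ 0) (hl : l ≠ 0) (hb₁ : b₁ ≠ 0) (hb₂ : b₂ ≠ 0) (hb₃ : b₃ ≠ 0)
    (hw1 : ‖w‖ < 1) (hl1 : ‖l‖ < 1) (hb₁1 : ‖b₁‖ < 1) (hb₂1 : ‖b₂‖ < 1) (hb₃1 : ‖b₃‖ < 1) :
    g2Integral p q a = 1 / (2 * Real.pi) ^ 2 * torusGamma p q w l b₁ b₂ b₃ := by
  refine g2Integral_eq_torusMean
    (torusContinuous_gammaProd hp hq hw hl hb₁ hb₂ hb₃ hw1 hl1 hb₁1 hb₂1 hb₃1) fun z h0 h1 => ?_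
  rw [g2Phi_eq hp hq a h0 h1, h fun a => orbitGamma p q a _ _ _, gammaProd]

/-- The indices other than `k`, listed in increasing order, and the corresponding products. -/
theorem exists_complement (k : Fin 4) : ∃ i₁ i₂ i₃ : Fin 4, i₁ ≠ k ∧ i₂ ≠ k ∧ i₃ ≠ k ∧
    (∀ f : Fin 4 → ℂ, ∏ i, f i = f k * f i₁ * f i₂ * f i₃) ∧
    (∀ f : Fin 4 → ℂ, (∏ i with i ≠ k, f i) = f i₁ * f i₂ * f i₃) ∧
    ∀ f : Fin 4 × Fin 4 → ℂ, (∏ ij with ij.1 < ij.2 ∧ ij.1 ≠ k ∧ ij.2 ≠ k, f ij) =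
      f (i₁, i₂) * f (i₁, i₃) * f (i₂, i₃) := by
  have key : ∃ i₁ i₂ i₃ : Fin 4, i₁ ≠ k ∧ i₂ ≠ k ∧ i₃ ≠ k ∧ i₁ ≠ i₂ ∧ i₁ ≠ i₃ ∧ i₂ ≠ i₃ ∧
      (Finset.univ.filter fun i => i ≠ k) = {i₁, i₂, i₃} ∧
      (Finset.univ.filter fun ij : Fin 4 × Fin 4 => ij.1 < ij.2 ∧ ij.1 ≠ k ∧ ij.2 ≠ k) =
        {(i₁, i₂), (i₁, i₃), (i₂, i₃)} := by
    fin_cases k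
    · exact ⟨1, 2, 3, by decide⟩
    · exact ⟨0, 2, 3, by decide⟩
    · exact ⟨0, 1, 3, by decide⟩
    · exact ⟨0, 1, 2, by decide⟩
  obtain ⟨i₁, i₂, i₃, h1, h2, h3, h12, h13, h23, e1, e2⟩ := key
  have t (f : Fin 4 → ℂ) : (∏ i with i ≠ k, f i) = f i₁ * f i₂ * f i₃ := by
    rw [e1, Finset.prod_insert (by simp [h12, h13]), Finset.prod_pair h23, mul_assoc]
  refine ⟨i₁, i₂, i₃, h1, h2, h3, fun f => ?_, t, fun f => ?_⟩
  · rw [← Finset.mul_prod_erase _ _ (Finset.mem_univ k), ← Finset.filter_ne' , t]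
    ring
  · rw [e2, Finset.prod_insert (by simp [h12, h23]), Finset.prod_pair (by simp [h12]), mul_assoc]

end

theorem proposition3p1 (p q : ℂ) (hp : p ≠ 0) (hpq : ‖p‖ < ‖q‖) (hq : ‖q‖ < 1)
    (a : Fin 5 → ℂ) (hbal : (∏ i : Fin 5, a i) ^ 2 = p * q)
    (ha : ∀ i : Fin 4, ‖a i.castSucc‖ < 1) (ha5 : ‖a (Fin.last 4)‖ < ‖q‖) (k : Fin 4) :
    g2Integral p q (qShift q k a) =
      g2Integral p q a *
        ((ellTheta (a k.castSucc ^ 2) p * ellTheta (q * a k.castSucc ^ 2) p *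
            ellTheta (q⁻¹ * a (Fin.last 4)) p * ellTheta (∏ i : Fin 4, a i.castSucc) p) /
          (ellTheta ((q ^ 2)⁻¹ * a (Fin.last 4) ^ 2) p *
            ellTheta (q⁻¹ * a (Fin.last 4) ^ 2) p * ellTheta (a k.castSucc) p *
            ellTheta (q⁻¹ * (∏ i : Fin 5, a i) / a k.castSucc) p)) *
        (∏ i : Fin 4 with i ≠ k,
          ellTheta (a k.castSucc * a i.castSucc) p /
            ellTheta (q⁻¹ * a (Fin.last 4) * a i.castSucc) p) *
        (∏ ij : Fin 4 × Fin 4 with ij.1 < ij.2 ∧ ij.1 ≠ k ∧ ij.2 ≠ k,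
          ellTheta (a k.castSucc * a ij.1.castSucc * a ij.2.castSucc) p /
            ellTheta (q⁻¹ * a (Fin.last 4) * a ij.1.castSucc * a ij.2.castSucc) p) := by
  have hq0 : 0 < ‖q‖ := (norm_nonneg _).trans_lt hpq
  have nq : q ≠ 0 := norm_pos_iff.1 hq0
  have hp1 : ‖p‖ < 1 := hpq.trans hq
  have ha0 : ∀ i, a i ≠ 0 := by
    have h : ∏ i : Fin 5, a i ≠ 0 := fun h => mul_ne_zero hp nq (by rw [← hbal, h]; simp)
    exact fun i => Finset.prod_ne_zero_iff.1 h i (Finset.mem_univ i)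
  obtain ⟨i₁, i₂, i₃, n1, n2, n3, e4, e3, e6⟩ := exists_complement k
  have e5 (f : Fin 5 → ℂ) : ∏ i, f i = f k.castSucc * f (Fin.last 4) * f i₁.castSucc *
      f i₂.castSucc * f i₃.castSucc := by
    rw [Fin.prod_univ_castSucc, e4]
    ring
  rw [e3, e6, e4, e5]
  rw [e5] at hbal
  set w := a k.castSucc with hw
  obtain ⟨l, hl⟩ : ∃ l, a (Fin.last 4) = q * l := ⟨q⁻¹ * a (Fin.last 4), by field_simp⟩
  have hl0 : l ≠ 0 := by
    rintro rfl
    exact ha0 (Fin.last 4) (by rw [hl, mul_zero])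
  have hl1 : ‖l‖ < 1 := by
    rw [hl, norm_mul] at ha5
    exact (mul_lt_iff_lt_one_right hq0).1 ha5
  have hs {x : ℂ} (hx : ‖x‖ < 1) : ‖q * x‖ < 1 := norm_mul_lt_one hq hx
  have hI : g2Integral p q a = 1 / (2 * Real.pi) ^ 2 *
      torusGamma p q w (q * l) (a i₁.castSucc) (a i₂.castSucc) (a i₃.castSucc) :=
    g2Integral_eq_torusGamma hp1 hq (fun f => by rw [e5 fun i => f (a i), hl]) (ha0 _)
      (mul_ne_zero nq hl0) (ha0 _) (ha0 _) (ha0 _) (ha _) (hs hl1) (ha _) (ha _) (ha _)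
  have hI' : g2Integral p q (qShift q k a) = 1 / (2 * Real.pi) ^ 2 *
      torusGamma p q (q * w) l (a i₁.castSucc) (a i₂.castSucc) (a i₃.castSucc) := by
    have s1 : qShift q k a (Fin.last 4) = l := by
      rw [qShift, Function.update_self, hl]
      field_simp
    have s2 : qShift q k a k.castSucc = q * w := by
      rw [qShift, Function.update_of_ne (Fin.castSucc_ne_last k), Function.update_self]
    have s3 {i : Fin 4} (h : i ≠ k) : qShift q k a i.castSucc = a i.castSucc := by
      rw [qShift, Function.update_of_ne (Fin.castSucc_ne_last i),
        Function.update_of_ne (fun e => h (Fin.castSucc_injective _ e))]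
    exact g2Integral_eq_torusGamma hp1 hq
      (fun f => by rw [e5 fun i => f (qShift q k a i), s1, s2, s3 n1, s3 n2, s3 n3])
      (mul_ne_zero nq (ha0 _)) hl0 (ha0 _) (ha0 _) (ha0 _) (hs (ha _)) hl1 (ha _) (ha _) (ha _)
  rw [hl] at hbal ⊢
  rw [hI, hI', torusGamma_shift hp hp1 nq hq (mul_right_cancel₀ nq
    (by rw [← hbal]; ring)) (ha k) hl1 (ha i₁) (ha i₂) (ha i₃), inv_mul_cancel_left₀ nq,
    show (q ^ 2)⁻¹ * (q * l) ^ 2 = l ^ 2 by field_simp,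
    show q⁻¹ * (q * l) ^ 2 = q * l ^ 2 by field_simp,
    show q⁻¹ * (w * (q * l) * a i₁.castSucc * a i₂.castSucc * a i₃.castSucc) / w =
      l * a i₁.castSucc * a i₂.castSucc * a i₃.castSucc by
        have hw0 : w ≠ 0 := ha0 k.castSucc
        field_simp]
  unfold contiguityFactor
  simp only [div_eq_mul_inv, mul_inv]
  ring
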